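/- **Conventions.** A lattice is a finitely generated free abelian group. An RPC is a pair $(\tau,N_\tau)$ of a lattice $N_\tau$ and a full-dimensional, strictly convex rational polyhedral cone $\tau\subseteq N_{\tau,\mathbb R}$; a morphism $\rho\to\tau$ is a homomorphism $N_\rho\to N_\tau$ mapping $\rho$ into $\tau$. Put $M_\tau=\mathrm{Hom}(N_\tau,\mathbb Z)$, with $a\le b$ iff $b-a\in\tau^\vee$. Stacks over $\mathrm{RPC}$ are categories fibered in groupoids over the category of RPCs; a monomorphism is a fully faithful morphism. Fix an RPC $(\sigma,N_\sigma)$, lattices $M,M'$ with duals $N,N'$, and a symmetric bilinear form $Q:M\times M\to M_\sigma$ with $Q(m,m)\in\sigma^\vee\setminus\{0\}$ for all $m\ne 0$. Write $Q_\tau$ for the composition of $Q$ with $M_\sigma\to M_\tau$ when $\tau\to\sigma$ is given, and $Q_{\hom,N}(m):N_\sigma\to N$ for $n\mapsto Q(m,\cdot)(n)$. The tropical abelian variety $A$ over $\sigma$ assigns to $\tau\to\sigma$ the set of $\phi\in\mathrm{Hom}(M,M_\tau)$ such that for every $m$ there are $m_1,m_2\in M$ with $Q_\tau(m_1,m)\le\phi(m)\le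 Q_\tau(m_2,m)$, modulo translation by the $Q_\tau(m,\cdot)$, $m\in M$. The tropical torus is $T_{N'}^{\mathrm{trop}}(\tau)=\mathrm{Hom}(N_\tau,N')$. Let $X=A\times T_{N'}^{\mathrm{trop}}\to\sigma$. A lift of $([\phi],\psi)\in X(\tau)$, with structure map $f:\tau\to\sigma$, is the map $N_\tau\to L:=N_\sigma\times N\times N'$, $n\mapsto(f(n),\phi(\cdot)(n),\psi(n))$, for a representative $\phi$ of the class. **Compactifications.** A subdivision of an RPC $\tau$ is the cone complex over $\tau$ of a finite fan with support $\tau$, each cone $\delta$ carrying the lattice $N_\tau\cap\mathrm{Span}\,\delta$; a morphism of stacks is a subdivision if all its base changes to RPCs are. A partial tropical compactification of $X\to\sigma$ is a monomorphism $Y\to X$ whose base change to every RPC is a finite cone stack (the stack glued along faces from a category fibered in groupoids over RPCs with face morphisms that has finitely many objects up to isomorphism and finite Hom sets), and through which the zero section $\sigma\to X$ factors. A generalized partial tropical compactification is a monomorphism $Y\to X$ for which there is a subdivision $Y'\to Y$ such that $Y'\to X$ is a partial tropical compactification. It is minimal if for every stack $Y_1\to X$, every subdivision $Y_2\to Y_1$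 and every morphism $f:Y_2\to Y$ over $X$ there is a unique morphism $Y_1\to Y$ over $X$ whose composition with $Y_2\to Y_1$ is $f$. Isomorphisms are taken over $X$. **Minimal fans.** Let $(N_\sigma\times N)^{(M)}$ be the set of $(n,n')\in N_\sigma\times N$ with $n\in\sigma$ and $n'$ in the $\mathbb Q$-span of $Q_{\hom,N}(M)(n)$, and put $T_m(n,n',n'')=(n,n'+Q_{\hom,N}(m)(n),n'')$ on $L$. A stacky fan is a set $\Delta$ of strictly convex rational polyhedral cones $\tau$ contained in the convex hull of $(N_\sigma\times N)^{(M)}\times N'$ in $L_{\mathbb R}$, with finite-index sublattices $\tilde N_\tau\subseteq L\cap\mathrm{Span}\,\tau$, such that: (i) any two cones $\tau,\tau'\in\Delta$ intersect in a common face, and $\tilde N_\tau\cap\mathrm{Span}(\tau\cap\tau')=\tilde N_{\tau'}\cap\mathrm{Span}(\tau\cap\tau')$; (ii) faces of cones of $\Delta$ are in $\Delta$; (iii) for $\tau\in\Delta$ and $m\in M$, $T_m(\tau)\in\Delta$ with lattice $T_m(\tilde N_\tau)$, and $T_m$ fixes $\tau\cap T_m(\tau)$ pointwise; (iv) $\Delta$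 has finitely many cones up to translation by the $T_m$; (v) $\sigma\times\{0\}\times\{0\}\in\Delta$, with lattice $L\cap\mathrm{Span}(\sigma\times\{0\}\times\{0\})$. A minimal fan is a set $S\subseteq L$ of the form $S=\bigcup_{\tau\in\Delta}\tau\cap\tilde N_\tau$ for some stacky fan $\Delta$. For a minimal fan $S$, let $\Sigma_S\subseteq X$ be the substack of those morphisms $\tau\to X$ all of whose lifts $N_\tau\to L$ map $\tau\cap N_\tau$ into $S$. **Corollary.** 1. Every minimal generalized partial tropical compactification of $X\to\sigma$ is isomorphic over $X$ to $\Sigma_S$ for some minimal fan $S$. 2. If $S,S'$ are minimal fans and $\Sigma_S\cong\Sigma_{S'}$ over $X$, then $S=S'$. -/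

import Mathlib

open CategoryTheory TensorProduct Opposite

noncomputable section

namespace TropMin

/-! ### Lattices and rational polyhedral cones -/

/-- The real vector space `N_ℝ = ℝ ⊗ N` of a lattice `N`. -/
abbrev RealExt (N : Type) [AddCommGroup N] : Type := ℝ ⊗[ℤ] N

/-- The canonical map `N → N_ℝ`. -/
def latPt {N : Type} [AddCommGroup N] (n : N) : RealExt N := (1 : ℝ) ⊗ₜ[ℤ] n

/-- The real linear map `N_ℝ → N'_ℝ` induced by a homomorphism `N → N'`. -/
def realMap {N N' : Type} [AddCommGroup N] [AddCommGroup N'] (f : N →ₗ[ℤ] N') :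
    RealExt N →ₗ[ℝ] RealExt N' := f.baseChange ℝ

/-- The real linear span of a cone. -/
def coneSpan {N : Type} [AddCommGroup N] (C : PointedCone ℝ (RealExt N)) :
    Submodule ℝ (RealExt N) := Submodule.span ℝ (C : Set (RealExt N))

/-- Rational polyhedral cones: generated by finitely many lattice points and strictly convex. -/
structure IsRationalCone {N : Type} [AddCommGroup N] (C : PointedCone ℝ (RealExt N)) : Prop where
  generated : ∃ s : Finset N, C = PointedCone.hull ℝ (latPt '' (s : Set N))
  strictlyConvex : ∀ x ∈ C, -x ∈ C → x = 0

/-- An RPC `(σ, N_σ)`: a lattice together with a full-dimensional rational polyhedral cone. -/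
structure RPC : Type 1 where
  N : Type
  [grp : AddCommGroup N]
  [free : Module.Free ℤ N]
  [fin : Module.Finite ℤ N]
  cone : PointedCone ℝ (RealExt N)
  rational : IsRationalCone cone
  full : coneSpan cone = ⊤

attribute [instance] RPC.grp RPC.free RPC.fin

/-- A morphism of RPCs: a homomorphism of lattices that maps the cone into the cone. -/
@[ext]
structure RPCHom (ρ τ : RPC) : Type where
  lin : ρ.N →ₗ[ℤ] τ.N
  maps : ∀ x ∈ ρ.cone, realMap lin x ∈ τ.cone

lemma realMap_id {N : Type} [AddCommGroup N] (x : RealExt N) :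
    realMap (LinearMap.id : N →ₗ[ℤ] N) x = x := by
  simp [realMap]

lemma realMap_comp {N N' N'' : Type} [AddCommGroup N] [AddCommGroup N'] [AddCommGroup N'']
    (g : N' →ₗ[ℤ] N'') (f : N →ₗ[ℤ] N') (x : RealExt N) :
    realMap (g.comp f) x = realMap g (realMap f x) := by
  simp [realMap, LinearMap.baseChange_comp]

lemma realMap_latPt {N N' : Type} [AddCommGroup N] [AddCommGroup N'] (f : N →ₗ[ℤ] N') (n : N) :
    realMap f (latPt n) = latPt (f n) := by
  simp [realMap, latPt]

instance : Category RPC where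
  Hom := RPCHom
  id ρ := ⟨LinearMap.id, fun x hx => by rwa [realMap_id]⟩
  comp f g := ⟨g.lin.comp f.lin, fun x hx => by
    rw [realMap_comp]; exact g.maps _ (f.maps _ hx)⟩

/-! ### Stacks over the category of RPCs -/

/-- A functor exhibiting its source as a category fibered in groupoids over its target. -/
structure IsFiberedInGroupoids {𝒳 𝒮 : Type 1} [Category.{0} 𝒳] [Category.{0} 𝒮] (p : 𝒳 ⥤ 𝒮) :
    Prop where
  lift : ∀ (a : 𝒳) {R : 𝒮} (f : R ⟶ p.obj a), ∃ (b : 𝒳) (φ : b ⟶ a), p.IsHomLift f φ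
  cartesian : ∀ {a b : 𝒳} (φ : a ⟶ b), p.IsStronglyCartesian (p.map φ) φ

/-- A stack over `RPC`. An RPC is a face of itself and is contained in no proper face, so every
covering by faces contains an isomorphism: the topology is the chaotic one, and a stack is a
category fibered in groupoids. -/
structure RPCStack extends BasedCategory.{0, 1} RPC where
  fibered : IsFiberedInGroupoids toBasedCategory.p

/-- Points of a presheaf `P` on `RPC`: pairs of an RPC `τ` and an element of `P(τ)`. -/
structure PshPt (P : RPCᵒᵖ ⥤ Type) : Type 1 where
  base : RPC
  pt : P.obj (op base)

/-- A morphism `(ρ, y) → (τ, x)` is a morphism `g : ρ → τ` with `g^* x = y`. -/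
@[ext]
structure PshPt.Hom {P : RPCᵒᵖ ⥤ Type} (a b : PshPt P) : Type where
  base : a.base ⟶ b.base
  map_pt : P.map base.op b.pt = a.pt

instance (P : RPCᵒᵖ ⥤ Type) : Category (PshPt P) where
  Hom := PshPt.Hom
  id a := ⟨𝟙 _, by simp⟩
  comp f g := ⟨f.base ≫ g.base, by simp [f.map_pt, g.map_pt]⟩
  id_comp f := PshPt.Hom.ext (Category.id_comp f.base)
  comp_id f := PshPt.Hom.ext (Category.comp_id f.base)
  assoc f g h := PshPt.Hom.ext (Category.assoc f.base g.base h.base)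

/-- The projection `(τ, x) ↦ τ`. -/
def PshPt.proj (P : RPCᵒᵖ ⥤ Type) : PshPt P ⥤ RPC where
  obj a := a.base
  map f := PshPt.Hom.base f

lemma PshPt.fibered (P : RPCᵒᵖ ⥤ Type) : IsFiberedInGroupoids (PshPt.proj P) where
  lift a R f := by
    let φ : (⟨R, P.map f.op a.pt⟩ : PshPt P) ⟶ a := ⟨f, rfl⟩
    exact ⟨_, φ, (inferInstance : (PshPt.proj P).IsHomLift ((PshPt.proj P).map φ) φ)⟩
  cartesian {a b} φ :=
    { universal_property' := by
        intro a' g φ' h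
        have h1 : g ≫ (PshPt.proj P).map φ = (PshPt.proj P).map φ' :=
          IsHomLift.eq_of_isHomLift (PshPt.proj P) _ φ'
        have h2 : g ≫ PshPt.Hom.base φ = PshPt.Hom.base φ' := h1
        let χ : a' ⟶ a := ⟨g, by
          rw [← PshPt.Hom.map_pt φ, ← PshPt.Hom.map_pt φ', ← h2]
          exact (P.map_comp_apply (PshPt.Hom.base φ).op (Quiver.Hom.op g) b.pt).symm⟩
        refine ⟨χ, ⟨(inferInstance : (PshPt.proj P).IsHomLift ((PshPt.proj P).map χ) χ),
          PshPt.Hom.ext h2⟩, ?_⟩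
        rintro χ' ⟨h3, -⟩
        have h4 : g = (PshPt.proj P).map χ' := IsHomLift.eq_of_isHomLift (PshPt.proj P) _ χ'
        exact PshPt.Hom.ext h4.symm }

/-- The stack (fibered in sets) of a presheaf of sets. -/
def stackOf (P : RPCᵒᵖ ⥤ Type) : RPCStack where
  obj := PshPt P
  p := PshPt.proj P
  fibered := PshPt.fibered P

/-- The functor `(τ, x) ↦ (τ, η(x))` induced by a morphism of presheaves. -/
def PshPt.mapFunctor {P P' : RPCᵒᵖ ⥤ Type} (η : P ⟶ P') : PshPt P ⥤ PshPt P' where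
  obj a := ⟨a.base, η.app _ a.pt⟩
  map {a b} f :=
    { base := (show PshPt.Hom a b from f).base
      map_pt := by
        rw [← PshPt.Hom.map_pt f]
        exact (NatTrans.naturality_apply η (PshPt.Hom.base f).op b.pt).symm }
  map_id _ := rfl
  map_comp _ _ := rfl

/-- The morphism of stacks induced by a morphism of presheaves. -/
def stackMap {P P' : RPCᵒᵖ ⥤ Type} (η : P ⟶ P') :
    (stackOf P).toBasedCategory ⥤ᵇ (stackOf P').toBasedCategory where
  toFunctor := PshPt.mapFunctor η
  w := rfl

/-- The stack represented by an RPC. -/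
def coneStackOf (τ : RPC) : RPCStack := stackOf (yoneda.obj τ)

/-! ### Properties of morphisms of stacks -/

section Morphisms

variable {Y Y' X : BasedCategory.{0, 1} RPC}

/-- A monomorphism of stacks: a fully faithful morphism. -/
def IsMono (F : Y ⥤ᵇ X) : Prop := F.toFunctor.Full ∧ F.toFunctor.Faithful

/-- `Y` and `Y'` are isomorphic over `X`. -/
def IsoOver (F : Y ⥤ᵇ X) (F' : Y' ⥤ᵇ X) : Prop :=
  ∃ G : Y ⥤ᵇ Y', G.toFunctor.IsEquivalence ∧ Nonempty (G.comp F' ≅ F)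

/-- The base change `Y ×_X τ` of `F : Y → X` along the morphism `τ → X` given by an object `x` of
`X` over an RPC `τ`. An object over `ρ` consists of a `y` over `ρ`, a morphism `g : ρ → τ` and an
isomorphism `F(y) ≅ g^* x`; as all morphisms of `X` are cartesian, the last two are the same as a
morphism `F(y) → x`. -/
def baseChange (F : Y ⥤ᵇ X) (x : X.obj) : BasedCategory.{0, 1} RPC where
  obj := CostructuredArrow F.toFunctor x
  p := CostructuredArrow.proj F.toFunctor x ⋙ Y.p

/-- The projection `Y ×_X τ → τ`; the stack represented by `τ` is `Over τ`. -/
def baseChangeProj (F : Y ⥤ᵇ X) (x : X.obj) : (baseChange F x).obj ⥤ Over (X.p.obj x) :=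
  CostructuredArrow.toOver F.toFunctor x ⋙ Over.post X.p

end Morphisms

/-- A finite fan with support `τ`. Each cone `δ` carries the lattice `N_τ ∩ Span δ`. -/
structure ConeSubdivision (τ : RPC) where
  cones : Set (PointedCone ℝ (RealExt τ.N))
  finite : cones.Finite
  rational : ∀ δ ∈ cones, IsRationalCone δ
  face_mem : ∀ δ ∈ cones, ∀ F : PointedCone ℝ (RealExt τ.N), F.IsFaceOf δ → F ∈ cones
  inter_face : ∀ δ ∈ cones, ∀ δ' ∈ cones, (δ ⊓ δ').IsFaceOf δ ∧ (δ ⊓ δ').IsFaceOf δ'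
  support : ∀ x : RealExt τ.N, x ∈ τ.cone ↔ ∃ δ ∈ cones, x ∈ δ

/-- `Z → τ` is a subdivision: it is equivalent over `τ` to the cone complex of a finite fan `Δ` in
`τ` with support `τ`, that is, to the subsheaf of `τ` of all morphisms `ρ → τ` that factor through
some cone `(δ, N_τ ∩ Span δ)` of `Δ`. -/
def IsConeSubdivision {Z : Type 1} [Category.{0} Z] {τ : RPC} (K : Z ⥤ Over τ) : Prop :=
  ∃ Δ : ConeSubdivision τ, K.Full ∧ K.Faithful ∧
    ∀ f : Over τ, K.essImage f ↔
      ∃ δ ∈ Δ.cones, ∀ x ∈ f.left.cone, realMap f.hom.lin x ∈ δ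

/-- A morphism of stacks is a subdivision if its base change to every RPC is one. -/
def IsSubdivision {Y X : BasedCategory.{0, 1} RPC} (F : Y ⥤ᵇ X) : Prop :=
  ∀ x : X.obj, IsConeSubdivision (baseChangeProj F x)

/-! ### Cone stacks -/

/-- Face morphisms: isomorphisms onto a face `F` of the target `τ` with its lattice
`N_τ ∩ Span F`. -/
def faceMor : MorphismProperty RPC := fun ρ τ f =>
  Function.Injective f.lin ∧ (ρ.cone.map (realMap f.lin)).IsFaceOf τ.cone ∧
    ∀ n : τ.N, latPt n ∈ coneSpan (ρ.cone.map (realMap f.lin)) → n ∈ LinearMap.range f.lin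

lemma realMap_injective {N N' : Type} [AddCommGroup N] [AddCommGroup N'] {f : N →ₗ[ℤ] N'}
    (hf : Function.Injective f) : Function.Injective (realMap f) :=
  Module.Flat.lTensor_preserves_injective_linearMap (M := ℝ) f hf

instance : faceMor.IsMultiplicative where
  id_mem τ := by
    have h : (𝟙 τ : τ ⟶ τ).lin = LinearMap.id := rfl
    refine ⟨fun a b hab => hab, ?_, fun n _ => ⟨n, rfl⟩⟩
    have h' : τ.cone.map (realMap (𝟙 τ : τ ⟶ τ).lin) = τ.cone := by
      ext x
      simp [h, realMap_id]
    rw [h']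
  comp_mem {ρ τ υ} f g hf hg := by
    obtain ⟨hf1, hf2, hf3⟩ := hf
    obtain ⟨hg1, hg2, hg3⟩ := hg
    have hl : (f ≫ g).lin = g.lin.comp f.lin := rfl
    have hm : ρ.cone.map (realMap (f ≫ g).lin) =
        (ρ.cone.map (realMap f.lin)).map (realMap g.lin) := by
      ext x
      simp [hl, realMap_comp]
    have hinj := realMap_injective hg1
    have hle : (ρ.cone.map (realMap f.lin)).map (realMap g.lin) ≤
        τ.cone.map (realMap g.lin) := by
      rintro x ⟨y, hy, rfl⟩
      exact ⟨y, hf2.le hy, rfl⟩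
    refine ⟨hg1.comp hf1, ?_, ?_⟩
    · rw [hm]
      refine ⟨hle.trans hg2.le, ?_⟩
      intro x y a hx hy ha h
      have hx' := hg2.mem_of_smul_add_mem hx hy ha (hle h)
      have hay : a • x + y ∈ τ.cone.map (realMap g.lin) := hle h
      have hy' : y ∈ τ.cone.map (realMap g.lin) := by
        refine hg2.mem_of_smul_add_smul_mem_right hx hy ha one_pos ?_
        simpa using hay
      obtain ⟨x', hx1, rfl⟩ := hx'
      obtain ⟨y', hy1, rfl⟩ := hy'
      obtain ⟨z, hz, hz'⟩ := h
      have hz2 : z = a • x' + y' := hinj (by simpa using hz')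
      subst hz2
      exact ⟨x', hf2.mem_of_smul_add_mem hx1 hy1 ha hz, rfl⟩
    · intro n hn
      rw [hm] at hn
      obtain ⟨n', rfl⟩ := hg3 n (Submodule.span_mono hle hn)
      have h1 : coneSpan ((ρ.cone.map (realMap f.lin)).map (realMap g.lin)) =
          (coneSpan (ρ.cone.map (realMap f.lin))).map (realMap g.lin) := by
        rw [coneSpan, coneSpan, Submodule.map_span]
        rfl
      rw [h1, ← realMap_latPt] at hn
      obtain ⟨z, hz, hz'⟩ := hn
      have hz2 : z = latPt n' := hinj hz'
      subst hz2
      obtain ⟨k, rfl⟩ := hf3 n' hz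
      exact ⟨k, rfl⟩

/-- The category of RPCs with face morphisms. -/
abbrev RPCFace : Type 1 := WideSubcategory faceMor

/-- A combinatorial cone stack: a category fibered in groupoids over `RPCFace`. -/
structure CombConeStack extends BasedCategory.{0, 1} RPCFace where
  fibered : IsFiberedInGroupoids toBasedCategory.p

/-- Finitely many objects up to isomorphism, and finitely many morphisms between any two. -/
def CombConeStack.IsFinite (Φ : CombConeStack) : Prop :=
  Finite (Quotient (isIsomorphicSetoid Φ.obj)) ∧ ∀ a b : Φ.obj, Finite (a ⟶ b)

/-- The underlying diagram of cones. -/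
def CombConeStack.toRPC (Φ : CombConeStack) : Φ.obj ⥤ RPC := Φ.p ⋙ wideSubcategoryInclusion faceMor

/-- The stack over `RPC` glued from the cones of `Φ`. Its objects over `ρ` are a cone `ξ` of `Φ` and
a morphism `g : ρ → ξ` that does not factor through a proper face of `ξ`; every morphism from `ρ` to
a cone factors uniquely in this way through a face. A morphism `(ρ, ξ, g) → (ρ', ξ', g')` is a
morphism `ρ → ρ'` and a (face) morphism `ξ → ξ'` forming a commutative square. -/
def CombConeStack.realization (Φ : CombConeStack) : BasedCategory.{0, 1} RPC where
  obj := ObjectProperty.FullSubcategory (C := Comma (𝟭 RPC) Φ.toRPC) fun c =>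
    ∀ F : PointedCone ℝ (RealExt (Φ.toRPC.obj c.right).N), F.IsFaceOf (Φ.toRPC.obj c.right).cone →
      (∀ x ∈ c.left.cone, realMap (RPCHom.lin c.hom) x ∈ F) → F = (Φ.toRPC.obj c.right).cone
  p := ObjectProperty.ι _ ⋙ Comma.fst (𝟭 RPC) Φ.toRPC

/-- `Z` is (equivalent to) a finite cone stack. -/
def IsFiniteConeStack (Z : BasedCategory.{0, 1} RPC) : Prop :=
  ∃ Φ : CombConeStack, Φ.IsFinite ∧ ∃ G : Z ⥤ᵇ Φ.realization, G.toFunctor.IsEquivalence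

/-! ### Partial tropical compactifications

`zero : Z → X` is the zero section of the family `X → Z`. -/

/-- A partial tropical compactification `F : Y → X`. -/
structure IsPartialTropComp {Z X : RPCStack} (zero : Z.toBasedCategory ⥤ᵇ X.toBasedCategory)
    {Y : RPCStack} (F : Y.toBasedCategory ⥤ᵇ X.toBasedCategory) : Prop where
  mono : IsMono F
  representable : ∀ x : X.obj, IsFiniteConeStack (baseChange F x)
  lifts_zero : ∃ s : Z.toBasedCategory ⥤ᵇ Y.toBasedCategory, Nonempty (s.comp F ≅ zero)

/-- A generalized partial tropical compactification `F : Y → X`. -/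
structure IsGenPartialTropComp {Z X : RPCStack} (zero : Z.toBasedCategory ⥤ᵇ X.toBasedCategory)
    {Y : RPCStack} (F : Y.toBasedCategory ⥤ᵇ X.toBasedCategory) : Prop where
  mono : IsMono F
  exists_subdivision : ∃ (Y' : RPCStack) (s : Y'.toBasedCategory ⥤ᵇ Y.toBasedCategory),
    IsSubdivision s ∧ IsPartialTropComp zero (s.comp F)

/-- Minimality of `F : Y → X`: descent with respect to subdivisions. For every stack `Y₁` over `X`,
every subdivision `Y₂ → Y₁` and every morphism `f : Y₂ → Y` over `X` there is a morphism `Y₁ → Y`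
over `X`, unique up to 2-isomorphism, whose composition with `Y₂ → Y₁` is `f`. -/
def IsMinimal {X Y : RPCStack} (F : Y.toBasedCategory ⥤ᵇ X.toBasedCategory) : Prop :=
  ∀ (Y₁ Y₂ : RPCStack) (F₁ : Y₁.toBasedCategory ⥤ᵇ X.toBasedCategory)
    (s : Y₂.toBasedCategory ⥤ᵇ Y₁.toBasedCategory) (f : Y₂.toBasedCategory ⥤ᵇ Y.toBasedCategory),
    IsSubdivision s → Nonempty (f.comp F ≅ s.comp F₁) →
      ∃ g : Y₁.toBasedCategory ⥤ᵇ Y.toBasedCategory,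
        (Nonempty (g.comp F ≅ F₁) ∧ Nonempty (s.comp g ≅ f)) ∧
        ∀ g' : Y₁.toBasedCategory ⥤ᵇ Y.toBasedCategory,
          Nonempty (g'.comp F ≅ F₁) → Nonempty (s.comp g' ≅ f) → Nonempty (g' ≅ g)

/-! ### Tropical tori and tropical abelian varieties -/

/-- The tropical torus `T_N^trop`, `τ ↦ Hom(N_τ, N)`. -/
def tropTorus (N : Type) [AddCommGroup N] : RPCᵒᵖ ⥤ Type where
  obj τ := τ.unop.N →ₗ[ℤ] N
  map g := ↾fun ψ => ψ.comp (RPCHom.lin g.unop)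
  map_id _ := rfl
  map_comp _ _ := rfl

section TropicalAbelian

variable {σ : RPC} {M : Type} [AddCommGroup M] (Q : M →ₗ[ℤ] M →ₗ[ℤ] Module.Dual ℤ σ.N)

/-- The order on `M_τ = Hom(N_τ, ℤ)`: `a ≤ b` if `b - a ∈ τ^∨`. Since `τ` is generated by lattice
points, it suffices to test these. -/
def dualLE (τ : RPC) (a b : Module.Dual ℤ τ.N) : Prop :=
  ∀ n : τ.N, latPt n ∈ τ.cone → 0 ≤ (b - a) n

/-- `Q(m, m) ∈ σ^∨ \ {0}` for every `m ≠ 0`. -/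
def IsPosDef : Prop := ∀ m : M, m ≠ 0 → dualLE σ 0 (Q m m) ∧ Q m m ≠ 0

/-- `Q_τ(m, m')`, the image of `Q(m, m')` under `M_σ → M_τ`. -/
def pullForm {τ : RPC} (f : τ ⟶ σ) (m m' : M) : Module.Dual ℤ τ.N := (Q m m').comp f.lin

/-- A morphism `τ → σ` and a point over it of `Hom(M, 𝔾_m,trop)^(M)`. -/
@[ext]
structure BoundedHom (τ : RPC) : Type where
  str : τ ⟶ σ
  hom : M →ₗ[ℤ] Module.Dual ℤ τ.N
  bounded : ∀ m : M, ∃ m₁ m₂ : M,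
    dualLE τ (pullForm Q str m₁ m) (hom m) ∧ dualLE τ (hom m) (pullForm Q str m₂ m)

/-- Translation by `Q_hom(M)`. -/
def BoundedHom.setoid (τ : RPC) : Setoid (BoundedHom Q τ) where
  r a b := a.str = b.str ∧ ∃ m : M, ∀ m' : M, b.hom m' = a.hom m' + pullForm Q a.str m m'
  iseqv :=
    { refl := fun a => ⟨rfl, 0, fun m' => by simp [pullForm]⟩
      symm := by
        rintro a b ⟨h, m, hm⟩
        refine ⟨h.symm, -m, fun m' => ?_⟩
        rw [hm, ← h]
        simp [pullForm]
      trans := by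
        rintro a b c ⟨h, m, hm⟩ ⟨h', m₁, hm₁⟩
        refine ⟨h.trans h', m + m₁, fun m' => ?_⟩
        rw [hm₁, hm, ← h]
        simp [pullForm, LinearMap.add_comp, add_assoc] }

/-- Translation of a point by `Q_hom(m)`. -/
def BoundedHom.shift {τ : RPC} (a : BoundedHom Q τ) (m : M) : BoundedHom Q τ where
  str := a.str
  hom := a.hom + (LinearMap.lcomp ℤ ℤ a.str.lin).comp (Q m)
  bounded m' := by
    obtain ⟨m₁, m₂, h₁, h₂⟩ := a.bounded m'
    refine ⟨m₁ + m, m₂ + m, fun k hk => ?_, fun k hk => ?_⟩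
    · simpa [pullForm, LinearMap.lcomp] using h₁ k hk
    · simpa [pullForm, LinearMap.lcomp] using h₂ k hk

/-- Pullback of a point along `g : ρ → τ`. -/
def BoundedHom.pull {ρ τ : RPC} (g : ρ ⟶ τ) (a : BoundedHom Q τ) : BoundedHom Q ρ where
  str := g ≫ a.str
  hom := (LinearMap.lcomp ℤ ℤ g.lin).comp a.hom
  bounded m := by
    obtain ⟨m₁, m₂, h₁, h₂⟩ := a.bounded m
    refine ⟨m₁, m₂, fun n hn => h₁ (g.lin n) ?_, fun n hn => h₂ (g.lin n) ?_⟩ <;>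
    · rw [← realMap_latPt]
      exact g.maps _ hn

/-- The tropical abelian variety `A = Hom(M, 𝔾_m,trop)^(M) / Q_hom(M)` over `σ`. -/
def tropAbelian : RPCᵒᵖ ⥤ Type where
  obj τ := Quotient (BoundedHom.setoid Q τ.unop)
  map {_ _} g := ↾(Quotient.map (sa := BoundedHom.setoid Q _) (sb := BoundedHom.setoid Q _)
    (BoundedHom.pull Q g.unop) (by
      rintro a b ⟨h, m, hm⟩
      refine ⟨congrArg (g.unop ≫ ·) h, m, fun m' => ?_⟩
      have h2 : ∀ c : BoundedHom Q _, (BoundedHom.pull Q g.unop c).hom m' =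
          (c.hom m').comp (RPCHom.lin g.unop) := fun _ => rfl
      rw [h2, h2, hm]
      rfl))
  map_id τ := by
    ext x
    induction x using Quotient.inductionOn
    rfl
  map_comp f g := by
    ext x
    induction x using Quotient.inductionOn
    rfl

variable (M' : Type) [AddCommGroup M']

/-- `A × T_{N'}^trop`, where `N'` is the dual of `M'`. -/
def tropSemiabelian : RPCᵒᵖ ⥤ Type :=
  FunctorToTypes.prod (tropAbelian Q) (tropTorus (Module.Dual ℤ M'))

/-- `A × T_{N'}^trop` as a stack. -/
def semiabStack : RPCStack := stackOf (tropSemiabelian Q M')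

/-- The trivial homomorphism as a point over `σ`. -/
def zeroHom : BoundedHom Q σ where
  str := 𝟙 σ
  hom := 0
  bounded m := ⟨0, 0, fun n _ => by simp [pullForm], fun n _ => by simp [pullForm]⟩

/-- The zero section `σ → A × T_{N'}^trop`. -/
def zeroSection :
    (coneStackOf σ).toBasedCategory ⥤ᵇ (semiabStack Q M').toBasedCategory :=
  stackMap (yonedaEquiv.symm
    ((Quotient.mk (BoundedHom.setoid Q σ) (zeroHom Q), (0 : σ.N →ₗ[ℤ] Module.Dual ℤ M')) :
      (tropSemiabelian Q M').obj (op σ)))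

/-! ### Stacky fans and minimal fans -/

/-- `Q_{hom,N}(m) : N_σ → N`, where `N` is the dual of `M`: `n ↦ (m' ↦ Q(m, m')(n))`. -/
def QhomN (m : M) : σ.N →ₗ[ℤ] Module.Dual ℤ M := (Q m).flip

/-- The lattice `N_σ × N × N'`. -/
abbrev BigLat (σ : RPC) (M M' : Type) [AddCommGroup M] [AddCommGroup M'] : Type :=
  σ.N × Module.Dual ℤ M × Module.Dual ℤ M'

/-- The set `(N_σ × N)^(M) × N'`: triples `(n, n', n'')` with `n ∈ σ` and `n'` in the rational span
of the subgroup `Q_{hom,N}(M)(n)`. -/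
def admissible : Set (BigLat σ M M') :=
  {l | latPt l.1 ∈ σ.cone ∧ ∃ k : ℕ, 0 < k ∧ ∃ m : M, k • l.2.1 = QhomN Q m l.1}

/-- `T_m(n, n', n'') = (n, n' + Q_{hom,N}(m)(n), n'')`. -/
def translate (m : M) : BigLat σ M M' →ₗ[ℤ] BigLat σ M M' where
  toFun l := (l.1, l.2.1 + QhomN Q m l.1, l.2.2)
  map_add' l l' := by
    ext <;> simp
    abel
  map_smul' c l := by
    ext <;> simp

/-- The cone `σ × {0} × {0}`. -/
def zeroCone : PointedCone ℝ (RealExt (BigLat σ M M')) :=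
  σ.cone.map (realMap (LinearMap.inl ℤ σ.N (Module.Dual ℤ M × Module.Dual ℤ M')))

/-- The saturated lattice `L ∩ Span τ` of a cone `τ` in `L_ℝ`. -/
def spanLat {L : Type} [AddCommGroup L] (τ : PointedCone ℝ (RealExt L)) : AddSubgroup L where
  carrier := {l | latPt l ∈ coneSpan τ}
  zero_mem' := by simp [latPt]
  add_mem' {a b} ha hb := by
    have h : latPt (a + b) = latPt a + latPt b := by simp [latPt, tmul_add]
    simpa [h] using (coneSpan τ).add_mem ha hb
  neg_mem' {a} ha := by
    have h : latPt (-a) = -latPt a := by simp [latPt, tmul_neg]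
    simpa [h] using ha

/-- A stacky fan for `A × T_{N'}^trop`: a set of cones `τ` with lattices `lat τ` (the values of
`lat` away from `cones` play no role). -/
structure StackyFan where
  cones : Set (PointedCone ℝ (RealExt (BigLat σ M M')))
  lat : PointedCone ℝ (RealExt (BigLat σ M M')) → AddSubgroup (BigLat σ M M')
  rational : ∀ τ ∈ cones, IsRationalCone τ
  subset : ∀ τ ∈ cones, (τ : Set (RealExt (BigLat σ M M'))) ⊆
    convexHull ℝ (latPt '' admissible Q M')
  lat_le : ∀ τ ∈ cones, lat τ ≤ spanLat τ
  lat_finiteIndex : ∀ τ ∈ cones, (lat τ).relIndex (spanLat τ) ≠ 0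
  inter_face : ∀ τ ∈ cones, ∀ τ' ∈ cones, (τ ⊓ τ').IsFaceOf τ ∧ (τ ⊓ τ').IsFaceOf τ'
  lat_inter : ∀ τ ∈ cones, ∀ τ' ∈ cones,
    lat τ ⊓ spanLat (τ ⊓ τ') = lat τ' ⊓ spanLat (τ ⊓ τ')
  face_mem : ∀ τ ∈ cones, ∀ F : PointedCone ℝ (RealExt (BigLat σ M M')),
    F.IsFaceOf τ → F ∈ cones
  translate_mem : ∀ τ ∈ cones, ∀ m : M, τ.map (realMap (translate Q M' m)) ∈ cones
  lat_translate : ∀ τ ∈ cones, ∀ m : M,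
    lat (τ.map (realMap (translate Q M' m))) = (lat τ).map (translate Q M' m).toAddMonoidHom
  fixed : ∀ τ ∈ cones, ∀ m : M, ∀ x ∈ τ ⊓ τ.map (realMap (translate Q M' m)),
    realMap (translate Q M' m) x = x
  finite : ∃ R : Set (PointedCone ℝ (RealExt (BigLat σ M M'))), R.Finite ∧ R ⊆ cones ∧
    ∀ τ ∈ cones, ∃ τ₀ ∈ R, ∃ m : M, τ = τ₀.map (realMap (translate Q M' m))
  zero_mem : zeroCone M' (σ := σ) (M := M) ∈ cones
  lat_zero : lat (zeroCone M') = spanLat (zeroCone M')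

/-- The lattice points `⋃_{τ ∈ Δ} τ ∩ Ñ_τ` of a stacky fan. -/
def StackyFan.points {Q : M →ₗ[ℤ] M →ₗ[ℤ] Module.Dual ℤ σ.N} {M' : Type} [AddCommGroup M']
    (Δ : StackyFan Q M') : Set (BigLat σ M M') :=
  {l | ∃ τ ∈ Δ.cones, latPt l ∈ τ ∧ l ∈ Δ.lat τ}

/-- Minimal fans. -/
def IsMinimalFan (S : Set (BigLat σ M M')) : Prop := ∃ Δ : StackyFan Q M', S = Δ.points

variable {M'} in
/-- The lift `N_τ → N_σ × N × N'`, `n ↦ (f(n), φ^∨(n), ψ(n))`, of the morphism `([φ], ψ)`. -/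
def liftMap {τ : RPC} (a : BoundedHom Q τ) (ψ : τ.N →ₗ[ℤ] Module.Dual ℤ M') (n : τ.N) :
    BigLat σ M M' := (a.str.lin n, a.hom.flip n, ψ n)

variable {M'} in
/-- The subsheaf `Σ_S` of `A × T_{N'}^trop`: those morphisms `([φ], ψ)` from `τ` such that for every
representative `φ`, that is, for every lift to `N_τ → N_σ × N × N'`, the image of `τ ∩ N_τ` lies in `S`. -/
def sigmaSub (S : Set (BigLat σ M M')) : Subfunctor (tropSemiabelian Q M') where
  obj τ := {x | ∀ a : BoundedHom Q τ.unop, Quotient.mk (BoundedHom.setoid Q τ.unop) a = x.1 →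
    ∀ n : τ.unop.N, latPt n ∈ τ.unop.cone →
      liftMap Q a x.2 n ∈ S}
  map {τ ρ} g := by
    rintro ⟨x, ψ⟩ hx b hb n hn
    induction x using Quotient.inductionOn with
    | h a =>
      obtain ⟨h, m, hm⟩ := Quotient.exact (s := BoundedHom.setoid Q _) hb.symm
      let a' : BoundedHom Q τ.unop := a.shift Q m
      have ha' : Quotient.mk (BoundedHom.setoid Q τ.unop) a' =
          Quotient.mk (BoundedHom.setoid Q τ.unop) a :=
        (Quotient.sound (s := BoundedHom.setoid Q τ.unop) (a := a) (b := a.shift Q m)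
          ⟨rfl, m, fun _ => rfl⟩).symm
      have hn' : latPt ((RPCHom.lin g.unop) n) ∈ τ.unop.cone := by
        rw [← realMap_latPt]
        exact RPCHom.maps g.unop _ hn
      have key := hx a' ha' _ hn'
      have e1 : b.str.lin n = a'.str.lin ((RPCHom.lin g.unop) n) := by
        rw [← h]; rfl
      have e2 : b.hom.flip n = a'.hom.flip ((RPCHom.lin g.unop) n) := by
        ext m'
        simp only [LinearMap.flip_apply]
        rw [hm]
        rfl
      unfold liftMap
      rw [e1, e2]
      exact key

variable {M'} in
/-- `Σ_S` as a stack over `RPC`. -/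
def sigmaStack (S : Set (BigLat σ M M')) : RPCStack := stackOf (sigmaSub Q S).toFunctor

variable {M'} in
/-- The inclusion `Σ_S → A × T_{N'}^trop`. -/
def sigmaIncl (S : Set (BigLat σ M M')) :
    (sigmaStack Q S).toBasedCategory ⥤ᵇ (semiabStack Q M').toBasedCategory :=
  stackMap (sigmaSub Q S).ι

end TropicalAbelian

end TropMin

end

/-! A monomorphism into the stack of a presheaf `P` is determined, up to isomorphism over that
stack, by its image `imageSub`, a subpresheaf of `P` (`isoOver_of_imageSub_eq`,
`IsoOver.imageSub_eq`). Both claims are therefore about subpresheaves of `tropSemiabelian`. They are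
linked to subsets of L = N_σ × N × N' by rays: a morphism from ℝ_{≥0} with lattice ℤ to X is an
admissible lattice point of L up to the translations T_m. For a minimal fan S, the rays of Σ_S are
the points of S (`StackyFan.isPt_rayLin_iff`), so Σ_S determines S.

For existence, let Y' → Y be the given subdivision and E' ≤ E the images of Y' and Y in X. A
subdivision keeps all lattice points, so E and E' have the same rays (`mem_imageSub_of_ray`). Let S
be the set of generators of these rays. Then Σ_S consists of the points all of whose rays lie in E'
(`liftPoint_mem_sigmaSub_rays`), and E ≤ Σ_S follows. Conversely, over a cone of Σ_S the presheaf E'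
is a finite fan of cones with lattices that contains every lattice point. This forces the lattices
to be saturated and the fan to be complete (`exists_coneSubdivision`). Hence Σ_S ∩ E' → Σ_S is a
subdivision, and minimality of Y extends Σ_S ∩ E' → Y to Σ_S → Y over X, so Σ_S ≤ E.

It remains to see that S is a minimal fan. If the base change of a monomorphism to an RPC τ is a
finite cone stack, its full faithfulness over τ and the finiteness of automorphism groups force the
cones to embed in τ (`ConeChart.cone_injective`), and their images form a finite fan with lattices
(`ConeChart.isLatticeFan_image`). This applies only to cones, so the admissible part of L is first
cut into cells: the regions where one of the linear functions `CellData.ell m u` is minimal among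
all m in M and u in a finite set U. These functions are quadratic in m, and the cells are a
perturbed Voronoi decomposition. They are rational polyhedral by an argument with Dickson's lemma,
are permuted by the T_m with finitely many orbits, and include σ × 0 × 0. The fans over the cells
agree wherever they share a relatively interior lattice point, and glue to a stacky fan with point
set S (`LocalFans.stackyFan`, `LocalFans.mem_points_stackyFan`). -/

noncomputable section

namespace TropMin

/-! ### Relative interiors and minimal faces -/

section Cones

variable {V W : Type*} [AddCommGroup V] [Module ℝ V] [AddCommGroup W] [Module ℝ W]

/-- `x` lies in the relative interior of the cone `C`. -/
def IsRelInt (C : PointedCone ℝ V) (x : V) : Prop :=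
  x ∈ C ∧ ∀ y ∈ C, ∃ t : ℝ, 0 < t ∧ x - t • y ∈ C

lemma sub_smul_mem_of_le {C : PointedCone ℝ V} {x y : V} (hx : x ∈ C) {t s : ℝ} (ht : 0 < t)
    (hs : 0 ≤ s) (hst : s ≤ t) (h : x - t • y ∈ C) : x - s • y ∈ C := by
  have e : x - s • y = (s / t) • (x - t • y) + (1 - s / t) • x := by
    rw [smul_sub, smul_smul, div_mul_cancel₀ _ ht.ne', sub_smul, one_smul]
    abel
  rw [e]
  refine C.add_mem (C.smul_mem (div_nonneg hs ht.le) h) (C.smul_mem ?_ hx)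
  rw [sub_nonneg]
  exact (div_le_one ht).2 hst

/-- The smallest face of `C` that contains `x`. -/
def minFace (C : PointedCone ℝ V) (x : V) (hx : x ∈ C) : PointedCone ℝ V where
  carrier := {y | y ∈ C ∧ ∃ t : ℝ, 0 < t ∧ x - t • y ∈ C}
  zero_mem' := ⟨C.zero_mem, 1, one_pos, by simpa using hx⟩
  add_mem' := by
    rintro y z ⟨hy, t, ht, hty⟩ ⟨hz, t', ht', htz⟩
    -- With s = min t t', both x − s y and x − s z lie in C, and their average is x − (s/2)(y + z).
    refine ⟨C.add_mem hy hz, min t t' / 2, by positivity, ?_⟩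
    have h1 := sub_smul_mem_of_le hx ht (lt_min ht ht').le (min_le_left _ _) hty
    have h2 := sub_smul_mem_of_le hx ht' (lt_min ht ht').le (min_le_right _ _) htz
    have h3 := C.add_mem (C.smul_mem (by norm_num : (0 : ℝ) ≤ 1 / 2) h1)
      (C.smul_mem (by norm_num : (0 : ℝ) ≤ 1 / 2) h2)
    convert h3 using 1
    module
  smul_mem' := by
    rintro ⟨c, hc⟩ y ⟨hy, t, ht, hty⟩
    refine ⟨C.smul_mem hc hy, ?_⟩
    change ∃ t : ℝ, 0 < t ∧ x - t • c • y ∈ C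
    rcases hc.eq_or_lt with rfl | hc
    · exact ⟨1, one_pos, by simpa using hx⟩
    · refine ⟨t / c, by positivity, ?_⟩
      rwa [smul_smul, div_mul_cancel₀ _ hc.ne']

lemma minFace_isFaceOf {C : PointedCone ℝ V} {x : V} (hx : x ∈ C) :
    (minFace C x hx).IsFaceOf C where
  le _ h := h.1
  mem_of_smul_add_mem := by
    rintro y z a hy hz ha ⟨-, t, ht, h⟩
    refine ⟨hy, t * a, by positivity, ?_⟩
    have := C.add_mem h (C.smul_mem ht.le hz)
    convert this using 1
    module

lemma isRelInt_minFace {C : PointedCone ℝ V} {x : V} (hx : x ∈ C) :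
    IsRelInt (minFace C x hx) x := by
  have h1 : x ∈ minFace C x hx := ⟨hx, 1, one_pos, by simp⟩
  refine ⟨h1, ?_⟩
  rintro y ⟨hy, t, ht, h⟩
  refine ⟨t, ht, h, 1, one_pos, ?_⟩
  simpa using C.smul_mem ht.le hy

lemma IsRelInt.le_face {C F : PointedCone ℝ V} {x : V} (h : IsRelInt C x) (hF : F.IsFaceOf C)
    (hx : x ∈ F) : C ≤ F := by
  intro y hy
  obtain ⟨t, ht, h'⟩ := h.2 y hy
  exact hF.mem_of_smul_add_mem hy h' ht (by simpa using hx)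

lemma IsRelInt.face_eq {C F : PointedCone ℝ V} {x : V} (h : IsRelInt C x) (hF : F.IsFaceOf C)
    (hx : x ∈ F) : F = C :=
  le_antisymm hF.le (h.le_face hF hx)

/-- A subcone that meets the face `F` in a relatively interior point is contained in `F`. -/
lemma IsRelInt.le_of_mem_face {C D F : PointedCone ℝ V} {x : V} (h : IsRelInt C x) (hCD : C ≤ D)
    (hF : F.IsFaceOf D) (hx : x ∈ F) : C ≤ F := by
  intro y hy
  obtain ⟨t, ht, h'⟩ := h.2 y hy
  exact hF.mem_of_smul_add_mem (hCD hy) (hCD h') ht (by simpa using hx)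

lemma IsRelInt.smul {C : PointedCone ℝ V} {x : V} (h : IsRelInt C x) {c : ℝ} (hc : 0 < c) :
    IsRelInt C (c • x) := by
  refine ⟨C.smul_mem hc.le h.1, fun y hy => ?_⟩
  obtain ⟨t, ht, h'⟩ := h.2 y hy
  refine ⟨c * t, by positivity, ?_⟩
  have := C.smul_mem hc.le h'
  rwa [smul_sub, smul_smul] at this

lemma IsRelInt.add {C : PointedCone ℝ V} {x z : V} (h : IsRelInt C x) (hz : z ∈ C) :
    IsRelInt C (x + z) := by
  refine ⟨C.add_mem h.1 hz, fun y hy => ?_⟩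
  obtain ⟨t, ht, h'⟩ := h.2 y hy
  refine ⟨t, ht, ?_⟩
  have := C.add_mem h' hz
  convert this using 1
  abel

lemma isRelInt_map {C : PointedCone ℝ V} {f : V →ₗ[ℝ] W} {x : V} (h : IsRelInt C x) :
    IsRelInt (C.map f) (f x) := by
  refine ⟨⟨x, h.1, rfl⟩, ?_⟩
  rintro _ ⟨y, hy, rfl⟩
  obtain ⟨t, ht, h'⟩ := h.2 y hy
  exact ⟨t, ht, _, h', by simp⟩

lemma isRelInt_of_map {C : PointedCone ℝ V} {f : V →ₗ[ℝ] W} (hf : Function.Injective f) {x : V}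
    (h : IsRelInt (C.map f) (f x)) : IsRelInt C x := by
  have key : ∀ z, f z ∈ C.map f → z ∈ C := by
    rintro z ⟨z', hz', e⟩
    rwa [← hf e]
  refine ⟨key _ h.1, fun y hy => ?_⟩
  obtain ⟨t, ht, h'⟩ := h.2 (f y) ⟨y, hy, rfl⟩
  exact ⟨t, ht, key _ (by simpa using h')⟩

/-- Adding a large multiple of a relatively interior point moves the span into the interior. -/
lemma IsRelInt.exists_nat_smul_add {C : PointedCone ℝ V} {x a : V} (h : IsRelInt C x)
    (ha : a ∈ Submodule.span ℝ (C : Set V)) :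
    ∃ k : ℕ, 0 < k ∧ IsRelInt C ((k : ℝ) • x + a) := by
  have h1 : ∃ t : ℝ, 0 < t ∧ x + t • a ∈ C := by
    have hd : ∃ y ∈ C, ∃ z ∈ C, a = y - z := by
      induction ha using Submodule.span_induction with
      | mem y hy => exact ⟨y, hy, 0, C.zero_mem, by simp⟩
      | zero => exact ⟨0, C.zero_mem, 0, C.zero_mem, by simp⟩
      | add u v _ _ hu hv =>
        obtain ⟨y, hy, z, hz, rfl⟩ := hu
        obtain ⟨y', hy', z', hz', rfl⟩ := hv
        exact ⟨_, C.add_mem hy hy', _, C.add_mem hz hz', by abel⟩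
      | smul c u _ hu =>
        obtain ⟨y, hy, z, hz, rfl⟩ := hu
        rcases le_total 0 c with hc | hc
        · exact ⟨_, C.smul_mem hc hy, _, C.smul_mem hc hz, by module⟩
        · exact ⟨_, C.smul_mem (neg_nonneg.2 hc) hz, _, C.smul_mem (neg_nonneg.2 hc) hy,
            by module⟩
    obtain ⟨y, hy, z, hz, rfl⟩ := hd
    obtain ⟨t, ht, h'⟩ := h.2 z hz
    refine ⟨t, ht, ?_⟩
    have := C.add_mem h' (C.smul_mem ht.le hy)
    convert this using 1
    module
  obtain ⟨t, ht, h1⟩ := h1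
  -- In k x + a = (k − 1/t) x + (1/t)(x + t a), the bound k > 1/t leaves a positive multiple of x.
  obtain ⟨k, hk⟩ := exists_nat_gt (1 / t)
  have hk0 : (0 : ℝ) < k := lt_trans (by positivity) hk
  refine ⟨k, by exact_mod_cast hk0, ?_⟩
  have h2 : (k : ℝ) • x + a = ((k : ℝ) - 1 / t) • x + (1 / t) • (x + t • a) := by
    rw [smul_add, smul_smul, one_div_mul_cancel ht.ne']
    module
  rw [h2]
  exact (h.smul (sub_pos.2 hk)).add (C.smul_mem (by positivity) h1)

/-- In a nonnegative combination lying in a face, every generator with positive coefficient lies in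
the face. Rationality of faces and finiteness of their number both come from this. -/
lemma hull_face {S : Set V} {F : PointedCone ℝ V} (hF : F.IsFaceOf (PointedCone.hull ℝ S)) :
    F = PointedCone.hull ℝ (S ∩ F) := by
  refine le_antisymm ?_ (Submodule.span_le.2 fun x hx => hx.2)
  intro x hx
  obtain ⟨c, hc, hc0, rfl⟩ := PointedCone.mem_hull_set.1 (hF.le hx)
  refine Submodule.sum_mem _ fun i hi => ?_
  have hS : ∀ j : c.support, (j : V) ∈ PointedCone.hull ℝ S :=
    fun j => PointedCone.subset_hull (hc j.2)
  have hi' : i ∈ F := by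
    refine hF.mem_of_sum_smul_mem (ι := c.support) (f := fun j => (j : V)) (c := fun j => c j)
      hS (fun j => hc0 j) ?_ ⟨i, hi⟩ (lt_of_le_of_ne (hc0 i) (Finsupp.mem_support_iff.1 hi).symm)
    have := Finset.sum_coe_sort c.support (fun j => c j • j)
    rw [this]
    exact hx
  exact PointedCone.smul_mem _ (hc0 i) (PointedCone.subset_hull ⟨hc hi, hi'⟩)

lemma isFaceOf_inf_of_isFaceOf {C D F : PointedCone ℝ V} (hCD : C ≤ D) (hF : F.IsFaceOf D) :
    (C ⊓ F).IsFaceOf C where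
  le := inf_le_left
  mem_of_smul_add_mem hx hy ha h := ⟨hx, hF.mem_of_smul_add_mem (hCD hx) (hCD hy) ha h.2⟩

end Cones

/-! ### Lattice points and integral functionals -/

section Lattice

variable {L L' : Type} [AddCommGroup L] [AddCommGroup L']

lemma latPt_add (a b : L) : latPt (a + b) = latPt a + latPt b := by simp [latPt, tmul_add]

lemma latPt_zero : latPt (0 : L) = 0 := by simp [latPt]

lemma latPt_neg (a : L) : latPt (-a) = -latPt a := by simp [latPt, tmul_neg]

lemma latPt_zsmul (k : ℤ) (a : L) : latPt (k • a) = (k : ℝ) • latPt a := by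
  simp [latPt, TensorProduct.smul_tmul']

lemma latPt_nsmul (k : ℕ) (a : L) : latPt (k • a) = (k : ℝ) • latPt a := by
  simpa using latPt_zsmul (k : ℤ) a

lemma span_latPt : Submodule.span ℝ (Set.range (latPt : L → RealExt L)) = ⊤ := by
  rw [eq_top_iff]
  rintro x -
  induction x using TensorProduct.induction_on with
  | zero => exact Submodule.zero_mem _
  | tmul r n =>
    have : r ⊗ₜ[ℤ] n = r • latPt n := by simp [latPt, TensorProduct.smul_tmul']
    rw [this]
    exact Submodule.smul_mem _ _ (Submodule.subset_span ⟨n, rfl⟩)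
  | add x y hx hy => exact Submodule.add_mem _ hx hy

lemma realExt_ext {W : Type*} [AddCommGroup W] [Module ℝ W] {f g : RealExt L →ₗ[ℝ] W}
    (h : ∀ n, f (latPt n) = g (latPt n)) : f = g := by
  refine LinearMap.ext_on span_latPt ?_
  rintro _ ⟨n, rfl⟩
  exact h n

/-- The real extension of an integral functional. -/
def evalR (l : Module.Dual ℤ L) : RealExt L →ₗ[ℝ] ℝ :=
  Module.Dual.baseChange ℝ l

@[simp] lemma evalR_latPt (l : Module.Dual ℤ L) (n : L) : evalR l (latPt n) = l n := by
  simp [evalR, latPt]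

lemma evalR_add (l l' : Module.Dual ℤ L) (x : RealExt L) :
    evalR (l + l') x = evalR l x + evalR l' x := by
  have : evalR (l + l') = evalR l + evalR l' := realExt_ext fun n => by simp
  rw [this]; rfl

lemma evalR_smul (k : ℤ) (l : Module.Dual ℤ L) (x : RealExt L) :
    evalR (k • l) x = k * evalR l x := by
  have : evalR (k • l) = (k : ℝ) • evalR l := realExt_ext fun n => by simp
  rw [this]; rfl

lemma evalR_neg (l : Module.Dual ℤ L) (x : RealExt L) : evalR (-l) x = -evalR l x := by
  simpa using evalR_smul (-1) l x

lemma evalR_sub (l l' : Module.Dual ℤ L) (x : RealExt L) :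
    evalR (l - l') x = evalR l x - evalR l' x := by
  rw [sub_eq_add_neg, evalR_add, evalR_neg, sub_eq_add_neg]

lemma evalR_zero (x : RealExt L) : evalR (0 : Module.Dual ℤ L) x = 0 := by
  simpa using evalR_smul 0 (0 : Module.Dual ℤ L) x

lemma evalR_realMap (l : Module.Dual ℤ L') (f : L →ₗ[ℤ] L') (x : RealExt L) :
    evalR l (realMap f x) = evalR (l.comp f) x := by
  have : (evalR l).comp (realMap f) = evalR (l.comp f) :=
    realExt_ext fun n => by simp [realMap_latPt]
  exact LinearMap.congr_fun this x

lemma eq_zero_of_evalR [Module.Free ℤ L] [Module.Finite ℤ L] {x : RealExt L}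
    (h : ∀ l : Module.Dual ℤ L, evalR l x = 0) : x = 0 := by
  let b := Module.Free.chooseBasis ℤ L
  have h1 : x = ∑ i, evalR (b.coord i) x • latPt (b i) := by
    let f : RealExt L →ₗ[ℝ] RealExt L :=
      ∑ i, (evalR (b.coord i)).smulRight (latPt (b i))
    have : LinearMap.id = f := realExt_ext fun n => by
      simp only [f, LinearMap.sum_apply, LinearMap.smulRight_apply, evalR_latPt, LinearMap.id_apply]
      conv_lhs => rw [← b.sum_repr n]
      have hs : ∀ s : Finset (Module.Free.ChooseBasisIndex ℤ L),
          latPt (∑ i ∈ s, b.repr n i • b i) = ∑ i ∈ s, latPt (b.repr n i • b i) := by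
        intro s
        induction s using Finset.cons_induction with
        | empty => simp [latPt_zero]
        | cons a s ha ih => rw [Finset.sum_cons, Finset.sum_cons, latPt_add, ih]
      rw [hs]
      exact Finset.sum_congr rfl fun i _ => by rw [latPt_zsmul]; rfl
    have := LinearMap.congr_fun this x
    simpa [f] using this
  rw [h1]
  simp [h]

lemma latPt_injective [Module.Free ℤ L] : Function.Injective (latPt : L → RealExt L) := by
  intro a b hab
  have h : a - b = 0 := by
    rw [← Module.forall_dual_apply_eq_zero_iff ℤ]
    intro l
    have h2 := congrArg (evalR l) hab
    simp only [evalR_latPt] at h2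
    rw [map_sub, sub_eq_zero]
    exact_mod_cast h2
  exact sub_eq_zero.1 h

end Lattice

/-! ### Rational cones: generators and inequalities -/

section Rational

variable {L L' : Type} [AddCommGroup L] [AddCommGroup L']

/-- Cones generated by finitely many lattice points. -/
def IsLatticeGenerated (C : PointedCone ℝ (RealExt L)) : Prop :=
  ∃ s : Finset L, C = PointedCone.hull ℝ (latPt '' (s : Set L))

/-- The half space of an integral functional. -/
def halfSpace (l : Module.Dual ℤ L) : PointedCone ℝ (RealExt L) where
  carrier := {x | 0 ≤ evalR l x}
  zero_mem' := by simp
  add_mem' {x y} hx hy := by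
    change 0 ≤ evalR l (x + y)
    rw [map_add]
    exact add_nonneg hx hy
  smul_mem' := by
    rintro ⟨c, hc⟩ x hx
    change 0 ≤ evalR l (c • x)
    rw [map_smul]
    exact mul_nonneg hc hx

lemma mem_halfSpace {l : Module.Dual ℤ L} {x : RealExt L} : x ∈ halfSpace l ↔ 0 ≤ evalR l x :=
  Iff.rfl

lemma mem_hull_latPt {s : Finset L} {x : RealExt L} :
    x ∈ PointedCone.hull ℝ (latPt '' (s : Set L)) ↔
      ∃ c : L → ℝ, (∀ i, 0 ≤ c i) ∧ x = ∑ i ∈ s, c i • latPt i := by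
  constructor
  · intro hx
    induction hx using Submodule.span_induction with
    | mem y hy =>
      classical
      obtain ⟨n, hn, rfl⟩ := hy
      refine ⟨fun i => if i = n then 1 else 0, fun i => by dsimp only; split_ifs <;> norm_num, ?_⟩
      simp [Finset.sum_ite_eq', Finset.mem_coe.1 hn]
    | zero => exact ⟨0, fun _ => le_rfl, by simp⟩
    | add y z _ _ hy hz =>
      obtain ⟨c, hc, rfl⟩ := hy
      obtain ⟨d, hd, rfl⟩ := hz
      exact ⟨c + d, fun i => add_nonneg (hc i) (hd i), by
        simp [add_smul, Finset.sum_add_distrib]⟩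
    | smul a y _ hy =>
      obtain ⟨c, hc, rfl⟩ := hy
      refine ⟨fun i => a * c i, fun i => mul_nonneg a.2 (hc i), ?_⟩
      change (a : ℝ) • ∑ i ∈ s, c i • latPt i = _
      rw [Finset.smul_sum]
      exact Finset.sum_congr rfl fun i _ => smul_smul _ _ _
  · rintro ⟨c, hc, rfl⟩
    refine Submodule.sum_mem _ fun i hi => PointedCone.smul_mem _ (hc i) ?_
    exact PointedCone.subset_hull ⟨i, hi, rfl⟩

lemma latPt_sum {ι : Type*} (s : Finset ι) (f : ι → L) :
    latPt (∑ i ∈ s, f i) = ∑ i ∈ s, latPt (f i) := by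
  classical
  induction s using Finset.induction_on with
  | empty => simp [latPt_zero]
  | insert a s ha ih => rw [Finset.sum_insert ha, Finset.sum_insert ha, latPt_add, ih]

/-- Double description step: generators with l ≥ 0 are kept, and each pair l i ≥ 0 > l j contributes
l i • j − l j • i, which lies on the hyperplane l = 0. -/
lemma IsLatticeGenerated.inf_halfSpace {C : PointedCone ℝ (RealExt L)}
    (hC : IsLatticeGenerated C) (l : Module.Dual ℤ L) : IsLatticeGenerated (C ⊓ halfSpace l) := by
  classical
  obtain ⟨s, rfl⟩ := hC
  let p := s.filter fun i => 0 ≤ l i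
  let q := s.filter fun i => ¬ 0 ≤ l i
  refine ⟨p ∪ (p ×ˢ q).image fun ij => l ij.1 • ij.2 + (-l ij.2) • ij.1, ?_⟩
  have hpq : ∀ (i j : L), latPt (l i • j + (-l j) • i) =
      (l i : ℝ) • latPt j + (-(l j : ℝ)) • latPt i := by
    intro i j
    rw [latPt_add, latPt_zsmul, latPt_zsmul]
    push_cast
    rfl
  apply le_antisymm
  · rintro x ⟨hx, hlx⟩
    obtain ⟨c, hc, rfl⟩ := mem_hull_latPt.1 hx
    replace hlx : 0 ≤ evalR l (∑ i ∈ s, c i • latPt i) := hlx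
    have hsum : ∀ f : L → RealExt L, ∑ i ∈ s, f i = ∑ i ∈ p, f i + ∑ i ∈ q, f i :=
      fun f => (Finset.sum_filter_add_sum_filter_not s _ f).symm
    set a : ℝ := ∑ i ∈ p, c i * l i with ha
    set b : ℝ := ∑ j ∈ q, c j * (-l j) with hb
    have hp : ∀ i ∈ p, (0 : ℝ) ≤ l i := fun i hi => by exact_mod_cast (Finset.mem_filter.1 hi).2
    have hq : ∀ j ∈ q, (l j : ℝ) < 0 := fun j hj => by
      exact_mod_cast not_le.1 (Finset.mem_filter.1 hj).2
    have hab : 0 ≤ a - b := by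
      rw [hsum, map_add, map_sum, map_sum] at hlx
      simp only [map_smul, evalR_latPt, smul_eq_mul] at hlx
      simpa [ha, hb, Finset.sum_neg_distrib] using hlx
    have hb0 : 0 ≤ b := Finset.sum_nonneg fun j hj =>
      mul_nonneg (hc j) (by linarith [hq j hj])
    have memp : ∀ i ∈ p, latPt i ∈ PointedCone.hull ℝ (latPt ''
        ((p ∪ (p ×ˢ q).image fun ij => l ij.1 • ij.2 + (-l ij.2) • ij.1 : Finset L) : Set L)) :=
      fun i hi => PointedCone.subset_hull
        ⟨i, Finset.mem_coe.2 (Finset.mem_union_left _ hi), rfl⟩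
    have mempq : ∀ i ∈ p, ∀ j ∈ q, (l i : ℝ) • latPt j + (-(l j : ℝ)) • latPt i ∈
        PointedCone.hull ℝ (latPt ''
        ((p ∪ (p ×ˢ q).image fun ij => l ij.1 • ij.2 + (-l ij.2) • ij.1 : Finset L) : Set L)) := by
      intro i hi j hj
      rw [← hpq]
      exact PointedCone.subset_hull ⟨_, Finset.mem_coe.2 (Finset.mem_union_right _
        (Finset.mem_image.2 ⟨(i, j), Finset.mem_product.2 ⟨hi, hj⟩, rfl⟩)), rfl⟩
    rw [hsum]
    rcases hb0.eq_or_lt with hb1 | hb1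
    · have hz : ∀ j ∈ q, c j • latPt j = 0 := by
        intro j hj
        have := (Finset.sum_eq_zero_iff_of_nonneg (fun j hj =>
          mul_nonneg (hc j) (by linarith [hq j hj]))).1 hb1.symm j hj
        rcases mul_eq_zero.1 this with h | h
        · rw [h, zero_smul]
        · linarith [hq j hj]
      rw [Finset.sum_eq_zero hz, add_zero]
      exact Submodule.sum_mem _ fun i hi => PointedCone.smul_mem _ (hc i) (memp i hi)
    · have ha0 : 0 < a := by linarith
      -- Here `a` and `b` are the total positive and negative weights of l, with b ≤ a. The share b
      -- / a of the positive part is used up against the negative part, distributed over the pairs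
      -- in proportion to their coefficients.
      have e : ∑ i ∈ p, c i • latPt i + ∑ j ∈ q, c j • latPt j =
          (1 - b / a) • ∑ i ∈ p, c i • latPt i +
          ∑ i ∈ p, ∑ j ∈ q, (c i * c j / a) •
            ((l i : ℝ) • latPt j + (-(l j : ℝ)) • latPt i) := by
        have e1 : ∑ i ∈ p, ∑ j ∈ q, (c i * c j / a) • ((l i : ℝ) • latPt j) =
            ∑ j ∈ q, c j • latPt j := by
          rw [Finset.sum_comm]
          refine Finset.sum_congr rfl fun j _ => ?_
          rw [show c j • latPt j = ((∑ i ∈ p, c i * l i) * (c j / a)) • latPt j by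
            rw [← ha]; congr 1; field_simp, Finset.sum_mul, Finset.sum_smul]
          refine Finset.sum_congr rfl fun i _ => ?_
          rw [smul_smul]; congr 1; ring
        have e2 : ∑ i ∈ p, ∑ j ∈ q, (c i * c j / a) • ((-(l j : ℝ)) • latPt i) =
            (b / a) • ∑ i ∈ p, c i • latPt i := by
          rw [Finset.smul_sum]
          refine Finset.sum_congr rfl fun i _ => ?_
          rw [smul_smul, hb, Finset.sum_div, Finset.sum_mul, Finset.sum_smul]
          refine Finset.sum_congr rfl fun j _ => ?_
          rw [smul_smul]; congr 1; ring
        simp only [smul_add, Finset.sum_add_distrib] at e1 e2 ⊢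
        rw [e1, e2, sub_smul, one_smul]
        abel
      rw [e]
      refine Submodule.add_mem _ (PointedCone.smul_mem _ ?_ (Submodule.sum_mem _ fun i hi =>
        PointedCone.smul_mem _ (hc i) (memp i hi))) (Submodule.sum_mem _ fun i hi =>
          Submodule.sum_mem _ fun j hj => PointedCone.smul_mem _ ?_ (mempq i hi j hj))
      · rw [sub_nonneg]
        exact (div_le_one ha0).2 (by linarith)
      · exact div_nonneg (mul_nonneg (hc i) (hc j)) ha0.le
  · refine Submodule.span_le.2 ?_
    rintro _ ⟨n, hn, rfl⟩
    have hs : ∀ i ∈ s, latPt i ∈ PointedCone.hull ℝ (latPt '' (s : Set L)) :=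
      fun i hi => PointedCone.subset_hull ⟨i, hi, rfl⟩
    rcases Finset.mem_union.1 (Finset.mem_coe.1 hn) with h | h
    · exact ⟨hs n (Finset.mem_filter.1 h).1, by
        change 0 ≤ evalR l (latPt n)
        rw [evalR_latPt]
        exact_mod_cast (Finset.mem_filter.1 h).2⟩
    · obtain ⟨⟨i, j⟩, hij, rfl⟩ := Finset.mem_image.1 h
      obtain ⟨hi, hj⟩ := Finset.mem_product.1 hij
      obtain ⟨hi1, hi2⟩ := Finset.mem_filter.1 hi
      obtain ⟨hj1, hj2⟩ := Finset.mem_filter.1 hj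
      refine ⟨?_, ?_⟩
      · change latPt (l i • j + (-l j) • i) ∈ PointedCone.hull ℝ (latPt '' (s : Set L))
        rw [hpq]
        refine Submodule.add_mem _ (PointedCone.smul_mem _ (by exact_mod_cast hi2) (hs j hj1))
          (PointedCone.smul_mem _ ?_ (hs i hi1))
        rw [neg_nonneg]
        exact_mod_cast (not_le.1 hj2).le
      · change 0 ≤ evalR l (latPt (l i • j + (-l j) • i))
        rw [evalR_latPt]
        simp only [map_add, map_smul, smul_eq_mul]
        push_cast
        apply le_of_eq
        ring

/-- The cone of solutions of finitely many integral inequalities. -/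
lemma IsLatticeGenerated.inf_iInf {C : PointedCone ℝ (RealExt L)} (hC : IsLatticeGenerated C)
    (T : Finset (Module.Dual ℤ L)) : IsLatticeGenerated (C ⊓ T.inf halfSpace) := by
  classical
  induction T using Finset.induction_on with
  | empty => simpa using hC
  | insert l T _ ih =>
    rw [Finset.inf_insert, inf_comm (halfSpace l), ← inf_assoc]
    exact ih.inf_halfSpace l

lemma mem_finset_inf_halfSpace {T : Finset (Module.Dual ℤ L)} {x : RealExt L} :
    x ∈ T.inf halfSpace ↔ ∀ l ∈ T, 0 ≤ evalR l x := by
  classical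
  induction T using Finset.induction_on with
  | empty => simp
  | insert l T _ ih =>
    rw [Finset.inf_insert, Submodule.mem_inf, ih]
    simp [mem_halfSpace]

lemma isLatticeGenerated_top [Module.Finite ℤ L] :
    IsLatticeGenerated (⊤ : PointedCone ℝ (RealExt L)) := by
  classical
  obtain ⟨s, hs⟩ := (Module.Finite.fg_top : (⊤ : Submodule ℤ L).FG)
  refine ⟨s ∪ s.image (fun i => -i), ?_⟩
  symm
  rw [eq_top_iff]
  rintro x -
  set D := PointedCone.hull ℝ (latPt '' ((s ∪ s.image (fun i => -i) : Finset L) : Set L)) with hD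
  have h1 : ∀ n : L, latPt n ∈ D ∧ latPt (-n) ∈ D := by
    intro n
    have hn : n ∈ Submodule.span ℤ (s : Set L) := hs ▸ Submodule.mem_top
    induction hn using Submodule.span_induction with
    | mem y hy =>
      exact ⟨PointedCone.subset_hull ⟨y, by simpa using Or.inl hy, rfl⟩,
        PointedCone.subset_hull ⟨-y, by simpa using Or.inr hy, rfl⟩⟩
    | zero => simp [latPt_zero]
    | add y z _ _ hy hz =>
      rw [neg_add, latPt_add, latPt_add]
      exact ⟨D.add_mem hy.1 hz.1, D.add_mem hy.2 hz.2⟩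
    | smul a y _ hy =>
      rw [latPt_neg] at hy
      rw [latPt_neg, latPt_zsmul]
      rcases le_total (0 : ℝ) a with ha | ha
      · refine ⟨PointedCone.smul_mem _ ha hy.1, ?_⟩
        rw [← smul_neg]
        exact PointedCone.smul_mem _ ha hy.2
      · have h2 := PointedCone.smul_mem _ (neg_nonneg.2 ha) hy.2
        have h3 := PointedCone.smul_mem _ (neg_nonneg.2 ha) hy.1
        rw [smul_neg, neg_smul, neg_neg] at h2
        rw [neg_smul] at h3
        exact ⟨h2, h3⟩
  have h2 : x ∈ Submodule.span ℝ (Set.range (latPt : L → RealExt L)) := by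
    rw [span_latPt]; trivial
  have h3 : x ∈ D ∧ -x ∈ D := by
    induction h2 using Submodule.span_induction with
    | mem y hy =>
      obtain ⟨n, rfl⟩ := hy
      rw [← latPt_neg]
      exact h1 n
    | zero => simp
    | add y z _ _ hy hz =>
      rw [neg_add]
      exact ⟨D.add_mem hy.1 hz.1, D.add_mem hy.2 hz.2⟩
    | smul a y _ hy =>
      rcases le_total (0 : ℝ) a with ha | ha
      · refine ⟨PointedCone.smul_mem _ ha hy.1, ?_⟩
        rw [← smul_neg]
        exact PointedCone.smul_mem _ ha hy.2
      · have h2 := PointedCone.smul_mem _ (neg_nonneg.2 ha) hy.2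
        have h3 := PointedCone.smul_mem _ (neg_nonneg.2 ha) hy.1
        rw [smul_neg, neg_smul, neg_neg] at h2
        rw [neg_smul] at h3
        exact ⟨h2, h3⟩
  exact h3.1

/-- One half of the Minkowski–Weyl theorem, by cutting the whole space with one half space at a
time. -/
lemma isLatticeGenerated_halfSpaces [Module.Finite ℤ L] (T : Finset (Module.Dual ℤ L)) :
    IsLatticeGenerated (T.inf halfSpace) := by
  simpa using (isLatticeGenerated_top (L := L)).inf_iInf T

variable [Module.Free ℤ L] [Module.Finite ℤ L]

/-- A cone generated by finitely many lattice points is defined by finitely many integral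
inequalities. -/
lemma IsLatticeGenerated.exists_halfSpaces {C : PointedCone ℝ (RealExt L)}
    (hC : IsLatticeGenerated C) : ∃ T : Finset (Module.Dual ℤ L), C = T.inf halfSpace := by
  classical
  obtain ⟨s, rfl⟩ := hC
  induction s using Finset.induction_on with
  | empty =>
    let b := Module.Free.chooseBasis ℤ L
    obtain ⟨T, hT⟩ := (Module.Finite.fg_top : (⊤ : Submodule ℤ (Module.Dual ℤ L)).FG)
    refine ⟨T ∪ T.image (fun i => -i), ?_⟩
    ext x
    rw [mem_finset_inf_halfSpace]
    constructor
    · intro hx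
      simp only [Finset.coe_empty, Set.image_empty, Submodule.span_empty, Submodule.mem_bot] at hx
      subst hx
      simp
    · intro hx
      have : x = 0 := by
        refine eq_zero_of_evalR fun l => ?_
        have hl : l ∈ Submodule.span ℤ (T : Set (Module.Dual ℤ L)) := hT ▸ Submodule.mem_top
        induction hl using Submodule.span_induction with
        | mem y hy =>
          have h1 := hx y (Finset.mem_union_left _ hy)
          have h2 := hx (-y) (Finset.mem_union_right _ (Finset.mem_image_of_mem _ hy))
          rw [evalR_neg] at h2
          linarith
        | zero => exact evalR_zero x
        | add y z _ _ hy hz => rw [evalR_add, hy, hz, add_zero]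
        | smul a y _ hy => rw [evalR_smul, hy, mul_zero]
      rw [this]
      exact Submodule.zero_mem _
  | insert v s _ ih =>
    obtain ⟨T, hT⟩ := ih
    -- Fourier–Motzkin elimination of t from the conditions 0 ≤ l (x − t v) with l ∈ T: functionals
    -- nonnegative at v survive, and each pair l v ≥ 0 > k v gives a nonnegative combination
    -- vanishing at v.
    let pos := T.filter fun l => 0 ≤ l v
    let neg := T.filter fun l => ¬ 0 ≤ l v
    refine ⟨pos ∪ (pos ×ˢ neg).image fun lk => (-lk.2 v) • lk.1 + lk.1 v • lk.2, ?_⟩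
    ext x
    rw [mem_finset_inf_halfSpace, Finset.coe_insert, Set.image_insert_eq, Submodule.mem_span_insert]
    constructor
    · rintro ⟨⟨t, ht⟩, z, hz, rfl⟩ l hl
      change 0 ≤ evalR l (t • latPt v + z)
      replace hz : z ∈ PointedCone.hull ℝ (latPt '' (s : Set L)) := hz
      rw [hT, mem_finset_inf_halfSpace] at hz
      rcases Finset.mem_union.1 hl with h | h
      · obtain ⟨h1, h2⟩ := Finset.mem_filter.1 h
        rw [map_add, map_smul, evalR_latPt, smul_eq_mul]
        exact add_nonneg (mul_nonneg ht (by exact_mod_cast h2)) (hz l h1)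
      · obtain ⟨⟨l, k⟩, hlk, rfl⟩ := Finset.mem_image.1 h
        obtain ⟨h1, h2⟩ := Finset.mem_product.1 hlk
        obtain ⟨h3, h4⟩ := Finset.mem_filter.1 h1
        obtain ⟨h5, h6⟩ := Finset.mem_filter.1 h2
        have h4' : (0 : ℝ) ≤ l v := by exact_mod_cast h4
        have h6' : (k v : ℝ) < 0 := by exact_mod_cast not_le.1 h6
        simp only [evalR_add, evalR_smul, map_add, map_smul, evalR_latPt, smul_eq_mul]
        have e1 := mul_nonneg (neg_nonneg.2 h6'.le) (hz l h3)
        have e2 := mul_nonneg h4' (hz k h5)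
        have e3 : ((-k v) • l + l v • k) v = 0 := by
          simp only [LinearMap.add_apply, LinearMap.smul_apply, smul_eq_mul]
          ring
        rw [e3]
        push_cast
        linarith
    · intro hx
      -- The functionals negative at v bound t from below; t is the greatest of these bounds and 0.
      have ht : ∃ t : ℝ, 0 ≤ t ∧ (∀ k ∈ neg, evalR k x / k v ≤ t) ∧
          (t = 0 ∨ ∃ k ∈ neg, t = evalR k x / k v) := by
        obtain ⟨t, ht, hmax⟩ := Finset.exists_max_image
          (insert (0 : ℝ) (neg.image fun k => evalR k x / k v)) id ⟨0, Finset.mem_insert_self _ _⟩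
        refine ⟨t, hmax 0 (Finset.mem_insert_self _ _), fun k hk => hmax _
          (Finset.mem_insert_of_mem (Finset.mem_image.2 ⟨k, hk, rfl⟩)), ?_⟩
        rcases Finset.mem_insert.1 ht with h | h
        · exact Or.inl h
        · obtain ⟨k, hk, h⟩ := Finset.mem_image.1 h
          exact Or.inr ⟨k, hk, h.symm⟩
      obtain ⟨t, ht0, htk, ht⟩ := ht
      refine ⟨⟨t, ht0⟩, x - t • latPt v, ?_, ?_⟩
      · change x - t • latPt v ∈ PointedCone.hull ℝ (latPt '' (s : Set L))
        rw [hT, mem_finset_inf_halfSpace]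
        intro l hl
        rw [map_sub, map_smul, evalR_latPt, smul_eq_mul, sub_nonneg]
        by_cases hlv : 0 ≤ l v
        · have hlp : l ∈ pos := Finset.mem_filter.2 ⟨hl, hlv⟩
          have hl0 := hx l (Finset.mem_union_left _ hlp)
          rcases ht with rfl | ⟨k, hk, rfl⟩
          · simpa using hl0
          · have h6 : (k v : ℝ) < 0 := by exact_mod_cast not_le.1 (Finset.mem_filter.1 hk).2
            have h7 := hx _ (Finset.mem_union_right _
              (Finset.mem_image.2 ⟨(l, k), Finset.mem_product.2 ⟨hlp, hk⟩, rfl⟩))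
            rw [evalR_add, evalR_smul, evalR_smul] at h7
            push_cast at h7
            rw [div_mul_eq_mul_div, div_le_iff_of_neg h6]
            linarith
        · have hk : l ∈ neg := Finset.mem_filter.2 ⟨hl, hlv⟩
          have h6 : (l v : ℝ) < 0 := by exact_mod_cast not_le.1 hlv
          have := htk l hk
          rw [div_le_iff_of_neg h6] at this
          linarith
      · change x = t • latPt v + (x - t • latPt v)
        abel

lemma IsLatticeGenerated.inf {C D : PointedCone ℝ (RealExt L)} (hC : IsLatticeGenerated C)
    (hD : IsLatticeGenerated D) : IsLatticeGenerated (C ⊓ D) := by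
  obtain ⟨T, rfl⟩ := hD.exists_halfSpaces
  exact hC.inf_iInf T

/-- If the lattice points of a cone are covered by finitely many cones, so is the cone. -/
lemma IsLatticeGenerated.exists_mem_of_latPt {C : PointedCone ℝ (RealExt L)}
    (hC : IsLatticeGenerated C) {A : Set (PointedCone ℝ (RealExt L))} (hA : A.Finite)
    (hg : ∀ D ∈ A, IsLatticeGenerated D) (h : ∀ n : L, latPt n ∈ C → ∃ D ∈ A, latPt n ∈ D)
    {x : RealExt L} (hx : x ∈ C) : ∃ D ∈ A, x ∈ D := by
  by_contra hcon
  push Not at hcon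
  have h1 : ∀ D ∈ A, ∃ l : Module.Dual ℤ L, (∀ y ∈ D, 0 ≤ evalR l y) ∧ evalR l x < 0 := by
    intro D hD
    obtain ⟨T, rfl⟩ := (hg D hD).exists_halfSpaces
    have := hcon _ hD
    rw [mem_finset_inf_halfSpace] at this
    push Not at this
    obtain ⟨l, hl, hlx⟩ := this
    exact ⟨l, fun y hy => mem_finset_inf_halfSpace.1 hy l hl, hlx⟩
  obtain ⟨s, rfl⟩ := hC
  obtain ⟨c, hc, rfl⟩ := mem_hull_latPt.1 hx
  -- Rounding up the coefficients of N x changes the value of a functional by an amount bounded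
  -- independently of N. A functional negative at x is thus negative at `n N` for large N, and one N
  -- serves for all the finitely many cones.
  let n : ℕ → L := fun N => ∑ i ∈ s, ⌈(N : ℝ) * c i⌉₊ • i
  have hn : ∀ N, latPt (n N) = ∑ i ∈ s, (⌈(N : ℝ) * c i⌉₊ : ℝ) • latPt i := by
    intro N
    rw [latPt_sum]
    exact Finset.sum_congr rfl fun i _ => latPt_nsmul _ _
  have h2 : ∀ D ∈ A, ∀ᶠ N : ℕ in Filter.atTop, latPt (n N) ∉ D := by
    intro D hD
    obtain ⟨l, hl, hlx⟩ := h1 D hD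
    set e := evalR l (∑ i ∈ s, c i • latPt i) with he
    obtain ⟨N₀, hN₀⟩ := exists_nat_gt ((∑ i ∈ s, |(l i : ℝ)|) / (-e))
    filter_upwards [Filter.eventually_ge_atTop N₀] with N hN hmem
    have h3 := hl _ hmem
    have h4 : evalR l (latPt (n N)) ≤ N * e + ∑ i ∈ s, |(l i : ℝ)| := by
      rw [hn, he, map_sum, map_sum, Finset.mul_sum, ← Finset.sum_add_distrib]
      refine Finset.sum_le_sum fun i _ => ?_
      simp only [map_smul, evalR_latPt, smul_eq_mul]
      have h5 : |(⌈(N : ℝ) * c i⌉₊ : ℝ) - N * c i| ≤ 1 := by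
        have h6 := Nat.le_ceil ((N : ℝ) * c i)
        have h7 := Nat.ceil_lt_add_one (mul_nonneg (Nat.cast_nonneg N) (hc i))
        rw [abs_le]
        constructor <;> linarith
      have h8 : ((⌈(N : ℝ) * c i⌉₊ : ℝ) - N * c i) * l i ≤ |(l i : ℝ)| := by
        refine (le_abs_self _).trans ?_
        rw [abs_mul]
        exact mul_le_of_le_one_left (abs_nonneg _) h5
      linarith
    have h5 : (∑ i ∈ s, |(l i : ℝ)|) < N * (-e) := by
      rw [div_lt_iff₀ (by linarith)] at hN₀
      have : (N₀ : ℝ) ≤ N := by exact_mod_cast hN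
      nlinarith
    linarith
  have h3 := (Filter.eventually_all_finite hA).2 h2
  obtain ⟨N, hN⟩ := h3.exists
  obtain ⟨D, hD, hmem⟩ := h (n N) (by
    rw [hn]
    exact Submodule.sum_mem _ fun i hi => PointedCone.smul_mem _ (Nat.cast_nonneg _)
      (PointedCone.subset_hull ⟨i, hi, rfl⟩))
  exact hN D hD hmem

end Rational

/-! ### Faces, images and interior points of rational cones -/

section RationalCones

variable {L L' : Type} [AddCommGroup L] [AddCommGroup L']

lemma IsLatticeGenerated.face {C F : PointedCone ℝ (RealExt L)} (hC : IsLatticeGenerated C)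
    (hF : F.IsFaceOf C) : IsLatticeGenerated F := by
  classical
  obtain ⟨s, rfl⟩ := hC
  refine ⟨s.filter fun i => latPt i ∈ F, ?_⟩
  refine (hull_face hF).trans ?_
  congr 1
  ext x
  constructor
  · rintro ⟨⟨n, hn, rfl⟩, h2⟩
    exact ⟨n, Finset.mem_coe.2 (Finset.mem_filter.2 ⟨hn, h2⟩), rfl⟩
  · rintro ⟨n, hn, rfl⟩
    have hn := Finset.mem_filter.1 (Finset.mem_coe.1 hn)
    exact ⟨⟨n, hn.1, rfl⟩, hn.2⟩

lemma IsLatticeGenerated.map {C : PointedCone ℝ (RealExt L)} (hC : IsLatticeGenerated C)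
    (f : L →ₗ[ℤ] L') : IsLatticeGenerated (C.map (realMap f)) := by
  classical
  obtain ⟨s, rfl⟩ := hC
  refine ⟨s.image f, ?_⟩
  rw [PointedCone.map, Submodule.map_span]
  congr 1
  ext x
  simp only [Set.mem_image, Finset.coe_image]
  constructor
  · rintro ⟨_, ⟨n, hn, rfl⟩, rfl⟩
    exact ⟨f n, ⟨n, hn, rfl⟩, (realMap_latPt f n).symm⟩
  · rintro ⟨_, ⟨n, hn, rfl⟩, rfl⟩
    exact ⟨latPt n, ⟨n, hn, rfl⟩, realMap_latPt f n⟩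

lemma IsLatticeGenerated.finite_faces {C : PointedCone ℝ (RealExt L)}
    (hC : IsLatticeGenerated C) : {F : PointedCone ℝ (RealExt L) | F.IsFaceOf C}.Finite := by
  classical
  obtain ⟨s, rfl⟩ := hC
  refine Set.Finite.subset ((s : Set L).toFinite.finite_subsets.image
    fun t => PointedCone.hull ℝ (latPt '' t)) ?_
  intro F hF
  refine ⟨{n | n ∈ s ∧ latPt n ∈ F}, fun n hn => hn.1, ?_⟩
  change PointedCone.hull ℝ (latPt '' {n | n ∈ s ∧ latPt n ∈ F}) = F
  conv_rhs => rw [hull_face hF]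
  congr 1
  ext x
  constructor
  · rintro ⟨n, hn, rfl⟩
    exact ⟨⟨n, hn.1, rfl⟩, hn.2⟩
  · rintro ⟨⟨n, hn, rfl⟩, h2⟩
    exact ⟨n, ⟨hn, h2⟩, rfl⟩

/-- A cone generated by lattice points contains a relatively interior lattice point. -/
lemma IsLatticeGenerated.exists_isRelInt {C : PointedCone ℝ (RealExt L)}
    (hC : IsLatticeGenerated C) : ∃ n : L, IsRelInt C (latPt n) := by
  classical
  obtain ⟨s, rfl⟩ := hC
  set C := PointedCone.hull ℝ (latPt '' (s : Set L)) with hC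
  have hs : ∀ i ∈ s, latPt i ∈ C := fun i hi => PointedCone.subset_hull ⟨i, hi, rfl⟩
  have hmem : latPt (∑ i ∈ s, i) ∈ C := by
    rw [latPt_sum]
    exact Submodule.sum_mem _ hs
  -- Each generator can be subtracted once from the sum of all generators, so the smallest face
  -- containing the sum is everything.
  refine ⟨∑ i ∈ s, i, hmem, ?_⟩
  have : C ≤ minFace C _ hmem := by
    refine Submodule.span_le.2 ?_
    rintro _ ⟨i, hi, rfl⟩
    refine ⟨hs i hi, 1, one_pos, ?_⟩
    rw [latPt_sum, one_smul, ← Finset.add_sum_erase s _ hi, add_sub_cancel_left]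
    exact Submodule.sum_mem _ fun j hj => hs j (Finset.mem_of_mem_erase hj)
  exact fun y hy => (this hy).2

lemma IsRationalCone.face {C F : PointedCone ℝ (RealExt L)} (hC : IsRationalCone C)
    (hF : F.IsFaceOf C) : IsRationalCone F :=
  ⟨IsLatticeGenerated.face hC.generated hF, fun x h1 h2 => hC.strictlyConvex x (hF.le h1) (hF.le h2)⟩

lemma IsRationalCone.map {C : PointedCone ℝ (RealExt L)} (hC : IsRationalCone C)
    {f : L →ₗ[ℤ] L'} (hf : Function.Injective f) : IsRationalCone (C.map (realMap f)) := by
  refine ⟨IsLatticeGenerated.map hC.generated f, ?_⟩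
  rintro _ ⟨x, hx, rfl⟩ ⟨y, hy, e⟩
  have : y = -x := realMap_injective hf (by rw [map_neg]; exact e)
  subst this
  have := hC.strictlyConvex x hx hy
  subst this
  exact map_zero _

lemma coneSpan_map (C : PointedCone ℝ (RealExt L)) (f : L →ₗ[ℤ] L') :
    coneSpan (C.map (realMap f)) = (coneSpan C).map (realMap f) := by
  rw [coneSpan, coneSpan, Submodule.map_span]
  rfl

/-- A lattice point in the real span of a sublattice is rationally in the sublattice. -/
lemma exists_nsmul_mem_of_latPt_mem_span [Module.Finite ℤ L] {N : Submodule ℤ L} {l : L}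
    (h : latPt l ∈ Submodule.span ℝ (latPt '' (N : Set L))) : ∃ k : ℕ, 0 < k ∧ k • l ∈ N := by
  -- The torsion-free quotient B of A is free, and its functionals vanish on the real span of N.
  -- Hence l dies in B, that is, l is torsion in A.
  let A := L ⧸ N
  let B := A ⧸ Submodule.torsion ℤ A
  let π : L →ₗ[ℤ] B := (Submodule.torsion ℤ A).mkQ.comp N.mkQ
  have h1 : π l = 0 := by
    rw [← Module.forall_dual_apply_eq_zero_iff ℤ]
    intro f
    have h2 : ∀ x ∈ Submodule.span ℝ (latPt '' (N : Set L)), evalR (f.comp π) x = 0 := by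
      intro x hx
      induction hx using Submodule.span_induction with
      | mem y hy =>
        obtain ⟨n, hn, rfl⟩ := hy
        have : N.mkQ n = 0 := by simpa using hn
        simp [π, this]
      | zero => simp
      | add y z _ _ hy hz => rw [map_add, hy, hz, add_zero]
      | smul a y _ hy => rw [map_smul, hy, smul_zero]
    have h3 := h2 _ h
    rw [evalR_latPt] at h3
    exact_mod_cast h3
  have h2 : N.mkQ l ∈ Submodule.torsion ℤ A := by
    rw [← Submodule.Quotient.mk_eq_zero]
    exact h1
  obtain ⟨⟨a, ha⟩, hal⟩ := h2
  have ha0 : a ≠ 0 := nonZeroDivisors.ne_zero ha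
  have h3 : a • l ∈ N := by
    rw [← Submodule.Quotient.mk_eq_zero]
    exact hal
  refine ⟨a.natAbs, Int.natAbs_pos.2 ha0, ?_⟩
  rw [← natCast_zsmul]
  rcases Int.natAbs_eq a with h | h
  · rwa [← h]
  · rw [show (a.natAbs : ℤ) = -a by omega, neg_smul]
    exact N.neg_mem h3

end RationalCones

/-! ### Cones with lattices -/

section LatticeCones

variable {L L' : Type} [AddCommGroup L] [AddCommGroup L']

/-- The saturated lattice of a cone, as a submodule. -/
def spanMod (C : PointedCone ℝ (RealExt L)) : Submodule ℤ L := (spanLat C).toIntSubmodule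

lemma mem_spanMod {C : PointedCone ℝ (RealExt L)} {l : L} :
    l ∈ spanMod C ↔ latPt l ∈ coneSpan C := Iff.rfl

lemma coneSpan_mono {C D : PointedCone ℝ (RealExt L)} (h : C ≤ D) : coneSpan C ≤ coneSpan D :=
  Submodule.span_mono h

lemma mem_coneSpan {C : PointedCone ℝ (RealExt L)} {x : RealExt L} (h : x ∈ C) :
    x ∈ coneSpan C := Submodule.subset_span h

/-- A rational cone together with a lattice of finite index in the lattice points of its span. -/
structure IsLatticeCone (p : PointedCone ℝ (RealExt L) × Submodule ℤ L) : Prop where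
  rational : IsRationalCone p.1
  le_span : p.2 ≤ spanMod p.1
  exists_nsmul : ∀ l, latPt l ∈ p.1 → ∃ k : ℕ, 0 < k ∧ k • l ∈ p.2

lemma isLatticeCone_spanMod {C : PointedCone ℝ (RealExt L)} (hC : IsRationalCone C) :
    IsLatticeCone (C, spanMod C) :=
  ⟨hC, le_rfl, fun l hl => ⟨1, one_pos, by rw [one_smul]; exact mem_coneSpan hl⟩⟩

lemma IsLatticeCone.exists_isRelInt {p : PointedCone ℝ (RealExt L) × Submodule ℤ L}
    (hp : IsLatticeCone p) : ∃ l ∈ p.2, IsRelInt p.1 (latPt l) := by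
  obtain ⟨n, hn⟩ := IsLatticeGenerated.exists_isRelInt hp.rational.generated
  obtain ⟨k, hk, h⟩ := hp.exists_nsmul n hn.1
  refine ⟨_, h, ?_⟩
  rw [latPt_nsmul]
  exact hn.smul (by exact_mod_cast hk)

/-- A homomorphism from the lattice of an RPC that maps the cone into `p.1` and the lattice into
`p.2`. -/
def Factors {ρ : RPC} (g : ρ.N →ₗ[ℤ] L) (p : PointedCone ℝ (RealExt L) × Submodule ℤ L) : Prop :=
  (∀ n, latPt n ∈ ρ.cone → latPt (g n) ∈ p.1) ∧ ∀ n, g n ∈ p.2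

lemma realMap_mem_of_latPt {ρ : RPC} {g : ρ.N →ₗ[ℤ] L} {C : PointedCone ℝ (RealExt L)}
    (h : ∀ n, latPt n ∈ ρ.cone → latPt (g n) ∈ C) {x : RealExt ρ.N} (hx : x ∈ ρ.cone) :
    realMap g x ∈ C := by
  obtain ⟨s, hs⟩ := ρ.rational.generated
  have : ρ.cone ≤ C.comap (realMap g) := by
    rw [hs]
    refine Submodule.span_le.2 ?_
    rintro _ ⟨n, hn, rfl⟩
    change realMap g (latPt n) ∈ C
    rw [realMap_latPt]
    exact h n (by rw [hs]; exact PointedCone.subset_hull ⟨n, hn, rfl⟩)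
  exact this hx

/-- The morphism of RPCs given by a homomorphism that maps lattice points of the cone into the
cone. -/
def RPC.homMk {ρ τ : RPC} (g : ρ.N →ₗ[ℤ] τ.N)
    (h : ∀ n, latPt n ∈ ρ.cone → latPt (g n) ∈ τ.cone) : ρ ⟶ τ :=
  ⟨g, fun _ hx => realMap_mem_of_latPt h hx⟩

@[simp] lemma RPC.id_lin (τ : RPC) : RPCHom.lin (𝟙 τ) = LinearMap.id := rfl

lemma RPC.hom_ext {ρ τ : RPC} {f g : ρ ⟶ τ} (h : ∀ n, RPCHom.lin f n = RPCHom.lin g n) : f = g :=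
  RPCHom.ext (LinearMap.ext h)

lemma RPC.maps_latPt {ρ τ : RPC} (g : ρ ⟶ τ) {n : ρ.N} (hn : latPt n ∈ ρ.cone) :
    latPt (RPCHom.lin g n) ∈ τ.cone := by
  rw [← realMap_latPt]
  exact RPCHom.maps g _ hn

/-- The ray `ℝ_{≥0}` with lattice `ℤ`. -/
def ray : RPC where
  N := ℤ
  cone := PointedCone.hull ℝ (latPt '' (({1} : Finset ℤ) : Set ℤ))
  rational := by
    refine ⟨⟨{1}, rfl⟩, ?_⟩
    intro x hx hx'
    obtain ⟨c, hc, rfl⟩ := mem_hull_latPt.1 hx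
    obtain ⟨d, hd, h⟩ := mem_hull_latPt.1 hx'
    rw [Finset.sum_singleton] at h ⊢
    rw [Finset.sum_singleton] at h
    have h2 := congrArg (evalR (LinearMap.id : ℤ →ₗ[ℤ] ℤ)) h
    simp only [map_neg, map_smul, evalR_latPt, LinearMap.id_apply, Int.cast_one, smul_eq_mul,
      mul_one] at h2
    have : c 1 = 0 := by linarith [hc 1, hd 1]
    rw [this, zero_smul]
  full := by
    rw [eq_top_iff, ← span_latPt, Submodule.span_le]
    rintro _ ⟨n, rfl⟩
    have h1 : latPt n = (n : ℝ) • latPt (1 : ℤ) := by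
      rw [← latPt_zsmul]
      simp
    rw [h1]
    refine Submodule.smul_mem _ _ (Submodule.subset_span ?_)
    exact PointedCone.subset_hull ⟨1, by simp, rfl⟩

/-- The lattice points of the ray. -/
def rayPt (n : ℤ) : ray.N := n

lemma ray_cone : ray.cone = PointedCone.hull ℝ (latPt '' (({rayPt 1} : Finset ray.N) : Set ray.N)) :=
  rfl

lemma one_mem_ray : latPt (rayPt 1) ∈ ray.cone := by
  rw [ray_cone]
  exact PointedCone.subset_hull ⟨rayPt 1, by simp, rfl⟩

lemma latPt_rayPt (n : ℤ) : latPt (rayPt n) = (n : ℝ) • latPt (rayPt 1) := by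
  rw [← latPt_zsmul]
  congr 1
  change n = n • (1 : ℤ)
  simp

lemma latPt_mem_ray {n : ℤ} : latPt (rayPt n) ∈ ray.cone ↔ 0 ≤ n := by
  constructor
  · intro h
    rw [ray_cone] at h
    obtain ⟨c, hc, h⟩ := mem_hull_latPt.1 h
    rw [Finset.sum_singleton] at h
    let e : Module.Dual ℤ ray.N := (LinearMap.id : ℤ →ₗ[ℤ] ℤ)
    have he : ∀ m : ℤ, e (rayPt m) = m := fun _ => rfl
    have h2 := congrArg (evalR e) h
    simp only [map_smul, evalR_latPt, he, Int.cast_one, smul_eq_mul, mul_one] at h2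
    have := hc (rayPt 1)
    rw [← h2] at this
    exact_mod_cast this
  · intro h
    rw [latPt_rayPt]
    exact PointedCone.smul_mem _ (by exact_mod_cast h) one_mem_ray

lemma isRelInt_ray : IsRelInt ray.cone (latPt (rayPt 1)) := by
  obtain ⟨(n : ℤ), hn⟩ := IsLatticeGenerated.exists_isRelInt ray.rational.generated
  change IsRelInt ray.cone (latPt (rayPt n)) at hn
  have h0 := latPt_mem_ray.1 hn.1
  have h2 : ((n : ℝ) + 1) • latPt (rayPt 1) = latPt (rayPt n) + latPt (rayPt 1) := by
    rw [add_smul, one_smul, ← latPt_rayPt]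
  have h3 : IsRelInt ray.cone (((n : ℝ) + 1) • latPt (rayPt 1)) := by
    rw [h2]
    exact hn.add one_mem_ray
  have hp : (0 : ℝ) < (n : ℝ) + 1 := by
    have : (0 : ℝ) ≤ n := by exact_mod_cast h0
    linarith
  have h4 := h3.smul (inv_pos.2 hp)
  rwa [smul_smul, inv_mul_cancel₀ hp.ne', one_smul] at h4

/-- The homomorphism `ℤ → L` with `1 ↦ l`. -/
def rayLin (l : L) : ray.N →ₗ[ℤ] L := LinearMap.toSpanSingleton ℤ L l

@[simp] lemma rayLin_apply (l : L) (n : ℤ) : rayLin l (rayPt n) = n • l := rfl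

lemma rayLin_mem {C : PointedCone ℝ (RealExt L)} {l : L} (hl : latPt l ∈ C) (n : ray.N)
    (hn : latPt n ∈ ray.cone) : latPt (rayLin l n) ∈ C := by
  obtain ⟨m, rfl⟩ : ∃ m, rayPt m = n := ⟨n, rfl⟩
  have h0 := latPt_mem_ray.1 hn
  rw [rayLin_apply, latPt_zsmul]
  exact PointedCone.smul_mem _ (by exact_mod_cast h0) hl

lemma comp_rayLin (f : L →ₗ[ℤ] L') (l : L) : f.comp (rayLin l) = rayLin (f l) := by
  refine LinearMap.ext fun n => ?_
  obtain ⟨m, rfl⟩ : ∃ m, rayPt m = n := ⟨n, rfl⟩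
  rw [LinearMap.comp_apply, rayLin_apply, rayLin_apply, map_smul]

/-- The morphism from the ray to a lattice point of a cone. -/
def rayHom {τ : RPC} (n : τ.N) (hn : latPt n ∈ τ.cone) : ray ⟶ τ :=
  RPC.homMk (rayLin n) (rayLin_mem hn)

lemma rayHom_comp {τ υ : RPC} (n : τ.N) (hn : latPt n ∈ τ.cone) (g : τ ⟶ υ) :
    rayHom n hn ≫ g = rayHom (RPCHom.lin g n) (RPC.maps_latPt g hn) :=
  RPCHom.ext (comp_rayLin _ _)

lemma rayHom_injective {τ : RPC} {n n' : τ.N} {hn : latPt n ∈ τ.cone} {hn' : latPt n' ∈ τ.cone}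
    (h : rayHom n hn = rayHom n' hn') : n = n' := by
  have := LinearMap.congr_fun (congrArg RPCHom.lin h) (rayPt 1)
  change (1 : ℤ) • n = (1 : ℤ) • n' at this
  simpa using this

/-- The RPC of a cone with a lattice. -/
def latticeConeRPC [Module.Free ℤ L] [Module.Finite ℤ L]
    (p : PointedCone ℝ (RealExt L) × Submodule ℤ L) (hp : IsLatticeCone p) : RPC where
  N := p.2
  cone := p.1.comap (realMap p.2.subtype)
  rational := by
    classical
    have hinj : Function.Injective (realMap p.2.subtype) :=
      realMap_injective (Submodule.subtype_injective _)
    refine ⟨?_, ?_⟩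
    · obtain ⟨s, hs⟩ := hp.rational.generated
      have hsp : ∀ n ∈ s, latPt n ∈ p.1 := fun n hn => by
        rw [hs]; exact PointedCone.subset_hull ⟨n, hn, rfl⟩
      -- The generators of the cone need not lie in the sublattice, but suitable positive multiples
      -- do, and these generate the same cone.
      have hk : ∀ n : s, ∃ k : ℕ, 0 < k ∧ k • (n : L) ∈ p.2 :=
        fun n => hp.exists_nsmul n (hsp n n.2)
      choose k hk0 hk using hk
      refine ⟨Finset.univ.image fun n : s => (⟨k n • (n : L), hk n⟩ : p.2), ?_⟩
      apply le_antisymm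
      · intro x hx
        have hx' : realMap p.2.subtype x ∈ p.1 := hx
        have hle : p.1 ≤ (PointedCone.hull ℝ (latPt '' ((Finset.univ.image
            fun n : s => (⟨k n • (n : L), hk n⟩ : p.2) : Finset p.2) : Set p.2))).map
            (realMap p.2.subtype) := by
          conv_lhs => rw [hs]
          refine Submodule.span_le.2 ?_
          rintro _ ⟨n, hn, rfl⟩
          refine ⟨((k ⟨n, hn⟩ : ℝ)⁻¹) • latPt (⟨k ⟨n, hn⟩ • n, hk ⟨n, hn⟩⟩ : p.2), ?_, ?_⟩
          · exact PointedCone.smul_mem _ (by positivity) (PointedCone.subset_hull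
              ⟨_, by simp, rfl⟩)
          · change realMap p.2.subtype (((k ⟨n, hn⟩ : ℝ)⁻¹) •
              latPt (⟨k ⟨n, hn⟩ • n, hk ⟨n, hn⟩⟩ : p.2)) = latPt n
            rw [map_smul, realMap_latPt]
            have : (0 : ℝ) < k ⟨n, hn⟩ := by exact_mod_cast hk0 ⟨n, hn⟩
            change (k ⟨n, hn⟩ : ℝ)⁻¹ • latPt (k ⟨n, hn⟩ • n) = latPt n
            rw [latPt_nsmul, smul_smul, inv_mul_cancel₀ this.ne', one_smul]
        obtain ⟨y, hy, e⟩ := hle hx'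
        rwa [← hinj e]
      · refine Submodule.span_le.2 ?_
        rintro _ ⟨n, hn, rfl⟩
        obtain ⟨⟨m, hm⟩, -, rfl⟩ := Finset.mem_image.1 (Finset.mem_coe.1 hn)
        change realMap p.2.subtype _ ∈ p.1
        rw [realMap_latPt]
        change latPt (k ⟨m, hm⟩ • m) ∈ p.1
        rw [latPt_nsmul]
        exact PointedCone.smul_mem _ (Nat.cast_nonneg _) (hsp m hm)
    · intro x hx hx'
      apply hinj
      rw [map_zero]
      refine hp.rational.strictlyConvex _ hx ?_
      rw [← map_neg]
      exact hx'
  full := by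
    have hinj : Function.Injective (realMap p.2.subtype) :=
      realMap_injective (Submodule.subtype_injective _)
    have hmap : (p.1.comap (realMap p.2.subtype)).map (realMap p.2.subtype) = p.1 := by
      apply le_antisymm
      · rintro _ ⟨x, hx, rfl⟩
        exact hx
      · obtain ⟨s, hs⟩ := hp.rational.generated
        conv_lhs => rw [hs]
        refine Submodule.span_le.2 ?_
        rintro _ ⟨n, hn, rfl⟩
        have hnp : latPt n ∈ p.1 := by
          rw [hs]; exact PointedCone.subset_hull ⟨n, hn, rfl⟩
        obtain ⟨k, hk0, hk⟩ := hp.exists_nsmul n hnp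
        have hk0' : (0 : ℝ) < k := by exact_mod_cast hk0
        have e : realMap p.2.subtype ((k : ℝ)⁻¹ • latPt (⟨k • n, hk⟩ : p.2)) = latPt n := by
          rw [map_smul, realMap_latPt]
          change (k : ℝ)⁻¹ • latPt (k • n) = latPt n
          rw [latPt_nsmul, smul_smul, inv_mul_cancel₀ hk0'.ne', one_smul]
        exact ⟨_, by change realMap p.2.subtype _ ∈ p.1; rwa [e], e⟩
    rw [eq_top_iff, ← span_latPt, Submodule.span_le]
    rintro _ ⟨l, rfl⟩
    have h1 : latPt (l : L) ∈ coneSpan p.1 := hp.le_span l.2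
    rw [← hmap, coneSpan_map] at h1
    obtain ⟨y, hy, e⟩ := h1
    have : y = latPt l := hinj (by rw [e, realMap_latPt]; rfl)
    rwa [← this]

section

variable [Module.Free ℤ L] [Module.Finite ℤ L]
  {p : PointedCone ℝ (RealExt L) × Submodule ℤ L} (hp : IsLatticeCone p)

/-- The inclusion of the lattice of a cone. -/
def latticeConeIncl : (latticeConeRPC p hp).N →ₗ[ℤ] L := p.2.subtype

lemma latticeConeIncl_injective : Function.Injective (latticeConeIncl hp) :=
  Submodule.subtype_injective _

lemma latPt_mem_latticeCone {n : (latticeConeRPC p hp).N} :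
    latPt n ∈ (latticeConeRPC p hp).cone ↔ latPt (latticeConeIncl hp n) ∈ p.1 := by
  rw [← realMap_latPt]
  rfl

lemma factors_latticeConeIncl : Factors (latticeConeIncl hp) p :=
  ⟨fun _ hn => (latPt_mem_latticeCone hp).1 hn, fun n => n.2⟩

lemma map_latticeCone :
    (latticeConeRPC p hp).cone.map (realMap (latticeConeIncl hp)) = p.1 := by
  apply le_antisymm
  · rintro _ ⟨x, hx, rfl⟩
    exact hx
  · obtain ⟨s, hs⟩ := hp.rational.generated
    conv_lhs => rw [hs]
    refine Submodule.span_le.2 ?_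
    rintro _ ⟨n, hn, rfl⟩
    have hnp : latPt n ∈ p.1 := by
      rw [hs]; exact PointedCone.subset_hull ⟨n, hn, rfl⟩
    obtain ⟨k, hk0, hk⟩ := hp.exists_nsmul n hnp
    have hk0' : (0 : ℝ) < k := by exact_mod_cast hk0
    have e : realMap p.2.subtype ((k : ℝ)⁻¹ • latPt (⟨k • n, hk⟩ : p.2)) = latPt n := by
      rw [map_smul, realMap_latPt]
      change (k : ℝ)⁻¹ • latPt (k • n) = latPt n
      rw [latPt_nsmul, smul_smul, inv_mul_cancel₀ hk0'.ne', one_smul]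
    exact ⟨_, by change realMap p.2.subtype _ ∈ p.1; rwa [e], e⟩

end

end LatticeCones

/-! ### Fans of cones with lattices -/

section Fans

variable {L : Type} [AddCommGroup L]

/-- A fan of cones with lattices. -/
structure IsLatticeFan (Φ : Set (PointedCone ℝ (RealExt L) × Submodule ℤ L)) : Prop where
  isLatticeCone : ∀ p ∈ Φ, IsLatticeCone p
  face : ∀ p ∈ Φ, ∀ F : PointedCone ℝ (RealExt L), F.IsFaceOf p.1 → (F, p.2 ⊓ spanMod F) ∈ Φ
  uniq : ∀ p ∈ Φ, ∀ q ∈ Φ, ∀ l ∈ p.2, l ∈ q.2 → IsRelInt p.1 (latPt l) →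
    IsRelInt q.1 (latPt l) → p = q

variable {Φ : Set (PointedCone ℝ (RealExt L) × Submodule ℤ L)}

/-- The relatively interior lattice points of a cone need not lie in the smaller lattices. -/
lemma IsLatticeFan.uniq' (h : IsLatticeFan Φ) {p q : PointedCone ℝ (RealExt L) × Submodule ℤ L}
    (hp : p ∈ Φ) (hq : q ∈ Φ) {l : L} (h1 : IsRelInt p.1 (latPt l)) (h2 : IsRelInt q.1 (latPt l)) :
    p = q := by
  obtain ⟨k, hk, hk'⟩ := (h.isLatticeCone p hp).exists_nsmul l h1.1
  obtain ⟨j, hj, hj'⟩ := (h.isLatticeCone q hq).exists_nsmul l h2.1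
  have hpos : (0 : ℝ) < ((j * k : ℕ) : ℝ) := by exact_mod_cast Nat.mul_pos hj hk
  refine h.uniq p hp q hq ((j * k) • l) ?_ ?_ ?_ ?_
  · rw [mul_smul]
    exact p.2.smul_of_tower_mem j hk'
  · rw [mul_comm, mul_smul]
    exact q.2.smul_of_tower_mem k hj'
  · rw [latPt_nsmul]
    exact h1.smul hpos
  · rw [latPt_nsmul]
    exact h2.smul hpos

/-- In a fan the lattice is a function of the cone, which is the form in which a `StackyFan` records
it. -/
lemma IsLatticeFan.snd_eq (h : IsLatticeFan Φ) {p q : PointedCone ℝ (RealExt L) × Submodule ℤ L}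
    (hp : p ∈ Φ) (hq : q ∈ Φ) (e : p.1 = q.1) : p = q := by
  obtain ⟨n, hn⟩ := IsLatticeGenerated.exists_isRelInt (h.isLatticeCone p hp).rational.generated
  exact h.uniq' hp hq hn (e ▸ hn)

/-- A morphism that factors through the fan and meets the relative interior of a cone factors
through a unique cone whose relative interior it meets. -/
lemma IsLatticeFan.exists_factors_isRelInt (h : IsLatticeFan Φ) {ρ : RPC} {g : ρ.N →ₗ[ℤ] L}
    {p : PointedCone ℝ (RealExt L) × Submodule ℤ L} (hp : p ∈ Φ) (hg : Factors g p) {n : ρ.N}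
    (hn : IsRelInt ρ.cone (latPt n)) :
    ∃ q ∈ Φ, Factors g q ∧ IsRelInt q.1 (latPt (g n)) ∧ q.1.IsFaceOf p.1 ∧ q.2 ≤ p.2 := by
  have hx := hg.1 n hn.1
  have hF := minFace_isFaceOf hx
  have hC : ∀ x ∈ ρ.cone, realMap g x ∈ minFace p.1 _ hx := by
    intro x hxρ
    obtain ⟨t, ht, h'⟩ := hn.2 x hxρ
    refine hF.mem_of_smul_add_mem (realMap_mem_of_latPt hg.1 hxρ) (realMap_mem_of_latPt hg.1 h') ht ?_
    rw [← map_smul, ← map_add, add_sub_cancel, realMap_latPt]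
    exact (isRelInt_minFace hx).1
  refine ⟨_, h.face p hp _ hF, ⟨fun m hm => ?_, fun m => ⟨hg.2 m, ?_⟩⟩, isRelInt_minFace hx, hF,
    inf_le_left⟩
  · have := hC _ hm
    rw [realMap_latPt] at this
    exact this
  · change latPt (g m) ∈ coneSpan (minFace p.1 _ hx)
    have h1 : latPt m ∈ coneSpan ρ.cone := by rw [ρ.full]; trivial
    have h2 : coneSpan (ρ.cone.map (realMap g)) ≤ coneSpan (minFace p.1 _ hx) := by
      refine coneSpan_mono ?_
      rintro _ ⟨x, hxρ, rfl⟩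
      exact hC x hxρ
    apply h2
    rw [coneSpan_map, ← realMap_latPt]
    exact ⟨_, h1, rfl⟩

variable [Module.Free ℤ L] [Module.Finite ℤ L]

/-- Any two cones of a fan meet in a common face, on which their lattices agree. -/
lemma IsLatticeFan.inter (h : IsLatticeFan Φ) {p q : PointedCone ℝ (RealExt L) × Submodule ℤ L}
    (hp : p ∈ Φ) (hq : q ∈ Φ) : (p.1 ⊓ q.1).IsFaceOf p.1 ∧ (p.1 ⊓ q.1).IsFaceOf q.1 ∧
      p.2 ⊓ spanMod (p.1 ⊓ q.1) = q.2 ⊓ spanMod (p.1 ⊓ q.1) := by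
  have hrp := (h.isLatticeCone p hp).rational
  have hrq := (h.isLatticeCone q hq).rational
  -- The smallest faces of p.1 and of q.1 through an interior point n of the intersection both
  -- belong to the fan and have n in their interiors. So they agree, lattices included, and their
  -- common value is the intersection.
  obtain ⟨n, hn⟩ := IsLatticeGenerated.exists_isRelInt
    (IsLatticeGenerated.inf hrp.generated hrq.generated)
  have e := h.uniq' (h.face p hp _ (minFace_isFaceOf hn.1.1)) (h.face q hq _ (minFace_isFaceOf hn.1.2))
    (isRelInt_minFace hn.1.1) (isRelInt_minFace hn.1.2)
  have e1 : minFace p.1 _ hn.1.1 = minFace q.1 _ hn.1.2 := congrArg Prod.fst e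
  have e2 := congrArg Prod.snd e
  dsimp only at e2
  have key : p.1 ⊓ q.1 = minFace p.1 _ hn.1.1 := by
    apply le_antisymm
    · exact hn.le_of_mem_face inf_le_left (minFace_isFaceOf hn.1.1) (isRelInt_minFace hn.1.1).1
    · refine le_inf (minFace_isFaceOf hn.1.1).le ?_
      rw [e1]
      exact (minFace_isFaceOf hn.1.2).le
  rw [← e1, ← key] at e2
  refine ⟨?_, ?_, e2⟩
  · rw [key]
    exact minFace_isFaceOf _
  · rw [key, e1]
    exact minFace_isFaceOf _

end Fans

/-! ### Cone stacks over an RPC -/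

section Charts

variable {Φ : CombConeStack}

/-- A fully faithful functor over `RPC` from the realization of `Φ` to the RPCs over `τ`. -/
structure ConeChart (Φ : CombConeStack) (τ : RPC) where
  str : ∀ c : Φ.realization.obj, Φ.realization.p.obj c ⟶ τ
  map_str : ∀ {c c' : Φ.realization.obj} (f : c ⟶ c'), Φ.realization.p.map f ≫ str c' = str c
  full : ∀ {c c' : Φ.realization.obj} (a : Φ.realization.p.obj c ⟶ Φ.realization.p.obj c'),
    a ≫ str c' = str c → ∃ f : c ⟶ c', Φ.realization.p.map f = a
  faithful : ∀ {c c' : Φ.realization.obj} (f f' : c ⟶ c'),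
    Φ.realization.p.map f = Φ.realization.p.map f' → f = f'

/-- The quasi-inverse H of G commutes with the projections to `RPC` only up to an isomorphism θ, so
the structure maps of the chart are those of H followed by D, corrected by θ. -/
lemma exists_coneChart {Z : BasedCategory.{0, 1} RPC} {τ : RPC} (D : Z.obj ⥤ Over τ) [D.Full]
    [D.Faithful] (hD : D ⋙ Over.forget τ = Z.p) (G : Z ⥤ᵇ Φ.realization)
    [G.toFunctor.IsEquivalence] :
    ∃ K : ConeChart Φ τ, ∀ {ρ : RPC} (g : ρ ⟶ τ), D.essImage (Over.mk g) ↔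
      ∃ (c : Φ.realization.obj) (e : ρ ≅ Φ.realization.p.obj c), e.hom ≫ K.str c = g := by
  let H : Φ.realization.obj ⥤ Z.obj := G.toFunctor.inv
  have hw : G.toFunctor ⋙ Φ.realization.p = Z.p := G.w
  let θ : Φ.realization.p ≅ (H ⋙ D) ⋙ Over.forget τ :=
    (Functor.leftUnitor _).symm ≪≫
    Functor.isoWhiskerRight G.toFunctor.asEquivalence.counitIso.symm Φ.realization.p ≪≫
    (Functor.associator _ _ _) ≪≫ Functor.isoWhiskerLeft H (eqToIso (hw.trans hD.symm)) ≪≫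
    (Functor.associator _ _ _).symm
  let θc (c) : Φ.realization.p.obj c ≅ (D.obj (H.obj c)).left := θ.app c
  have hθ : ∀ {c c' : Φ.realization.obj} (f : c ⟶ c'),
      Φ.realization.p.map f ≫ (θc c').hom = (θc c).hom ≫ (D.map (H.map f)).left :=
    fun f => θ.hom.naturality f
  refine ⟨⟨fun c => (θc c).hom ≫ (D.obj (H.obj c)).hom, ?_, ?_, ?_⟩, ?_⟩
  · intro c c' f
    rw [← Category.assoc, hθ, Category.assoc, Over.w]
  · intro c c' a ha
    let b : D.obj (H.obj c) ⟶ D.obj (H.obj c') :=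
      Over.homMk ((θc c).inv ≫ a ≫ (θc c').hom) (by
        rw [Category.assoc, Category.assoc, ha, Iso.inv_hom_id_assoc])
    obtain ⟨f', hf'⟩ := D.map_surjective b
    obtain ⟨f, rfl⟩ := H.map_surjective f'
    refine ⟨f, ?_⟩
    have h1 := hθ f
    rw [hf'] at h1
    change _ = (θc c).hom ≫ (θc c).inv ≫ a ≫ (θc c').hom at h1
    rw [Iso.hom_inv_id_assoc] at h1
    exact (cancel_mono (θc c').hom).1 h1
  · intro c c' f f' h
    apply H.map_injective
    apply D.map_injective
    ext1
    rw [← cancel_epi (θc c).hom, ← hθ, ← hθ, h]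
  · intro ρ g
    constructor
    · rintro ⟨z, ⟨i⟩⟩
      let u : D.obj z ≅ D.obj (H.obj (G.toFunctor.obj z)) :=
        D.mapIso (G.toFunctor.asEquivalence.unitIso.app z)
      refine ⟨G.toFunctor.obj z, (Over.forget τ).mapIso (i.symm ≪≫ u) ≪≫ (θc _).symm, ?_⟩
      change ((i.symm ≪≫ u).hom.left ≫ (θc _).inv) ≫ (θc _).hom ≫ _ = g
      rw [Category.assoc, Iso.inv_hom_id_assoc]
      exact Over.w (i.symm ≪≫ u).hom
    · rintro ⟨c, e, he⟩
      refine ⟨H.obj c, ⟨(Over.isoMk (e ≪≫ θc c) ?_).symm⟩⟩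
      change (e.hom ≫ (θc c).hom) ≫ (D.obj (H.obj c)).hom = g
      rw [Category.assoc]
      exact he

/-- The object of the realization given by a morphism to a cone not factoring through a face. -/
def CombConeStack.realObj {ρ : RPC} (ξ : Φ.obj) (g : ρ ⟶ Φ.toRPC.obj ξ)
    (hg : ∀ F : PointedCone ℝ (RealExt (Φ.toRPC.obj ξ).N), F.IsFaceOf (Φ.toRPC.obj ξ).cone →
      (∀ x ∈ ρ.cone, realMap (RPCHom.lin g) x ∈ F) → F = (Φ.toRPC.obj ξ).cone) :
    Φ.realization.obj :=
  ⟨Comma.mk (L := 𝟭 RPC) (R := Φ.toRPC) ρ ξ g, hg⟩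

/-- A cone of `Φ` as an object of the realization. -/
def CombConeStack.coneObj (ξ : Φ.obj) : Φ.realization.obj :=
  CombConeStack.realObj ξ (𝟙 _) fun F hF h => le_antisymm hF.le fun x hx => by
    have := h x hx
    rwa [RPC.id_lin, realMap_id] at this

/-- A relatively interior lattice point of a cone of `Φ` as an object of the realization. -/
def CombConeStack.ptObj (ξ : Φ.obj) (n : (Φ.toRPC.obj ξ).N)
    (hn : IsRelInt (Φ.toRPC.obj ξ).cone (latPt n)) : Φ.realization.obj :=
  CombConeStack.realObj ξ (rayHom n hn.1) fun F hF h => hn.face_eq hF (by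
    have := h _ one_mem_ray
    rw [realMap_latPt] at this
    change latPt (rayLin n (rayPt 1)) ∈ F at this
    rwa [rayLin_apply, one_smul] at this)

/-- The morphism of cones underlying a morphism of the realization. -/
def CombConeStack.coneHom {c c' : Φ.realization.obj} (f : c ⟶ c') :
    c.obj.right ⟶ c'.obj.right := CommaMorphism.right f.hom

lemma CombConeStack.realization_w {c c' : Φ.realization.obj} (f : c ⟶ c') :
    Φ.realization.p.map f ≫ c'.obj.hom = c.obj.hom ≫ Φ.toRPC.map (coneHom f) :=
  CommaMorphism.w f.hom

/-- The morphism of the realization given by a commutative square. -/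
def CombConeStack.homMk {c c' : Φ.realization.obj} (a : c.obj.left ⟶ c'.obj.left)
    (φ : c.obj.right ⟶ c'.obj.right) (h : a ≫ c'.obj.hom = c.obj.hom ≫ Φ.toRPC.map φ) : c ⟶ c' :=
  ObjectProperty.homMk
    (show c.obj ⟶ c'.obj from CommaMorphism.mk (L := 𝟭 RPC) (R := Φ.toRPC) a φ h)

lemma CombConeStack.faceMor_map {ξ ξ' : Φ.obj} (φ : ξ ⟶ ξ') : faceMor (Φ.toRPC.map φ) :=
  InducedWideCategory.Hom.property (Φ.p.map φ)

/-- Every face of a cone of `Φ` is a cone of `Φ`. -/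
lemma CombConeStack.exists_face (ξ : Φ.obj) (F : PointedCone ℝ (RealExt (Φ.toRPC.obj ξ).N))
    (hF : F.IsFaceOf (Φ.toRPC.obj ξ).cone) : ∃ (ξ' : Φ.obj) (φ : ξ' ⟶ ξ),
      (Φ.toRPC.obj ξ').cone.map (realMap (RPCHom.lin (Φ.toRPC.map φ))) = F := by
  have hL := isLatticeCone_spanMod ((Φ.toRPC.obj ξ).rational.face hF)
  let ρ := latticeConeRPC _ hL
  let i : ρ ⟶ Φ.toRPC.obj ξ := RPC.homMk (latticeConeIncl hL) fun n hn =>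
    hF.le ((latPt_mem_latticeCone hL).1 hn)
  have hmap : ρ.cone.map (realMap (RPCHom.lin i)) = F := map_latticeCone hL
  have hi : faceMor i := by
    refine ⟨latticeConeIncl_injective hL, by rwa [hmap], fun n hn => ?_⟩
    rw [hmap] at hn
    exact ⟨⟨n, hn⟩, rfl⟩
  have key : ∀ (R : RPCFace) (f : R ⟶ Φ.p.obj ξ),
      R.obj.cone.map (realMap (RPCHom.lin f.hom)) = F → ∃ (ξ' : Φ.obj) (φ : ξ' ⟶ ξ),
      (Φ.toRPC.obj ξ').cone.map (realMap (RPCHom.lin (Φ.toRPC.map φ))) = F := by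
    intro R f hf
    obtain ⟨ξ', φ, h⟩ := Φ.fibered.lift ξ f
    obtain rfl := IsHomLift.domain_eq Φ.p f φ
    have h2 : Φ.p.map φ = f := by
      have := IsHomLift.fac' Φ.p f φ
      simpa using this
    refine ⟨ξ', φ, ?_⟩
    rw [← hf, ← h2]
    rfl
  exact key ⟨ρ⟩ ⟨i, hi⟩ hmap

namespace ConeChart

open CombConeStack

variable {τ : RPC} (K : ConeChart Φ τ)

/-- The morphism from a cone of `Φ` to `τ`. -/
def cone (ξ : Φ.obj) : Φ.toRPC.obj ξ ⟶ τ := K.str (coneObj ξ)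

/-- An object (ρ, ξ, g) maps to (ξ, ξ, 𝟙) by g, so the chart is determined by its values on cones.
-/
lemma str_eq (c : Φ.realization.obj) : K.str c = c.obj.hom ≫ K.cone c.obj.right :=
  (K.map_str (homMk (c := c) (c' := coneObj c.obj.right) c.obj.hom (𝟙 _)
    (congrArg (fun u => c.obj.hom ≫ u) (Φ.toRPC.map_id c.obj.right)).symm)).symm

lemma map_cone {ξ ξ' : Φ.obj} (φ : ξ ⟶ ξ') : Φ.toRPC.map φ ≫ K.cone ξ' = K.cone ξ :=
  K.map_str (homMk (c := coneObj ξ) (c' := coneObj ξ') (Φ.toRPC.map φ) φ (by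
    change Φ.toRPC.map φ ≫ 𝟙 _ = 𝟙 _ ≫ Φ.toRPC.map φ
    rw [Category.comp_id, Category.id_comp]))

/-- Interior points of cones with the same image in `τ` are related by a morphism. -/
lemma exists_hom {ξ ξ' : Φ.obj} {n : (Φ.toRPC.obj ξ).N} {n' : (Φ.toRPC.obj ξ').N}
    (hn : IsRelInt (Φ.toRPC.obj ξ).cone (latPt n)) (hn' : IsRelInt (Φ.toRPC.obj ξ').cone (latPt n'))
    (h : RPCHom.lin (K.cone ξ) n = RPCHom.lin (K.cone ξ') n') :
    ∃ φ : ξ ⟶ ξ', RPCHom.lin (Φ.toRPC.map φ) n = n' ∧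
      ∃ f : ptObj ξ n hn ⟶ ptObj ξ' n' hn', Φ.realization.p.map f = 𝟙 ray ∧ coneHom f = φ := by
  have h1 : 𝟙 ray ≫ K.str (ptObj ξ' n' hn') = K.str (ptObj ξ n hn) := by
    refine (Category.id_comp (X := ray) (Y := τ) _).trans
      ((K.str_eq (ptObj ξ' n' hn')).trans (Eq.trans ?_ (K.str_eq (ptObj ξ n hn)).symm))
    change rayHom n' hn'.1 ≫ K.cone ξ' = rayHom n hn.1 ≫ K.cone ξ
    rw [rayHom_comp, rayHom_comp]
    congr 1
    exact h.symm
  -- Both points are objects over the ray with the same structure map to τ, so the identity of the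
  -- ray lifts.
  obtain ⟨f, hf⟩ := K.full (c := ptObj ξ n hn) (c' := ptObj ξ' n' hn') (𝟙 ray) h1
  refine ⟨coneHom f, ?_, f, hf, rfl⟩
  have h2 := realization_w f
  rw [hf] at h2
  change 𝟙 ray ≫ rayHom n' hn'.1 = rayHom n hn.1 ≫ Φ.toRPC.map (coneHom f) at h2
  rw [Category.id_comp, rayHom_comp] at h2
  exact (rayHom_injective h2).symm

/-- An endomorphism of a cone that fixes an interior point is the identity. -/
lemma eq_id_of_fixed (K : ConeChart Φ τ) {ξ : Φ.obj} {n : (Φ.toRPC.obj ξ).N}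
    (hn : IsRelInt (Φ.toRPC.obj ξ).cone (latPt n)) (φ : ξ ⟶ ξ)
    (h : RPCHom.lin (Φ.toRPC.map φ) n = n) : φ = 𝟙 ξ := by
  let f : ptObj ξ n hn ⟶ ptObj ξ n hn := homMk (𝟙 ray) φ (by
    change 𝟙 ray ≫ rayHom n hn.1 = rayHom n hn.1 ≫ Φ.toRPC.map φ
    rw [Category.id_comp, rayHom_comp]
    congr 1
    exact h.symm)
  have h1 : f = 𝟙 _ := K.faithful _ _ (by
    exact (Φ.realization.p.map_id (ptObj ξ n hn)).symm)
  exact congrArg coneHom h1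

/-- If a and b have the same image, adding a large multiple of an interior point makes both
interior. They are then exchanged by an automorphism φ of ξ, invertible by faithfulness. Since the
automorphism group is finite, the sum of the translates of a point under it is an interior point
fixed by φ, hence φ = 𝟙 and a = b. -/
lemma cone_injective (hfin : ∀ a b : Φ.obj, Finite (a ⟶ b)) (ξ : Φ.obj) :
    Function.Injective (RPCHom.lin (K.cone ξ)) := by
  intro a b hab
  obtain ⟨n, hn⟩ := IsLatticeGenerated.exists_isRelInt (Φ.toRPC.obj ξ).rational.generated
  have hfull : ∀ x : (Φ.toRPC.obj ξ).N, latPt x ∈ coneSpan (Φ.toRPC.obj ξ).cone := fun x => by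
    rw [(Φ.toRPC.obj ξ).full]; trivial
  obtain ⟨k, hk, hka⟩ := hn.exists_nat_smul_add (hfull a)
  obtain ⟨k', hk', hkb⟩ := hn.exists_nat_smul_add (hfull b)
  rw [← latPt_nsmul, ← latPt_add] at hka hkb
  have mem : ∀ j : ℕ, latPt (j • n) ∈ (Φ.toRPC.obj ξ).cone := fun j => by
    rw [latPt_nsmul]; exact PointedCone.smul_mem _ (Nat.cast_nonneg j) hn.1
  have hpa : IsRelInt (Φ.toRPC.obj ξ).cone (latPt ((k + k') • n + a)) := by
    have := hka.add (mem k')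
    rw [← latPt_add] at this
    convert this using 2
    rw [add_smul]; abel
  have hpb : IsRelInt (Φ.toRPC.obj ξ).cone (latPt ((k + k') • n + b)) := by
    have := hkb.add (mem k)
    rw [← latPt_add] at this
    convert this using 2
    rw [add_smul]; abel
  have hpab : RPCHom.lin (K.cone ξ) ((k + k') • n + a) =
      RPCHom.lin (K.cone ξ) ((k + k') • n + b) := by rw [map_add, map_add, hab]
  obtain ⟨φ, hφ, f, hf, hfφ⟩ := K.exists_hom hpa hpb hpab
  obtain ⟨ψ, hψ, g, hg, hgψ⟩ := K.exists_hom hpb hpa hpab.symm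
  have e1 : f ≫ g = 𝟙 _ := K.faithful _ _ (by
    rw [CategoryTheory.Functor.map_comp, hf, hg, CategoryTheory.Functor.map_id]
    exact Category.comp_id _)
  have e2 : g ≫ f = 𝟙 _ := K.faithful _ _ (by
    rw [CategoryTheory.Functor.map_comp, hf, hg, CategoryTheory.Functor.map_id]
    exact Category.comp_id _)
  let α : Aut ξ := ⟨φ, ψ, by rw [← hfφ, ← hgψ]; exact congrArg coneHom e1,
    by rw [← hfφ, ← hgψ]; exact congrArg coneHom e2⟩
  have : Finite (Aut ξ) := Finite.of_injective (fun β : Aut ξ => (β.hom : ξ ⟶ ξ))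
    fun β γ h => Iso.ext h
  have := Fintype.ofFinite (Aut ξ)
  set m := (k + k') • n + a with hm
  let u : Aut ξ → (Φ.toRPC.obj ξ).N := fun β => RPCHom.lin (Φ.toRPC.map β.hom) m
  have hu1 : u 1 = m := by
    change RPCHom.lin (Φ.toRPC.map (𝟙 ξ)) m = m
    rw [CategoryTheory.Functor.map_id]
    rfl
  have humul : ∀ β, RPCHom.lin (Φ.toRPC.map φ) (u β) = u (α * β) := by
    intro β
    change RPCHom.lin (Φ.toRPC.map φ) (RPCHom.lin (Φ.toRPC.map β.hom) m) =
      RPCHom.lin (Φ.toRPC.map (β.hom ≫ φ)) m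
    rw [CategoryTheory.Functor.map_comp]
    rfl
  have humem : ∀ β, latPt (u β) ∈ (Φ.toRPC.obj ξ).cone :=
    fun β => RPC.maps_latPt (Φ.toRPC.map β.hom) hpa.1
  clear_value u
  have hr : IsRelInt (Φ.toRPC.obj ξ).cone (latPt (∑ β, u β)) := by
    classical
    rw [← Finset.add_sum_erase Finset.univ u (Finset.mem_univ (1 : Aut ξ)), hu1, latPt_add]
    refine hpa.add ?_
    rw [latPt_sum]
    exact Submodule.sum_mem _ fun β _ => humem β
  have hfix : RPCHom.lin (Φ.toRPC.map φ) (∑ β, u β) = ∑ β, u β := by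
    rw [map_sum]
    exact Fintype.sum_equiv (Equiv.mulLeft α) _ _ humul
  have hid := K.eq_id_of_fixed hr φ hfix
  rw [hid, CategoryTheory.Functor.map_id] at hφ
  exact add_left_cancel hφ

variable {L : Type} [AddCommGroup L] (h : τ.N →ₗ[ℤ] L)

/-- The image of a cone of `Φ` in a lattice. -/
def image (ξ : Φ.obj) : PointedCone ℝ (RealExt L) × Submodule ℤ L :=
  ((Φ.toRPC.obj ξ).cone.map (realMap (h.comp (RPCHom.lin (K.cone ξ)))),
    LinearMap.range (h.comp (RPCHom.lin (K.cone ξ))))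

lemma image_le {ξ ξ' : Φ.obj} (φ : ξ ⟶ ξ') :
    (K.image h ξ).1 ≤ (K.image h ξ').1 ∧ (K.image h ξ).2 ≤ (K.image h ξ').2 := by
  have e : h.comp (RPCHom.lin (K.cone ξ)) =
      (h.comp (RPCHom.lin (K.cone ξ'))).comp (RPCHom.lin (Φ.toRPC.map φ)) := by
    rw [← K.map_cone φ]
    rfl
  constructor
  · change PointedCone.map _ _ ≤ PointedCone.map _ _
    rw [e]
    rintro _ ⟨x, hx, rfl⟩
    exact ⟨_, RPCHom.maps (Φ.toRPC.map φ) x hx, (realMap_comp _ _ x).symm⟩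
  · change LinearMap.range _ ≤ LinearMap.range _
    rw [e]
    rintro _ ⟨n, rfl⟩
    exact ⟨_, rfl⟩

variable {h}

/-- Faces are present because Φ is fibered over face morphisms. Two cones whose images share an
interior lattice point of both lattices have morphisms in both directions by `exists_hom`, so their
images coincide. -/
lemma isLatticeFan_image [Module.Finite ℤ L] (hh : Function.Injective h) (hfin : ∀ a b : Φ.obj, Finite (a ⟶ b)) :
    IsLatticeFan (Set.range (K.image h)) := by
  have hinj : ∀ ξ, Function.Injective (h.comp (RPCHom.lin (K.cone ξ))) :=
    fun ξ => hh.comp (K.cone_injective hfin ξ)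
  refine ⟨?_, ?_, ?_⟩
  · rintro _ ⟨ξ, rfl⟩
    have hsp : Submodule.span ℝ (latPt '' ((K.image h ξ).2 : Set L)) =
        coneSpan (K.image h ξ).1 := by
      change _ = coneSpan (PointedCone.map _ _)
      rw [coneSpan_map, (Φ.toRPC.obj ξ).full, ← span_latPt, Submodule.map_span]
      congr 1
      ext x
      constructor
      · rintro ⟨_, ⟨n, rfl⟩, rfl⟩
        exact ⟨_, ⟨n, rfl⟩, realMap_latPt _ _⟩
      · rintro ⟨_, ⟨n, rfl⟩, rfl⟩
        exact ⟨_, ⟨n, rfl⟩, (realMap_latPt _ _).symm⟩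
    refine ⟨(Φ.toRPC.obj ξ).rational.map (hinj ξ), fun l hl => ?_, fun l hl => ?_⟩
    · rw [mem_spanMod, ← hsp]
      exact Submodule.subset_span ⟨l, hl, rfl⟩
    · apply exists_nsmul_mem_of_latPt_mem_span
      rw [hsp]
      exact mem_coneSpan hl
  · rintro _ ⟨ξ, rfl⟩ F hF
    have hrinj := realMap_injective (hinj ξ)
    let F₀ : PointedCone ℝ (RealExt (Φ.toRPC.obj ξ).N) :=
      F.comap (realMap (h.comp (RPCHom.lin (K.cone ξ))))
    have hF₀ : F₀.map (realMap (h.comp (RPCHom.lin (K.cone ξ)))) = F := by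
      apply le_antisymm
      · rintro _ ⟨x, hx, rfl⟩
        exact hx
      · intro x hx
        obtain ⟨y, hy, rfl⟩ := hF.le hx
        exact ⟨y, hx, rfl⟩
    have hface : F₀.IsFaceOf (Φ.toRPC.obj ξ).cone := by
      refine PointedCone.IsFaceOf.of_map_injective hrinj ?_
      rw [hF₀]
      exact hF
    obtain ⟨ξ', φ, hφ⟩ := exists_face ξ F₀ hface
    obtain ⟨hφ1, hφ2, hφ3⟩ := faceMor_map φ
    have e : h.comp (RPCHom.lin (K.cone ξ')) =
        (h.comp (RPCHom.lin (K.cone ξ))).comp (RPCHom.lin (Φ.toRPC.map φ)) := by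
      rw [← K.map_cone φ]
      rfl
    refine ⟨ξ', Prod.ext ?_ ?_⟩
    · change PointedCone.map _ _ = F
      rw [e, ← hF₀, ← hφ, PointedCone.map_map]
      congr 1
      exact LinearMap.ext fun x => realMap_comp _ _ x
    · change LinearMap.range _ = LinearMap.range _ ⊓ spanMod F
      ext l
      constructor
      · intro hl
        refine ⟨?_, ?_⟩
        · rw [e] at hl
          obtain ⟨n, rfl⟩ := hl
          exact ⟨_, rfl⟩
        · obtain ⟨n, rfl⟩ := hl
          rw [e]
          change latPt _ ∈ coneSpan F
          rw [← hF₀, ← hφ, coneSpan_map, coneSpan_map, LinearMap.comp_apply, ← realMap_latPt,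
            ← realMap_latPt]
          exact ⟨_, ⟨_, by rw [(Φ.toRPC.obj ξ').full]; trivial, rfl⟩, rfl⟩
      · rintro ⟨⟨n, rfl⟩, hn⟩
        replace hn : latPt ((h.comp (RPCHom.lin (K.cone ξ))) n) ∈ coneSpan F := hn
        rw [← hF₀, ← hφ, coneSpan_map, ← realMap_latPt] at hn
        obtain ⟨y, hy, hy'⟩ := hn
        obtain rfl := hrinj hy'
        obtain ⟨n', rfl⟩ := hφ3 n hy
        rw [e]
        exact ⟨n', rfl⟩
  · rintro _ ⟨ξ, rfl⟩ _ ⟨ξ', rfl⟩ l ⟨n, rfl⟩ ⟨n', hn'⟩ h1 h2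
    rw [← realMap_latPt] at h1
    rw [← hn', ← realMap_latPt] at h2
    have h1 := isRelInt_of_map (realMap_injective (hinj ξ)) h1
    have h2 := isRelInt_of_map (realMap_injective (hinj ξ')) h2
    have hnn : RPCHom.lin (K.cone ξ) n = RPCHom.lin (K.cone ξ') n' := (hh hn').symm
    obtain ⟨φ, -⟩ := K.exists_hom h1 h2 hnn
    obtain ⟨ψ, -⟩ := K.exists_hom h2 h1 hnn.symm
    exact Prod.ext (le_antisymm (K.image_le h φ).1 (K.image_le h ψ).1)
      (le_antisymm (K.image_le h φ).2 (K.image_le h ψ).2)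

lemma finite_range_image (hfin : Finite (Quotient (isIsomorphicSetoid Φ.obj))) :
    (Set.range (K.image h)).Finite := by
  let f : Quotient (isIsomorphicSetoid Φ.obj) → PointedCone ℝ (RealExt L) × Submodule ℤ L :=
    Quotient.lift (K.image h) (by
      rintro ξ ξ' ⟨i⟩
      exact Prod.ext (le_antisymm (K.image_le h i.hom).1 (K.image_le h i.inv).1)
        (le_antisymm (K.image_le h i.hom).2 (K.image_le h i.inv).2))
  refine (Set.finite_range f).subset ?_
  rintro _ ⟨ξ, rfl⟩
  exact ⟨Quotient.mk _ ξ, rfl⟩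

/-- A morphism factors through a cone of the image fan exactly when it factors through `Φ`. -/
lemma factors_image_iff (hh : Function.Injective h) (hfin : ∀ a b : Φ.obj, Finite (a ⟶ b))
    {ρ : RPC} (g : ρ ⟶ τ) (ξ : Φ.obj) :
    Factors (h.comp (RPCHom.lin g)) (K.image h ξ) ↔
      ∃ g' : ρ ⟶ Φ.toRPC.obj ξ, g' ≫ K.cone ξ = g := by
  have hinj : Function.Injective (h.comp (RPCHom.lin (K.cone ξ))) :=
    hh.comp (K.cone_injective hfin ξ)
  constructor
  · rintro ⟨h1, h2⟩
    let e := LinearEquiv.ofInjective _ hinj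
    let g' : ρ.N →ₗ[ℤ] (Φ.toRPC.obj ξ).N :=
      e.symm.toLinearMap.comp ((h.comp (RPCHom.lin g)).codRestrict _ h2)
    have hg' : ∀ n, (h.comp (RPCHom.lin (K.cone ξ))) (g' n) = h (RPCHom.lin g n) := by
      intro n
      have : e (g' n) = (h.comp (RPCHom.lin g)).codRestrict _ h2 n := e.apply_symm_apply _
      exact congrArg Subtype.val this
    refine ⟨RPC.homMk g' fun n hn => ?_, RPC.hom_ext fun n => hh (hg' n)⟩
    obtain ⟨y, hy, hy'⟩ := h1 n hn
    have h3 : realMap (h.comp (RPCHom.lin (K.cone ξ))) (latPt (g' n)) =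
        latPt ((h.comp (RPCHom.lin g)) n) := by
      rw [realMap_latPt, hg']
      rfl
    rwa [← realMap_injective hinj (hy'.trans h3.symm)]
  · rintro ⟨g', rfl⟩
    refine ⟨fun n hn => ⟨_, RPC.maps_latPt g' hn, ?_⟩, fun n => ⟨_, rfl⟩⟩
    exact realMap_latPt _ _

end ConeChart

end Charts

/-! ### Morphisms to the stack of a presheaf -/

section Image

variable {P : RPCᵒᵖ ⥤ Type}

/-- The fibers of `PshPt P` are discrete, so the source of a lift is determined on the nose. The
`eqToHom` absorbs the fact that a based functor preserves base objects only up to propositional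
equality. -/
lemma PshPt.eq_of_isHomLift {a b c : PshPt P} (f : a ⟶ c) {R : RPC} (e : c.base = R) (φ : b ⟶ c)
    [h : (PshPt.proj P).IsHomLift (PshPt.Hom.base f ≫ eqToHom e) φ] : b = a := by
  subst e
  rw [eqToHom_refl, Category.comp_id] at h
  obtain ⟨B, x⟩ := b
  obtain rfl : B = a.base := IsHomLift.domain_eq (PshPt.proj P) (PshPt.Hom.base f) φ
  have h1 : PshPt.Hom.base φ = 𝟙 _ ≫ PshPt.Hom.base f ≫ 𝟙 _ :=
    IsHomLift.fac' (PshPt.proj P) (PshPt.Hom.base f) φ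
  rw [Category.comp_id, Category.id_comp] at h1
  have h2 : x = a.pt := by
    rw [← PshPt.Hom.map_pt f, ← h1]
    exact (PshPt.Hom.map_pt φ).symm
  rw [h2]

lemma PshPt.eq_of_isHomLift_id {a b : PshPt P} (R : RPC) (φ : b ⟶ a)
    [h : (PshPt.proj P).IsHomLift (𝟙 R) φ] : b = a := by
  have e : a.base = R := IsHomLift.codomain_eq (PshPt.proj P) (𝟙 R) φ
  subst e
  have : (PshPt.proj P).IsHomLift (PshPt.Hom.base (𝟙 a) ≫ eqToHom rfl) φ := by
    change (PshPt.proj P).IsHomLift (𝟙 _ ≫ 𝟙 _) φ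
    rwa [Category.id_comp]
  exact PshPt.eq_of_isHomLift (𝟙 a) rfl φ

/-- The pullback of a point. -/
def PshPt.pullHom (x : PshPt P) {ρ : RPC} (g : ρ ⟶ x.base) :
    (⟨ρ, P.map g.op x.pt⟩ : PshPt P) ⟶ x := ⟨g, rfl⟩

variable {Y : RPCStack} (F : Y.toBasedCategory ⥤ᵇ (stackOf P).toBasedCategory)

/-- Lifting f to Y and applying F returns a itself, not merely an isomorphic object; this makes the
set of values of F stable under restriction. -/
lemma exists_obj_eq (y : Y.obj) {a : PshPt P} (f : a ⟶ F.obj y) : ∃ y', F.obj y' = a := by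
  have e : (F.obj y : PshPt P).base = Y.p.obj y := Functor.congr_obj F.w y
  obtain ⟨y', φ, h⟩ := Y.fibered.lift y (PshPt.Hom.base f ≫ eqToHom e)
  have h2 : (PshPt.proj P).IsHomLift (PshPt.Hom.base f ≫ eqToHom e) (F.map φ) :=
    (inferInstance : (stackOf P).p.IsHomLift (PshPt.Hom.base f ≫ eqToHom e) (F.map φ))
  exact ⟨y', PshPt.eq_of_isHomLift (b := F.obj y') (c := F.obj y) f e (F.map φ)⟩

/-- The image of a morphism of stacks to the stack of a presheaf. -/
def imageSub : Subfunctor P where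
  obj τ := {x | ∃ y, F.obj y = (⟨τ.unop, x⟩ : PshPt P)}
  map {τ ρ} g x := by
    rintro ⟨y, hy⟩
    refine exists_obj_eq F y (a := ⟨ρ.unop, P.map g x⟩) ?_
    rw [hy]
    exact PshPt.pullHom (⟨τ.unop, x⟩ : PshPt P) g.unop

lemma mem_imageSub_of_hom (y : Y.obj) {a : PshPt P} (f : a ⟶ F.obj y) :
    a.pt ∈ (imageSub F).obj (op a.base) := exists_obj_eq F y f

/-- Over a fixed point x, a morphism of base cones compatible with the maps to the base of x
respects points automatically. -/
lemma full_post (x : (stackOf P).obj) : (Over.post (X := x) (stackOf P).p).Full where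
  map_surjective {a b} f := by
    have hw : f.left ≫ PshPt.Hom.base (P := P) (b := x) b.hom =
      PshPt.Hom.base (P := P) (b := x) a.hom := Over.w f
    let u : PshPt.Hom (P := P) a.left b.left := ⟨f.left, by
      rw [← PshPt.Hom.map_pt (P := P) (b := x) a.hom, ← PshPt.Hom.map_pt (P := P) (b := x) b.hom,
        ← hw]
      exact (P.map_comp_apply (PshPt.Hom.base (P := P) (b := x) b.hom).op f.left.op
        (PshPt.pt x)).symm⟩
    exact ⟨Over.homMk u (PshPt.Hom.ext hw), rfl⟩

lemma faithful_post (x : (stackOf P).obj) : (Over.post (X := x) (stackOf P).p).Faithful where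
  map_injective {a b} f g h := by
    ext1
    exact PshPt.Hom.ext (congrArg CommaMorphism.left h)

lemma full_baseChangeProj (hF : IsMono F) (x : (stackOf P).obj) : (baseChangeProj F x).Full := by
  have := hF.1
  have := full_post x
  exact (inferInstance : (CostructuredArrow.toOver F.toFunctor x ⋙
    Over.post (X := x) (stackOf P).p).Full)

lemma faithful_baseChangeProj (hF : IsMono F) (x : (stackOf P).obj) :
    (baseChangeProj F x).Faithful := by
  have := hF.2
  have := faithful_post x
  exact (inferInstance : (CostructuredArrow.toOver F.toFunctor x ⋙
    Over.post (X := x) (stackOf P).p).Faithful)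

lemma baseChangeProj_forget (x : (stackOf P).obj) :
    baseChangeProj F x ⋙ Over.forget _ = (baseChange F x).p := by
  change CostructuredArrow.proj F.toFunctor x ⋙ (F.toFunctor ⋙ (stackOf P).p) =
    CostructuredArrow.proj F.toFunctor x ⋙ Y.p
  rw [F.w]

/-- The dictionary between base changes and subpresheaves: for a morphism F(y) → x lying over g, the
point of F(y) is the restriction of x along g. -/
lemma essImage_baseChangeProj (x : (stackOf P).obj) {ρ : RPC} (g : ρ ⟶ (stackOf P).p.obj x) :
    (baseChangeProj F x).essImage (Over.mk g) ↔
      P.map g.op (PshPt.pt x) ∈ (imageSub F).obj (op ρ) := by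
  constructor
  · rintro ⟨c, ⟨i⟩⟩
    have hw : i.inv.left ≫ PshPt.Hom.base (P := P) (b := x) c.hom = g := Over.w i.inv
    refine mem_imageSub_of_hom F c.left (a := ⟨ρ, P.map g.op (PshPt.pt x)⟩) ⟨i.inv.left, ?_⟩
    rw [← PshPt.Hom.map_pt (P := P) (b := x) c.hom]
    refine (P.map_comp_apply (PshPt.Hom.base (P := P) (b := x) c.hom).op i.inv.left.op
      (PshPt.pt x)).symm.trans ?_
    exact congrArg (fun u : ρ ⟶ (stackOf P).p.obj x => P.map u.op (PshPt.pt x)) hw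
  · rintro ⟨y, hy⟩
    let φ : (show (stackOf P).obj from ⟨ρ, P.map g.op (PshPt.pt x)⟩) ⟶ x := PshPt.pullHom x g
    refine ⟨CostructuredArrow.mk (Y := y) (S := F.toFunctor) (T := x) (eqToHom hy ≫ φ), ⟨?_⟩⟩
    have key : ∀ (b : (stackOf P).obj) (e : b = (show (stackOf P).obj from
        ⟨ρ, P.map g.op (PshPt.pt x)⟩)),
        Nonempty ((Over.post (stackOf P).p).obj (Over.mk (eqToHom e ≫ φ)) ≅
          Over.mk g) := by
      rintro _ rfl
      rw [eqToHom_refl, Category.id_comp]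
      exact ⟨Iso.refl _⟩
    exact (key _ hy).some

/-- The fan of a monomorphism whose base change is a finite cone stack. -/
lemma exists_isLatticeFan {L : Type} [AddCommGroup L] [Module.Finite ℤ L] (hF : IsMono F)
    (x : (stackOf P).obj) (hx : IsFiniteConeStack (baseChange F x))
    {h : ((stackOf P).p.obj x).N →ₗ[ℤ] L}
    (hh : Function.Injective h) :
    ∃ Φ : Set (PointedCone ℝ (RealExt L) × Submodule ℤ L), Φ.Finite ∧ IsLatticeFan Φ ∧
      (∀ p ∈ Φ, p.1 ≤ ((stackOf P).p.obj x).cone.map (realMap h)) ∧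
      ∀ {ρ : RPC} (g : ρ ⟶ (stackOf P).p.obj x),
        P.map g.op (PshPt.pt x) ∈ (imageSub F).obj (op ρ) ↔
        ∃ p ∈ Φ, Factors (h.comp (RPCHom.lin g)) p := by
  obtain ⟨Φ, ⟨hΦ1, hΦ2⟩, G, hG⟩ := hx
  have := full_baseChangeProj F hF x
  have := faithful_baseChangeProj F hF x
  obtain ⟨K, hK⟩ := exists_coneChart (baseChangeProj F x) (baseChangeProj_forget F x) G
  replace hK : ∀ {ρ : RPC} (g : ρ ⟶ (stackOf P).p.obj x),
      P.map g.op (PshPt.pt x) ∈ (imageSub F).obj (op ρ) ↔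
      ∃ (c : Φ.realization.obj) (e : ρ ≅ Φ.realization.p.obj c), e.hom ≫ K.str c = g :=
    fun g => (essImage_baseChangeProj F x g).symm.trans (hK g)
  refine ⟨Set.range (K.image h), K.finite_range_image hΦ1, K.isLatticeFan_image hh hΦ2, ?_, ?_⟩
  · rintro _ ⟨ξ, rfl⟩ _ ⟨y, hy, rfl⟩
    exact ⟨_, RPCHom.maps (K.cone ξ) y hy, (realMap_comp _ _ y).symm⟩
  · intro ρ g
    constructor
    · intro hg
      obtain ⟨c, e, rfl⟩ := (hK g).1 hg
      refine ⟨_, ⟨c.obj.right, rfl⟩, (K.factors_image_iff hh hΦ2 _ _).2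
        ⟨e.hom ≫ c.obj.hom, ?_⟩⟩
      rw [K.str_eq]
      exact Category.assoc _ _ _
    · rintro ⟨_, ⟨ξ, rfl⟩, hg⟩
      obtain ⟨g', rfl⟩ := (K.factors_image_iff hh hΦ2 g ξ).1 hg
      have h1 := (hK (K.cone ξ)).2
        ⟨CombConeStack.coneObj ξ, Iso.refl _, Category.id_comp _⟩
      have h2 := (imageSub F).map g'.op h1
      have h3 := P.map_comp_apply (K.cone ξ).op g'.op (PshPt.pt x)
      exact h3 ▸ h2

/-- Components of a based isomorphism lie over identities, and the fibers of `PshPt P` are discrete.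
-/
lemma map_obj_eq_of_iso {F' : Y.toBasedCategory ⥤ᵇ (stackOf P).toBasedCategory} (i : F ≅ F')
    (y : Y.obj) : F.obj y = F'.obj y := by
  have h : (PshPt.proj P).IsHomLift (𝟙 (Y.p.obj y)) (i.hom.toNatTrans.app y) :=
    i.hom.isHomLift rfl
  exact PshPt.eq_of_isHomLift_id (b := F.obj y) (a := F'.obj y) (Y.p.obj y) (i.hom.toNatTrans.app y)

variable {F}

/-- A morphism of stacks whose objects lie in the image of a monomorphism lifts to it. -/
lemma exists_lift (hF : IsMono F) {Z : RPCStack}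
    (H : Z.toBasedCategory ⥤ᵇ (stackOf P).toBasedCategory) (h : ∀ z, ∃ y, F.obj y = H.obj z) :
    ∃ G : Z.toBasedCategory ⥤ᵇ Y.toBasedCategory, G.comp F = H := by
  have := hF.1
  have := hF.2
  choose o ho using h
  let G : Z.obj ⥤ Y.obj :=
    { obj := o
      map := fun {a b} f => F.toFunctor.preimage (eqToHom (ho a) ≫ H.map f ≫ eqToHom (ho b).symm)
      map_id := fun a => F.toFunctor.map_injective (by
        rw [F.toFunctor.map_preimage, CategoryTheory.Functor.map_id, CategoryTheory.Functor.map_id]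
        simp)
      map_comp := fun f g => F.toFunctor.map_injective (by
        rw [F.toFunctor.map_preimage, F.toFunctor.map_comp, F.toFunctor.map_preimage,
          F.toFunctor.map_preimage, CategoryTheory.Functor.map_comp]
        simp) }
  have hGF : G ⋙ F.toFunctor = H.toFunctor :=
    CategoryTheory.Functor.ext ho fun a b f => F.toFunctor.map_preimage _
  have hw : G ⋙ Y.p = Z.p := by
    rw [← H.w, ← hGF, ← F.w]
    rfl
  refine ⟨⟨G, hw⟩, ?_⟩
  have key : ∀ (A B : Z.toBasedCategory ⥤ᵇ (stackOf P).toBasedCategory),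
      A.toFunctor = B.toFunctor → A = B := by
    rintro ⟨A, _⟩ ⟨B, _⟩ rfl
    rfl
  exact key _ _ hGF

/-- Together with `IsoOver.imageSub_eq`, this classifies monomorphisms to `stackOf P` by
subpresheaves of P. The lift of F through F' inherits full faithfulness from both and is essentially
surjective because the images agree. -/
lemma isoOver_of_imageSub_eq (hF : IsMono F) {Y' : RPCStack}
    {F' : Y'.toBasedCategory ⥤ᵇ (stackOf P).toBasedCategory} (hF' : IsMono F')
    (h : imageSub F = imageSub F') : IsoOver F F' := by
  have key : ∀ a : PshPt P, (∃ y, F.obj y = a) ↔ ∃ y, F'.obj y = a := by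
    intro a
    have := congrArg (fun S : Subfunctor P => a.pt ∈ S.obj (op a.base)) h
    exact iff_of_eq this
  obtain ⟨G, hG⟩ := exists_lift hF' F fun y => (key _).1 ⟨y, rfl⟩
  have := hF.1
  have := hF.2
  have := hF'.1
  have := hF'.2
  have hGF : G.toFunctor ⋙ F'.toFunctor = F.toFunctor := congrArg BasedFunctor.toFunctor hG
  have h1 : (G.toFunctor ⋙ F'.toFunctor).Full := by rw [hGF]; infer_instance
  have h2 : (G.toFunctor ⋙ F'.toFunctor).Faithful := by rw [hGF]; infer_instance
  have h3 : G.toFunctor.Full := Functor.Full.of_comp_faithful _ F'.toFunctor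
  have h4 : G.toFunctor.Faithful := Functor.Faithful.of_comp _ F'.toFunctor
  have h5 : G.toFunctor.EssSurj := ⟨fun y' => by
    obtain ⟨y, hy⟩ := (key _).2 ⟨y', rfl⟩
    exact ⟨y, ⟨F'.toFunctor.preimageIso (eqToIso ((Functor.congr_obj hGF y).trans hy))⟩⟩⟩
  exact ⟨G, {}, ⟨eqToIso hG⟩⟩

lemma IsoOver.imageSub_eq {Y' : RPCStack}
    {F' : Y'.toBasedCategory ⥤ᵇ (stackOf P).toBasedCategory} (h : IsoOver F F') :
    imageSub F = imageSub F' := by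
  obtain ⟨G, hG, ⟨i⟩⟩ := h
  have h1 : ∀ y, F'.obj (G.obj y) = F.obj y := map_obj_eq_of_iso (G.comp F') i
  refine le_antisymm (fun τ x => ?_) (fun τ x => ?_)
  · rintro ⟨y, hy⟩
    exact ⟨G.obj y, (h1 y).trans hy⟩
  · rintro ⟨y', hy'⟩
    have e := (G.toFunctor.objObjPreimageIso y').inv
    refine exists_obj_eq F (G.toFunctor.objPreimage y') (a := ⟨τ.unop, x⟩) ?_
    rw [← h1, ← hy']
    exact F'.map e

end Image

/-! ### Stacks of subpresheaves, and rays under subdivision -/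

section Subfunctors

variable {P : RPCᵒᵖ ⥤ Type}

lemma isMono_stackMap {P' : RPCᵒᵖ ⥤ Type} (η : P' ⟶ P)
    (hη : ∀ τ, Function.Injective (η.app τ)) : IsMono (stackMap η) := by
  refine ⟨⟨fun {a b} f => ?_⟩, ⟨fun {a b} f g h => ?_⟩⟩
  · let f' : PshPt.Hom (⟨PshPt.base a, η.app _ (PshPt.pt a)⟩ : PshPt P)
      ⟨PshPt.base b, η.app _ (PshPt.pt b)⟩ := f
    refine ⟨(⟨f'.base, hη _ ?_⟩ : PshPt.Hom (P := P') a b), rfl⟩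
    exact (NatTrans.naturality_apply η f'.base.op (PshPt.pt b)).trans f'.map_pt
  · exact PshPt.Hom.ext (congrArg (PshPt.Hom.base (P := P)) h)

lemma mem_imageSub_stackMap {P' : RPCᵒᵖ ⥤ Type} (η : P' ⟶ P) {τ : RPC} {x : P.obj (op τ)} :
    x ∈ (imageSub (stackMap η)).obj (op τ) ↔ ∃ y, η.app (op τ) y = x := by
  constructor
  · rintro ⟨⟨τ', y⟩, hy⟩
    obtain rfl : τ' = τ := congrArg PshPt.base hy
    refine ⟨y, ?_⟩
    have : (⟨τ', η.app (op τ') y⟩ : PshPt P) = ⟨τ', x⟩ := hy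
    simpa using this
  · rintro ⟨y, rfl⟩
    exact ⟨⟨τ, y⟩, rfl⟩

lemma imageSub_subfunctor (S : Subfunctor P) : imageSub (stackMap S.ι) = S := by
  ext τ x
  refine (mem_imageSub_stackMap S.ι (τ := τ.unop)).trans ?_
  constructor
  · rintro ⟨y, rfl⟩
    exact y.2
  · intro hx
    exact ⟨⟨x, hx⟩, rfl⟩

lemma isMono_subfunctor (S : Subfunctor P) : IsMono (stackMap S.ι) :=
  isMono_stackMap _ fun _ _ _ h => Subtype.ext h

/-- An object of a subdivided stack over a ray lifts to the subdivision. -/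
lemma mem_imageSub_of_ray {Y Y' : RPCStack} {F : Y.toBasedCategory ⥤ᵇ (stackOf P).toBasedCategory}
    {s : Y'.toBasedCategory ⥤ᵇ Y.toBasedCategory} (hs : IsSubdivision s) {x : P.obj (op ray)}
    (hx : x ∈ (imageSub F).obj (op ray)) : x ∈ (imageSub (s.comp F)).obj (op ray) := by
  obtain ⟨y, hy⟩ := hx
  have hr : Y.p.obj y = ray := by
    rw [← F.w_obj y, hy]
    rfl
  -- The cone of the subdivision that contains the generator 1 contains the whole ray, so the
  -- identity of the ray factors through it. The RPC is a variable here because the base of y equals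
  -- `ray` only propositionally.
  have key : ∀ (τ : RPC), τ = ray → ∀ {Z : Type 1} [Category.{0} Z] (K : Z ⥤ Over τ),
      IsConeSubdivision K → K.essImage (Over.mk (𝟙 τ)) := by
    rintro _ rfl Z _ K ⟨Δ, -, -, h⟩
    obtain ⟨δ, hδ, h1⟩ := (Δ.support _).1 one_mem_ray
    refine (h _).2 ⟨δ, hδ, fun z hz => ?_⟩
    change realMap LinearMap.id z ∈ δ
    refine realMap_mem_of_latPt (fun n hn => ?_) hz
    obtain ⟨m, rfl⟩ : ∃ m, rayPt m = n := ⟨n, rfl⟩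
    rw [LinearMap.id_apply, latPt_rayPt]
    exact δ.smul_mem (by exact_mod_cast latPt_mem_ray.1 hn) h1
  obtain ⟨c, ⟨i⟩⟩ := key _ hr _ (hs y)
  have hc : i.inv.left ≫ Y.p.map c.hom = 𝟙 _ := Over.w i.inv
  have hiso : IsIso (Y.p.map c.hom) := by
    have h5 : i.hom.left ≫ 𝟙 _ = Y.p.map c.hom := Over.w i.hom
    refine ⟨i.inv.left, ?_, hc⟩
    rw [← h5, Category.comp_id]
    exact congrArg CommaMorphism.left i.hom_inv_id
  have h2 : IsIso ((stackOf P).p.map (F.map c.hom)) := by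
    have := Functor.congr_hom F.w c.hom
    change (stackOf P).p.map (F.map c.hom) = _ at this
    rw [this]
    infer_instance
  let φ : (F.obj (s.obj c.left) : PshPt P) ⟶ F.obj y := F.map c.hom
  have h2 : IsIso (PshPt.Hom.base φ) := h2
  have ψ : (F.obj y : PshPt P) ⟶ F.obj (s.obj c.left) := ⟨inv (PshPt.Hom.base φ), by
    rw [← PshPt.Hom.map_pt φ]
    have e : (PshPt.Hom.base φ).op ≫ (inv (PshPt.Hom.base φ)).op = 𝟙 _ := by
      rw [← op_comp, IsIso.inv_hom_id]
      rfl
    have := P.map_comp_apply (PshPt.Hom.base φ).op (inv (PshPt.Hom.base φ)).op (F.obj y : PshPt P).pt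
    rw [e, P.map_id] at this
    exact this.symm⟩
  refine exists_obj_eq (s.comp F) c.left (a := ⟨ray, x⟩) ?_
  rw [← hy]
  exact ψ

end Subfunctors

/-! ### Positive semidefinite integral forms -/

section Forms

variable {M : Type} [AddCommGroup M]

lemma apply_eq_zero_of_apply_self {B : M →ₗ[ℤ] M →ₗ[ℤ] ℤ} (hs : ∀ x y, B x y = B y x)
    (hB : ∀ x, 0 ≤ B x x) {x : M} (hx : B x x = 0) (y : M) : B x y = 0 := by
  by_contra h
  -- The value here is B(y,y) − 2 (B(y,y) + 1) B(x,y)², which is negative as soon as B(x,y) is a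
  -- nonzero integer.
  have h1 := hB (y + (-(B y y + 1) * B x y) • x)
  simp only [map_add, map_smul, LinearMap.add_apply, LinearMap.smul_apply, smul_eq_mul, hx,
    hs y x] at h1
  have h2 : 1 ≤ B x y * B x y := by
    have := mul_self_pos.2 h
    omega
  nlinarith [hB y]

/-- Diagonalization of a positive semidefinite form over the integers, up to a multiple. -/
lemma exists_diagonalization [Module.Free ℤ M] [Module.Finite ℤ M] (B : M →ₗ[ℤ] M →ₗ[ℤ] ℤ)
    (hs : ∀ x y, B x y = B y x) (hB : ∀ x, 0 ≤ B x x) :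
    ∃ (s : Finset M) (c : M → ℤ) (D : ℤ), 0 < D ∧ (∀ e ∈ s, 0 < c e) ∧
      ∀ x y, B (D • x - ∑ e ∈ s, (c e * B e x) • e) y = 0 := by
  classical
  -- Gram–Schmidt without denominators, for a maximal orthogonal set s of vectors of positive norm,
  -- whose size is bounded by the rank. With D the product of all norms and c e the product of the
  -- norms other than that of e, D x − Σ c(e) B(e,x) e is orthogonal to s. By maximality it is
  -- isotropic, hence in the radical.
  let IsOrth : Finset M → Prop := fun s =>
    (∀ e ∈ s, 0 < B e e) ∧ ∀ e ∈ s, ∀ f ∈ s, e ≠ f → B e f = 0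
  have hcard : ∀ s, IsOrth s → s.card ≤ Module.finrank ℤ M := by
    rintro s ⟨h1, h2⟩
    have hli : LinearIndependent ℤ (fun e : s => (e : M)) := by
      rw [Fintype.linearIndependent_iff]
      intro g hg f
      have h3 := congrArg (B f) hg
      rw [map_sum, map_zero, Finset.sum_eq_single f] at h3
      · rw [map_smul, smul_eq_mul] at h3
        exact (mul_eq_zero.1 h3).resolve_right (h1 f f.2).ne'
      · intro e _ hef
        rw [map_smul, h2 f f.2 e e.2 (fun h => hef (Subtype.ext h.symm)), smul_zero]
      · exact fun h => absurd (Finset.mem_univ f) h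
    simpa using hli.fintype_card_le_finrank
  obtain ⟨s, hso, hmax⟩ : ∃ s, IsOrth s ∧ ∀ t, IsOrth t → t.card ≤ s.card := by
    let p : ℕ → Prop := fun n => ∃ s, IsOrth s ∧ s.card = n
    have h0 : p 0 := ⟨∅, ⟨by simp, by simp⟩, rfl⟩
    obtain ⟨s, hs1, hs2⟩ := Nat.findGreatest_spec (P := p) (Nat.zero_le (Module.finrank ℤ M)) h0
    refine ⟨s, hs1, fun t ht => ?_⟩
    rw [hs2]
    exact Nat.le_findGreatest (hcard t ht) ⟨t, ht, rfl⟩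
  obtain ⟨h1, h2⟩ := hso
  let D := ∏ e ∈ s, B e e
  let c : M → ℤ := fun e => ∏ f ∈ s.erase e, B f f
  have hcD : ∀ e ∈ s, c e * B e e = D := fun e he => by
    rw [mul_comm]; exact Finset.mul_prod_erase s (fun f => B f f) he
  have hD : 0 < D := Finset.prod_pos h1
  refine ⟨s, c, D, hD, fun e he => Finset.prod_pos fun f hf => h1 f (Finset.mem_of_mem_erase hf),
    fun x y => ?_⟩
  set x' := D • x - ∑ e ∈ s, (c e * B e x) • e with hx'
  refine apply_eq_zero_of_apply_self hs hB ?_ y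
  have horth : ∀ f ∈ s, B f x' = 0 := by
    intro f hf
    rw [hx', map_sub, map_smul, map_sum, Finset.sum_eq_single f]
    · rw [map_smul, smul_eq_mul, smul_eq_mul, ← hcD f hf]
      ring
    · intro e he hef
      rw [map_smul, h2 f hf e he hef.symm, smul_zero]
    · exact fun h => absurd hf h
  by_contra hne
  have hpos : 0 < B x' x' := lt_of_le_of_ne (hB x') (Ne.symm hne)
  have hmem : x' ∉ s := fun h => hne (horth x' h)
  have := hmax (insert x' s) ⟨by
    intro e he
    rcases Finset.mem_insert.1 he with rfl | he
    · exact hpos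
    · exact h1 e he, by
    intro e he f hf hef
    rcases Finset.mem_insert.1 he with he | he <;> rcases Finset.mem_insert.1 hf with hf | hf
    · exact absurd (he.trans hf.symm) hef
    · rw [he, hs]; exact horth f hf
    · rw [hf]; exact horth e he
    · exact h2 e he f hf hef⟩
  rw [Finset.card_insert_of_notMem hmem] at this
  omega

/-- A functional vanishing on the isotropic vectors is rationally represented by the form. -/
lemma exists_smul_eq_of_isotropic [Module.Free ℤ M] [Module.Finite ℤ M]
    (B : M →ₗ[ℤ] M →ₗ[ℤ] ℤ) (hs : ∀ x y, B x y = B y x) (hB : ∀ x, 0 ≤ B x x)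
    (l : Module.Dual ℤ M) (hl : ∀ x, B x x = 0 → l x = 0) :
    ∃ k : ℕ, 0 < k ∧ ∃ m : M, ∀ x, k • l x = B m x := by
  obtain ⟨s, c, D, hD, -, h⟩ := exists_diagonalization B hs hB
  refine ⟨D.toNat, by omega, ∑ e ∈ s, (c e * l e) • e, fun x => ?_⟩
  -- Evaluating l on the isotropic vector gives D l(x) = Σ c(e) B(e,x) l(e), which is B(m, x) for
  -- the chosen m.
  have h1 := hl _ (h x _)
  rw [map_sub, map_smul, map_sum, sub_eq_zero, smul_eq_mul] at h1
  rw [nsmul_eq_mul, Int.natCast_toNat_eq_self.2 hD.le, h1, map_sum, LinearMap.sum_apply]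
  refine Finset.sum_congr rfl fun e _ => ?_
  rw [map_smul, map_smul, LinearMap.smul_apply, smul_eq_mul, smul_eq_mul]
  ring

end Forms

/-! ### Points of a tropical semiabelian variety -/

section Points

variable {σ : RPC} {M : Type} [AddCommGroup M] {Q : M →ₗ[ℤ] M →ₗ[ℤ] Module.Dual ℤ σ.N}
  {M' : Type} [AddCommGroup M']

lemma IsPosDef.nonneg (hQ : IsPosDef Q) (m : M) {n : σ.N} (hn : latPt n ∈ σ.cone) :
    0 ≤ Q m m n := by
  by_cases hm : m = 0
  · simp [hm]
  · simpa using (hQ m hm).1 n hn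

variable (Q) in
/-- The value of the form at a point. -/
def formAt (n : σ.N) : M →ₗ[ℤ] M →ₗ[ℤ] ℤ :=
  LinearMap.mk₂ ℤ (fun m m' => Q m m' n) (by simp) (by simp) (by simp) (by simp)

@[simp] lemma formAt_apply (n : σ.N) (m m' : M) : formAt Q n m m' = Q m m' n := rfl

@[simp] lemma QhomN_apply (m : M) (n : σ.N) (m' : M) : QhomN Q m n m' = Q m m' n := rfl

@[simp] lemma translate_fst (m : M) (l : BigLat σ M M') : (translate Q M' m l).1 = l.1 := rfl

@[simp] lemma translate_snd_fst (m : M) (l : BigLat σ M M') :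
    (translate Q M' m l).2.1 = l.2.1 + QhomN Q m l.1 := rfl

@[simp] lemma translate_snd_snd (m : M) (l : BigLat σ M M') : (translate Q M' m l).2.2 = l.2.2 := rfl

lemma bigLat_ext {l l' : BigLat σ M M'} (h1 : l.1 = l'.1) (h2 : ∀ m, l.2.1 m = l'.2.1 m)
    (h3 : l.2.2 = l'.2.2) : l = l' :=
  Prod.ext h1 (Prod.ext (LinearMap.ext h2) h3)

lemma translate_zero : translate Q M' (0 : M) = LinearMap.id :=
  LinearMap.ext fun l => bigLat_ext rfl (fun m => by simp) rfl

lemma translate_translate (m m' : M) (l : BigLat σ M M') :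
    translate Q M' m (translate Q M' m' l) = translate Q M' (m + m') l :=
  bigLat_ext rfl (fun x => by simp; ring) rfl

lemma translate_comp (m m' : M) :
    (translate Q M' m).comp (translate Q M' m') = translate Q M' (m + m') :=
  LinearMap.ext fun l => translate_translate m m' l

lemma translate_neg_translate (m : M) (l : BigLat σ M M') :
    translate Q M' (-m) (translate Q M' m l) = l := by
  rw [translate_translate, neg_add_cancel, translate_zero]
  rfl

lemma translate_translate_neg (m : M) (l : BigLat σ M M') :
    translate Q M' m (translate Q M' (-m) l) = l := by
  rw [translate_translate, add_neg_cancel, translate_zero]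
  rfl

lemma translate_mem_admissible (m : M) {l : BigLat σ M M'} (hl : l ∈ admissible Q M') :
    translate Q M' m l ∈ admissible Q M' := by
  obtain ⟨h, k, hk, m₀, hm₀⟩ := hl
  refine ⟨h, k, hk, m₀ + k • m, LinearMap.ext fun x => ?_⟩
  have := LinearMap.congr_fun hm₀ x
  simp only [LinearMap.smul_apply, QhomN_apply] at this
  rw [nsmul_eq_mul] at this
  simp [← this]

variable (Q) in
/-- Linear maps sending the lattice points of `τ` to admissible points. -/
def IsLift {τ : RPC} (h : τ.N →ₗ[ℤ] BigLat σ M M') : Prop :=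
  ∀ n, latPt n ∈ τ.cone → h n ∈ admissible Q M'

lemma IsLift.comp {ρ τ : RPC} {h : τ.N →ₗ[ℤ] BigLat σ M M'} (hh : IsLift Q h) (g : ρ ⟶ τ) :
    IsLift Q (h.comp (RPCHom.lin g)) := fun _ hn => hh _ (RPC.maps_latPt g hn)

lemma IsLift.translate {τ : RPC} {h : τ.N →ₗ[ℤ] BigLat σ M M'} (hh : IsLift Q h) (m : M) :
    IsLift Q ((translate Q M' m).comp h) := fun _ hn => translate_mem_admissible m (hh _ hn)

/-- The morphism to `σ` underlying a lift. -/
def liftStr {τ : RPC} (h : τ.N →ₗ[ℤ] BigLat σ M M') (hh : IsLift Q h) : τ ⟶ σ :=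
  RPC.homMk ((LinearMap.fst ℤ _ _).comp h) fun n hn => (hh n hn).1

lemma nonneg_of_generators {N : Type} [AddCommGroup N] {s : Finset N} {l : Module.Dual ℤ N}
    (h : ∀ v ∈ s, 0 ≤ l v) {n : N} (hn : latPt n ∈ PointedCone.hull ℝ (latPt '' (s : Set N))) :
    0 ≤ l n := by
  have : PointedCone.hull ℝ (latPt '' (s : Set N)) ≤ halfSpace l := by
    refine Submodule.span_le.2 ?_
    rintro _ ⟨v, hv, rfl⟩
    change 0 ≤ evalR l (latPt v)
    rw [evalR_latPt]
    exact_mod_cast h v hv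
  have h2 : 0 ≤ evalR l (latPt n) := this hn
  rw [evalR_latPt] at h2
  exact_mod_cast h2

/-- An isotropic m lies in the radical of the form at n, so k n'(m) = Q(m₀, m)(n) = 0. -/
lemma apply_eq_zero_of_admissible (hs : ∀ m m' : M, Q m m' = Q m' m) (hQ : IsPosDef Q)
    {l : BigLat σ M M'} (hl : l ∈ admissible Q M') {m : M} (hm : Q m m l.1 = 0) : l.2.1 m = 0 := by
  obtain ⟨h, k, hk, m₀, hm₀⟩ := hl
  have h1 := LinearMap.congr_fun hm₀ m
  have h2 := apply_eq_zero_of_apply_self (B := formAt Q l.1) (fun x y => by simp [hs x y])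
    (fun x => hQ.nonneg x h) (x := m) hm m₀
  rw [formAt_apply, hs] at h2
  rw [LinearMap.smul_apply, QhomN_apply, h2] at h1
  exact (smul_eq_zero.1 h1).resolve_left hk.ne'

/-- A lift as a point of the universal cover. -/
def liftHom (hs : ∀ m m' : M, Q m m' = Q m' m) (hQ : IsPosDef Q) {τ : RPC}
    (h : τ.N →ₗ[ℤ] BigLat σ M M') (hh : IsLift Q h) : BoundedHom Q τ where
  str := liftStr h hh
  hom := (((LinearMap.fst ℤ _ _).comp (LinearMap.snd ℤ _ _)).comp h).flip
  bounded m := by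
    obtain ⟨s, hgen⟩ := τ.rational.generated
    -- At a generator v either Q(m,m) vanishes, and then so does n'(m), or Q(m,m) is at least 1. So
    -- c Q(m,m) dominates |n'(m)| on all of τ, and ∓c • m serve as bounds.
    let c : ℤ := ∑ v ∈ s, |(h v).2.1 m|
    have hv : ∀ v ∈ s, |(h v).2.1 m| ≤ c * Q m m (h v).1 := by
      intro v hv
      have hvc : latPt v ∈ τ.cone := by
        rw [hgen]; exact PointedCone.subset_hull ⟨v, hv, rfl⟩
      have h1 := hQ.nonneg m (hh v hvc).1
      rcases h1.eq_or_lt with h1 | h1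
      · rw [apply_eq_zero_of_admissible hs hQ (hh v hvc) h1.symm, ← h1]
        simp
      · have h2 : |(h v).2.1 m| ≤ c :=
          Finset.single_le_sum (f := fun v => |(h v).2.1 m|) (fun _ _ => abs_nonneg _) hv
        have : 0 ≤ c := (abs_nonneg _).trans h2
        nlinarith
    refine ⟨(-c) • m, c • m, fun n hn => ?_, fun n hn => ?_⟩
    · rw [hgen] at hn
      refine nonneg_of_generators (fun v hv' => ?_) hn
      have h1 := hv v hv'
      have h2 := neg_abs_le ((h v).2.1 m)
      simp only [pullForm, map_smul, LinearMap.smul_apply, LinearMap.sub_apply,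
        LinearMap.comp_apply, smul_eq_mul]
      change 0 ≤ (h v).2.1 m - -c * Q m m (h v).1
      linarith
    · rw [hgen] at hn
      refine nonneg_of_generators (fun v hv' => ?_) hn
      have h1 := hv v hv'
      have h2 := le_abs_self ((h v).2.1 m)
      simp only [pullForm, map_smul, LinearMap.smul_apply, LinearMap.sub_apply,
        LinearMap.comp_apply, smul_eq_mul]
      change 0 ≤ c * Q m m (h v).1 - (h v).2.1 m
      linarith

/-- The lift of a point of the universal cover as a linear map. -/
def liftLin {τ : RPC} (a : BoundedHom Q τ) (ψ : τ.N →ₗ[ℤ] Module.Dual ℤ M') :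
    τ.N →ₗ[ℤ] BigLat σ M M' :=
  (RPCHom.lin a.str).prod (a.hom.flip.prod ψ)

/-- Converse to `liftHom`: at an isotropic x both bounds vanish and squeeze φ(x) to 0, and a
functional killing the isotropic vectors is rationally represented by the form. -/
lemma isLift_liftLin [Module.Free ℤ M] [Module.Finite ℤ M] (hs : ∀ m m' : M, Q m m' = Q m' m)
    (hQ : IsPosDef Q) {τ : RPC} (a : BoundedHom Q τ) (ψ : τ.N →ₗ[ℤ] Module.Dual ℤ M') :
    IsLift Q (liftLin a ψ) := by
  intro n hn
  have hσ := RPC.maps_latPt a.str hn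
  refine ⟨hσ, ?_⟩
  obtain ⟨k, hk, m, hm⟩ := exists_smul_eq_of_isotropic (formAt Q (RPCHom.lin a.str n))
    (fun x y => by simp [hs x y]) (fun x => hQ.nonneg x hσ) (a.hom.flip n) (fun x hx => by
      obtain ⟨m₁, m₂, h1, h2⟩ := a.bounded x
      have e : ∀ m₀, Q m₀ x (RPCHom.lin a.str n) = 0 := fun m₀ => by
        rw [hs]
        exact apply_eq_zero_of_apply_self (B := formAt Q (RPCHom.lin a.str n))
          (fun x y => by simp [hs x y]) (fun x => hQ.nonneg x hσ) hx m₀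
      have h1 := h1 n hn
      have h2 := h2 n hn
      simp only [pullForm, LinearMap.sub_apply, LinearMap.comp_apply] at h1 h2
      rw [e] at h1 h2
      rw [LinearMap.flip_apply]
      omega)
  exact ⟨k, hk, m, LinearMap.ext hm⟩

/-- The point given by a lift. -/
def liftPoint (hs : ∀ m m' : M, Q m m' = Q m' m) (hQ : IsPosDef Q) {τ : RPC}
    (h : τ.N →ₗ[ℤ] BigLat σ M M') (hh : IsLift Q h) : (tropSemiabelian Q M').obj (op τ) :=
  (Quotient.mk (BoundedHom.setoid Q τ) (liftHom hs hQ h hh),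
    ((LinearMap.snd ℤ _ _).comp (LinearMap.snd ℤ _ _)).comp h)

lemma exists_liftPoint [Module.Free ℤ M] [Module.Finite ℤ M] (hs : ∀ m m' : M, Q m m' = Q m' m)
    (hQ : IsPosDef Q) {τ : RPC} (x : (tropSemiabelian Q M').obj (op τ)) :
    ∃ (h : τ.N →ₗ[ℤ] BigLat σ M M') (hh : IsLift Q h), liftPoint hs hQ h hh = x := by
  obtain ⟨x, ψ⟩ := x
  induction x using Quotient.inductionOn with
  | h a => exact ⟨liftLin a ψ, isLift_liftLin hs hQ a ψ, rfl⟩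

/-- With `exists_liftPoint`, this presents X as the quotient of the presheaf of lifts by the
translations; from here on points of X are handled as linear maps to L. -/
lemma liftPoint_eq_iff (hs : ∀ m m' : M, Q m m' = Q m' m) (hQ : IsPosDef Q) {τ : RPC}
    {h h' : τ.N →ₗ[ℤ] BigLat σ M M'} (hh : IsLift Q h) (hh' : IsLift Q h') :
    liftPoint hs hQ h hh = liftPoint hs hQ h' hh' ↔ ∃ m, h' = (translate Q M' m).comp h := by
  constructor
  · intro e
    have e1 := congrArg Prod.fst e
    have e2 := congrArg Prod.snd e
    obtain ⟨h1, m, hm⟩ := Quotient.exact (s := BoundedHom.setoid Q τ) e1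
    refine ⟨m, LinearMap.ext fun n => bigLat_ext ?_ (fun x => ?_) ?_⟩
    · exact (LinearMap.congr_fun (congrArg RPCHom.lin h1) n).symm
    · exact LinearMap.congr_fun (hm x) n
    · exact (LinearMap.congr_fun e2 n).symm
  · rintro ⟨m, rfl⟩
    refine Prod.ext (Quotient.sound (s := BoundedHom.setoid Q τ) ⟨rfl, m, fun x => rfl⟩) rfl

lemma map_liftPoint (hs : ∀ m m' : M, Q m m' = Q m' m) (hQ : IsPosDef Q) {ρ τ : RPC} (g : ρ ⟶ τ)
    {h : τ.N →ₗ[ℤ] BigLat σ M M'} (hh : IsLift Q h) :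
    (tropSemiabelian Q M').map g.op (liftPoint hs hQ h hh) =
      liftPoint hs hQ (h.comp (RPCHom.lin g)) (hh.comp g) := rfl

lemma liftPoint_mem_sigmaSub [Module.Free ℤ M] [Module.Finite ℤ M]
    (hs : ∀ m m' : M, Q m m' = Q m' m) (hQ : IsPosDef Q) {τ : RPC}
    {h : τ.N →ₗ[ℤ] BigLat σ M M'} (hh : IsLift Q h) {S : Set (BigLat σ M M')} :
    liftPoint hs hQ h hh ∈ (sigmaSub Q S).obj (op τ) ↔
      ∀ m n, latPt n ∈ τ.cone → translate Q M' m (h n) ∈ S := by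
  constructor
  · intro H m n hn
    exact H (liftHom hs hQ _ (hh.translate m))
      (congrArg Prod.fst ((liftPoint_eq_iff hs hQ hh (hh.translate m)).2 ⟨m, rfl⟩)).symm n hn
  · intro H a ha n hn
    obtain ⟨m, hm⟩ := (liftPoint_eq_iff hs hQ hh (isLift_liftLin hs hQ a
      (liftPoint hs hQ h hh).2)).1 (Prod.ext ha.symm rfl)
    have := H m n hn
    rw [← LinearMap.comp_apply, ← hm] at this
    exact this

lemma isLift_inl {τ : RPC} (f : τ ⟶ σ) :
    IsLift Q ((LinearMap.inl ℤ σ.N (Module.Dual ℤ M × Module.Dual ℤ M')).comp (RPCHom.lin f)) :=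
  fun n hn => ⟨RPC.maps_latPt f hn, 1, one_pos, 0, LinearMap.ext fun x => by simp⟩

lemma zeroSection_obj (hs : ∀ m m' : M, Q m m' = Q m' m) (hQ : IsPosDef Q) {τ : RPC} (f : τ ⟶ σ) :
    (zeroSection Q M').obj (⟨τ, f⟩ : PshPt (yoneda.obj σ)) = (⟨τ, liftPoint hs hQ _ (isLift_inl f)⟩ :
      PshPt (tropSemiabelian Q M')) := rfl

end Points

/-! ### A translation invariant decomposition of the admissible points -/

section Cells

variable {σ : RPC} {M : Type} [AddCommGroup M] {Q : M →ₗ[ℤ] M →ₗ[ℤ] Module.Dual ℤ σ.N}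
  {M' : Type} [AddCommGroup M']

lemma evalR_nonneg_of_latPt {τ : RPC} {l : Module.Dual ℤ τ.N}
    (h : ∀ n, latPt n ∈ τ.cone → 0 ≤ l n) {x : RealExt τ.N} (hx : x ∈ τ.cone) : 0 ≤ evalR l x := by
  obtain ⟨s, hs⟩ := τ.rational.generated
  have : τ.cone ≤ halfSpace l := by
    conv_lhs => rw [hs]
    refine Submodule.span_le.2 ?_
    rintro _ ⟨v, hv, rfl⟩
    change 0 ≤ evalR l (latPt v)
    rw [evalR_latPt]
    exact_mod_cast h v (by rw [hs]; exact PointedCone.subset_hull ⟨v, hv, rfl⟩)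
  exact this hx

lemma IsPosDef.evalR_nonneg (hQ : IsPosDef Q) (m : M) {x : RealExt σ.N} (hx : x ∈ σ.cone) :
    0 ≤ evalR (Q m m) x :=
  evalR_nonneg_of_latPt (fun _ hn => hQ.nonneg m hn) hx

/-- Cauchy–Schwarz at a real point of σ with integral arguments: Q(m' + t m, m' + t m) = Q(m',m') +
2 t Q(m,m') is nonnegative for all integers t, so the slope vanishes. -/
lemma evalR_eq_zero_of_self (hs : ∀ m m' : M, Q m m' = Q m' m) (hQ : IsPosDef Q)
    {x : RealExt σ.N} (hx : x ∈ σ.cone) {m : M} (hm : evalR (Q m m) x = 0) (m' : M) :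
    evalR (Q m m') x = 0 := by
  have h1 : ∀ t : ℤ, 0 ≤ evalR (Q m' m') x + 2 * t * evalR (Q m m') x := by
    intro t
    have h := hQ.evalR_nonneg (m' + t • m) hx
    have e : Q (m' + t • m) (m' + t • m) = Q m' m' + (2 * t) • Q m m' + (t * t) • Q m m := by
      simp only [map_add, map_smul, LinearMap.add_apply, LinearMap.smul_apply, hs m' m]
      module
    rw [e, evalR_add, evalR_add, evalR_smul, evalR_smul, hm] at h
    push_cast at h
    linarith
  by_contra hne
  have key : ∀ c : ℝ, (∀ t : ℤ, 0 ≤ evalR (Q m' m') x + 2 * t * c) → ¬ 0 < c := by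
    intro c hc hpos
    obtain ⟨n, hn⟩ := exists_nat_gt (evalR (Q m' m') x / c)
    have h2 := hc (-n)
    rw [div_lt_iff₀ hpos] at hn
    have h3 := hc 0
    push_cast at h2 h3
    linarith
  rcases lt_or_gt_of_ne hne with h | h
  · refine key (-evalR (Q m m') x) (fun t => ?_) (by linarith)
    have := h1 (-t)
    push_cast at this
    linarith
  · exact key _ h1 h

variable (Q M') in
/-- The auxiliary data for the decomposition. -/
structure CellData where
  K : ℤ
  U : Finset (M × M')
  dirs : Finset (Module.Dual ℤ M)
  K_pos : 0 < K
  zero_mem : 0 ∈ U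
  span_eq : Submodule.span ℤ (U : Set (M × M')) = ⊤
  pos : ∀ x y, (∀ l ∈ dirs, 0 ≤ l x * l y) → ∀ n, latPt n ∈ σ.cone → 0 ≤ Q x y n
  sep : ∀ x, (∀ l ∈ dirs, l x = 0) → x = 0
  bound : ∀ u ∈ U, ∀ u' ∈ U, ∀ l ∈ dirs, |l (u'.1 - u.1)| ≤ K

/-- Diagonalizing the form at a generator v of σ writes a positive multiple of it as a positive
combination of squares of functionals Q(e, ·)(v). Vectors on which all these functionals have
compatible signs then pair nonnegatively. The coordinates are added in order to separate points. -/
lemma exists_finset_dirs [Module.Free ℤ M] [Module.Finite ℤ M]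
    (hs : ∀ m m' : M, Q m m' = Q m' m) (hQ : IsPosDef Q) :
    ∃ T : Finset (Module.Dual ℤ M),
      (∀ x y, (∀ l ∈ T, 0 ≤ l x * l y) → ∀ n, latPt n ∈ σ.cone → 0 ≤ Q x y n) ∧
      ∀ x, (∀ l ∈ T, l x = 0) → x = 0 := by
  classical
  obtain ⟨s, hgen⟩ := σ.rational.generated
  have h1 : ∀ v : σ.N, latPt v ∈ σ.cone → ∃ T : Finset (Module.Dual ℤ M),
      ∀ x y, (∀ l ∈ T, 0 ≤ l x * l y) → 0 ≤ Q x y v := by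
    intro v hv
    have hs' : ∀ x y, formAt Q v x y = formAt Q v y x := fun x y => by simp [hs x y]
    obtain ⟨t, c, D, hD, hc, h⟩ := exists_diagonalization (formAt Q v)
      hs' (fun x => hQ.nonneg x hv)
    refine ⟨t.image fun e => formAt Q v e, fun x y hxy => ?_⟩
    have h2 := h x y
    rw [map_sub, map_smul, map_sum, LinearMap.sub_apply, LinearMap.smul_apply,
      LinearMap.sum_apply, sub_eq_zero, smul_eq_mul] at h2
    have h3 : 0 ≤ D * formAt Q v x y := by
      rw [h2]
      refine Finset.sum_nonneg fun e he => ?_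
      rw [map_smul, LinearMap.smul_apply, smul_eq_mul, mul_assoc]
      exact mul_nonneg (hc e he).le (hxy _ (Finset.mem_image_of_mem _ he))
    exact nonneg_of_mul_nonneg_right h3 hD
  choose! T hT using h1
  let b := Module.Free.chooseBasis ℤ M
  refine ⟨s.biUnion T ∪ Finset.univ.image b.coord, fun x y hxy n hn => ?_, fun x hx => ?_⟩
  · have hv : ∀ v ∈ s, 0 ≤ Q x y v := fun v hv => hT v
      (by rw [hgen]; exact PointedCone.subset_hull ⟨v, hv, rfl⟩) x y fun l hl =>
        hxy l (Finset.mem_union_left _ (Finset.mem_biUnion.2 ⟨v, hv, hl⟩))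
    rw [hgen] at hn
    exact nonneg_of_generators hv hn
  · refine b.ext_elem fun i => ?_
    have := hx (b.coord i) (Finset.mem_union_right _ (Finset.mem_image_of_mem _ (Finset.mem_univ i)))
    simpa using this

variable (M') in
-- K exceeds every |l(u' − u)|, so that in `ell` the quadratic term in m dominates the perturbation
-- by U. The perturbation makes the cells strictly convex and σ × 0 × 0 one of them.
lemma nonempty_cellData [Module.Free ℤ M] [Module.Finite ℤ M] [Module.Finite ℤ M']
    (hs : ∀ m m' : M, Q m m' = Q m' m) (hQ : IsPosDef Q) : Nonempty (CellData Q M') := by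
  classical
  obtain ⟨T, hT1, hT2⟩ := exists_finset_dirs hs hQ
  obtain ⟨U, hU⟩ := (Module.Finite.fg_top : (⊤ : Submodule ℤ (M × M')).FG)
  let V := insert 0 U
  let f : (M × M') × (M × M') × Module.Dual ℤ M → ℤ := fun q => |q.2.2 (q.2.1.1 - q.1.1)|
  refine ⟨⟨1 + ∑ q ∈ V ×ˢ V ×ˢ T, f q, V, T, ?_, Finset.mem_insert_self _ _, ?_, hT1, hT2, ?_⟩⟩
  · have : 0 ≤ ∑ q ∈ V ×ˢ V ×ˢ T, f q := Finset.sum_nonneg fun _ _ => abs_nonneg _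
    omega
  · rw [eq_top_iff, ← hU]
    exact Submodule.span_mono (Finset.coe_subset.2 (Finset.subset_insert _ _))
  · intro u hu u' hu' l hl
    have : f (u, u', l) ≤ ∑ q ∈ V ×ˢ V ×ˢ T, f q :=
      Finset.single_le_sum (f := f) (fun _ _ => abs_nonneg _)
        (by simp only [Finset.mem_product]; exact ⟨hu, hu', hl⟩)
    change f (u, u', l) ≤ _
    omega

namespace CellData

variable (d : CellData Q M')

/-- `(n, n', n'') ↦ n'(u) + n''(u')` as a linear function of `(u, u')`. -/
def pair : M × M' →ₗ[ℤ] Module.Dual ℤ (BigLat σ M M') :=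
  LinearMap.mk₂ ℤ (fun u l => l.2.1 u.1 + l.2.2 u.2)
    (fun u v l => by simp; ring) (fun c u l => by simp; ring)
    (fun u l l' => by simp; ring) (fun c u l => by simp; ring)

@[simp] lemma pair_apply (u : M × M') (l : BigLat σ M M') :
    pair u l = l.2.1 u.1 + l.2.2 u.2 := rfl

/-- The functionals whose regions of minimality are the maximal cells. -/
def ell (m : M) (u : M × M') : Module.Dual ℤ (BigLat σ M M') :=
  d.K • ((Q m m).comp (LinearMap.fst ℤ _ _) + (4 : ℤ) • pair (m, 0)) + (2 : ℤ) • pair u +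
    (Q m u.1).comp (LinearMap.fst ℤ _ _)

lemma ell_apply (m : M) (u : M × M') (l : BigLat σ M M') : d.ell m u l =
    d.K * (Q m m l.1 + 4 * l.2.1 m) + 2 * (l.2.1 u.1 + l.2.2 u.2) + Q m u.1 l.1 := by
  simp [ell, mul_add]

/-- The coefficients of `ell` are made for this: translation by m₀ amounts to the shift of m by 2
m₀, up to a term independent of m and u. The shift being even leaves a midpoint in M, on which
`evalR_form_eq_zero` relies. -/
lemma ell_comp_translate (hs : ∀ m m' : M, Q m m' = Q m' m) (m : M) (u : M × M') (m₀ : M) :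
    (d.ell m u).comp (translate Q M' m₀) = d.ell (m + 2 • m₀) u -
      d.K • ((4 : ℤ) • (Q m₀ m₀).comp (LinearMap.fst ℤ _ _) + (8 : ℤ) • pair (m₀, 0)) := by
  refine LinearMap.ext fun l => ?_
  have h := LinearMap.congr_fun (hs m₀ m) l.1
  simp only [LinearMap.comp_apply, ell_apply, LinearMap.sub_apply, LinearMap.smul_apply,
    LinearMap.add_apply, LinearMap.fst_apply, pair_apply, translate_fst, translate_snd_fst,
    translate_snd_snd, map_add, map_nsmul, QhomN_apply, smul_eq_mul, nsmul_eq_mul, map_zero]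
  push_cast
  linear_combination (2 * d.K) * h

/-- Subadditivity of the conditions defining a cell. -/
lemma ell_add (hs : ∀ m m' : M, Q m m' = Q m' m) (m p q : M) (u u' : M × M') :
    d.ell (m + (p + q)) u' - d.ell m u = (d.ell (m + p) u - d.ell m u) +
      (d.ell (m + q) u' - d.ell m u) +
      (Q p ((2 * d.K) • q + (u'.1 - u.1))).comp (LinearMap.fst ℤ _ _) := by
  refine LinearMap.ext fun l => ?_
  have h := LinearMap.congr_fun (hs p q) l.1
  have h1 := LinearMap.congr_fun (hs m p) l.1
  have h2 := LinearMap.congr_fun (hs m q) l.1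
  simp only [LinearMap.comp_apply, ell_apply, LinearMap.sub_apply, LinearMap.smul_apply,
    LinearMap.add_apply, LinearMap.fst_apply, map_add, map_sub, map_smul, smul_eq_mul]
  linear_combination (-d.K) * h

/-- The maximal cells. -/
def cell (m : M) (u : M × M') : PointedCone ℝ (RealExt (BigLat σ M M')) :=
  σ.cone.comap (realMap (LinearMap.fst ℤ _ _)) ⊓
    ⨅ (p : M) (u' : d.U), halfSpace (d.ell (m + p) u' - d.ell m u)

lemma mem_cell {m : M} {u : M × M'} {x : RealExt (BigLat σ M M')} : x ∈ d.cell m u ↔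
    realMap (LinearMap.fst ℤ _ _) x ∈ σ.cone ∧
      ∀ p, ∀ u' ∈ d.U, 0 ≤ evalR (d.ell (m + p) u' - d.ell m u) x := by
  simp only [cell, Submodule.mem_inf, Submodule.mem_iInf, mem_halfSpace, Subtype.forall]
  rfl

lemma mem_cell' {m : M} {u : M × M'} {x : RealExt (BigLat σ M M')} : x ∈ d.cell m u ↔
    realMap (LinearMap.fst ℤ _ _) x ∈ σ.cone ∧
      ∀ p, ∀ u' ∈ d.U, evalR (d.ell m u) x ≤ evalR (d.ell p u') x := by
  rw [mem_cell]
  refine and_congr_right fun _ => ⟨fun h p u' hu' => ?_, fun h p u' hu' => ?_⟩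
  · have := h (p - m) u' hu'
    rw [evalR_sub, add_sub_cancel] at this
    linarith
  · have := h (m + p) u' hu'
    rw [evalR_sub]
    linarith

/-- `q` is smaller than `p`, with the same signs, in all directions. -/
def Rel (q p : M) : Prop := ∀ l ∈ d.dirs, SignType.sign (l q) = SignType.sign (l p) ∧ |l q| ≤ |l p|

/-- The elements that are minimal for `Rel`. -/
def IsIrred (p : M) : Prop := p ≠ 0 ∧ ∀ q, q ≠ 0 → d.Rel q p → q = p

/-- Dickson's lemma: among infinitely many elements with the same signs, two are comparable in all
the |l p| at once, and the larger one is not minimal. -/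
lemma finite_isIrred : {p | d.IsIrred p}.Finite := by
  by_contra hinf
  have : Infinite {p | d.IsIrred p} := Set.infinite_coe_iff.2 hinf
  let sg : {p | d.IsIrred p} → (d.dirs → SignType) := fun p l => SignType.sign (l.1 p.1)
  obtain ⟨s, hs⟩ := Finite.exists_infinite_fiber sg
  let f : ℕ ↪ (sg ⁻¹' {s}) := Infinite.natEmbedding _
  let v : ℕ → (d.dirs → ℕ) := fun n l => (l.1 (f n).1.1).natAbs
  obtain ⟨a, b, hab, hle⟩ := wellQuasiOrdered_le v
  have hrel : d.Rel (f a).1.1 (f b).1.1 := by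
    intro l hl
    refine ⟨?_, ?_⟩
    · have h1 := congrFun ((f a).2 : sg (f a).1 = s) ⟨l, hl⟩
      have h2 := congrFun ((f b).2 : sg (f b).1 = s) ⟨l, hl⟩
      exact h1.trans h2.symm
    · have := hle ⟨l, hl⟩
      rw [Int.abs_eq_natAbs, Int.abs_eq_natAbs]
      exact_mod_cast this
  have h := (f b).1.2.2 _ (f a).1.2.1 hrel
  exact hab.ne (f.injective (Subtype.ext (Subtype.ext h)))

/-- Equal signs give |l(p − q)| = |l p| − |l q|, so the size Σ |l p| is additive along p = (p − q) +
q, and it is positive off 0 by `sep`. This is the induction measure for `mem_cell_of_isIrred`. -/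
lemma Rel.sub_lt {q p : M} (h : d.Rel q p) (hq : q ≠ 0) (hp : q ≠ p) :
    (∑ l ∈ d.dirs, |l (p - q)|) < ∑ l ∈ d.dirs, |l p| ∧
      (∑ l ∈ d.dirs, |l q|) < ∑ l ∈ d.dirs, |l p| := by
  have key : ∀ l ∈ d.dirs, |l (p - q)| = |l p| - |l q| := by
    intro l hl
    obtain ⟨h1, h2⟩ := h l hl
    rw [map_sub]
    rcases lt_trichotomy (l p) 0 with h3 | h3 | h3
    · rw [sign_neg h3, sign_eq_neg_one_iff] at h1
      rw [abs_of_neg h3, abs_of_neg h1] at h2 ⊢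
      rw [abs_of_nonpos (by omega)]
      omega
    · rw [h3, sign_zero, sign_eq_zero_iff] at h1
      simp [h1, h3]
    · rw [sign_pos h3, sign_eq_one_iff] at h1
      rw [abs_of_pos h3, abs_of_pos h1] at h2 ⊢
      rw [abs_of_nonneg (by omega)]
  have pos : ∀ x : M, x ≠ 0 → 0 < ∑ l ∈ d.dirs, |l x| := by
    intro x hx
    obtain ⟨l, hl, hlx⟩ : ∃ l ∈ d.dirs, l x ≠ 0 := by
      by_contra hcon
      push Not at hcon
      exact hx (d.sep x hcon)
    exact Finset.sum_pos' (fun _ _ => abs_nonneg _) ⟨l, hl, abs_pos.2 hlx⟩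
  have hsum : (∑ l ∈ d.dirs, |l (p - q)|) = (∑ l ∈ d.dirs, |l p|) - ∑ l ∈ d.dirs, |l q| := by
    rw [← Finset.sum_sub_distrib]
    exact Finset.sum_congr rfl key
  have h1 := pos q hq
  have h2 := pos (p - q) (sub_ne_zero.2 hp.symm)
  omega

/-- If l(q) ≠ 0, then 2K |l q| ≥ 2K outweighs |l(u' − u)| ≤ K, so both factors weakly have the sign
of l(p). This makes the error term of `ell_add` nonnegative. -/
lemma Rel.mul_nonneg {q p : M} (h : d.Rel q p) {u u' : M × M'} (hu : u ∈ d.U) (hu' : u' ∈ d.U)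
    {l : Module.Dual ℤ M} (hl : l ∈ d.dirs) :
    0 ≤ l (p - q) * l ((2 * d.K) • q + (u'.1 - u.1)) := by
  obtain ⟨h1, h2⟩ := h l hl
  have hb := abs_le.1 (d.bound u hu u' hu' l hl)
  have hK := d.K_pos
  rw [map_sub, map_add, map_smul, smul_eq_mul]
  rcases lt_trichotomy (l p) 0 with h3 | h3 | h3
  · rw [sign_neg h3, sign_eq_neg_one_iff] at h1
    rw [abs_of_neg h3, abs_of_neg h1] at h2
    refine mul_nonneg_of_nonpos_of_nonpos (by omega) ?_
    nlinarith
  · rw [h3, sign_zero, sign_eq_zero_iff] at h1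
    simp [h1, h3]
  · rw [sign_pos h3, sign_eq_one_iff] at h1
    rw [abs_of_pos h3, abs_of_pos h1] at h2
    refine _root_.mul_nonneg (by omega) ?_
    nlinarith

/-- The infinitely many inequalities of a cell follow from finitely many. A reducible p splits as (p
− q) + q into elements of smaller size, and by `ell_add` its inequality is the sum of theirs and a
nonnegative term. -/
lemma mem_cell_of_isIrred (hs : ∀ m m' : M, Q m m' = Q m' m) {m : M} {u : M × M'} (hu : u ∈ d.U)
    {x : RealExt (BigLat σ M M')} (hx : realMap (LinearMap.fst ℤ _ _) x ∈ σ.cone)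
    (h : ∀ p, p = 0 ∨ d.IsIrred p → ∀ u' ∈ d.U, 0 ≤ evalR (d.ell (m + p) u' - d.ell m u) x) :
    x ∈ d.cell m u := by
  refine d.mem_cell.2 ⟨hx, ?_⟩
  have key : ∀ (n : ℕ) (p : M), (∑ l ∈ d.dirs, |l p|) < n → ∀ u' ∈ d.U,
      0 ≤ evalR (d.ell (m + p) u' - d.ell m u) x := by
    intro n
    induction n with
    | zero =>
      intro p hp
      have : 0 ≤ ∑ l ∈ d.dirs, |l p| := Finset.sum_nonneg fun _ _ => abs_nonneg _
      push_cast at hp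
      omega
    | succ n ih =>
      intro p hp u' hu'
      push_cast at hp
      by_cases hirr : p = 0 ∨ d.IsIrred p
      · exact h p hirr u' hu'
      · simp only [IsIrred, not_or, not_and] at hirr
        obtain ⟨hp0, hirr⟩ := hirr
        have hirr := hirr hp0
        push Not at hirr
        obtain ⟨q, hq0, hqp, hne⟩ := hirr
        obtain ⟨h1, h2⟩ := hqp.sub_lt d hq0 hne
        have e := d.ell_add hs m (p - q) q u u'
        rw [sub_add_cancel] at e
        rw [e, evalR_add, evalR_add, ← evalR_realMap]
        have h3 := ih (p - q) (by omega) u hu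
        have h4 := ih q (by omega) u' hu'
        have h5 := evalR_nonneg_of_latPt
          (d.pos _ _ fun l hl => hqp.mul_nonneg d hu hu' hl) hx
        linarith
  intro p
  refine key ((∑ l ∈ d.dirs, |l p|).toNat + 1) p ?_
  push_cast
  have := Int.self_le_toNat (∑ l ∈ d.dirs, |l p|)
  omega

lemma isLatticeGenerated_cell [Module.Free ℤ M] [Module.Finite ℤ M] [Module.Finite ℤ M']
    (hs : ∀ m m' : M, Q m m' = Q m' m) (m : M)
    {u : M × M'} (hu : u ∈ d.U) : IsLatticeGenerated (d.cell m u) := by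
  classical
  obtain ⟨T, hT⟩ := IsLatticeGenerated.exists_halfSpaces σ.rational.generated
  let I : Finset M := insert 0 d.finite_isIrred.toFinset
  let A : Finset (Module.Dual ℤ (BigLat σ M M')) :=
    T.image (fun t => t.comp (LinearMap.fst ℤ _ _)) ∪
      (I ×ˢ d.U).image fun q => d.ell (m + q.1) q.2 - d.ell m u
  have : d.cell m u = A.inf halfSpace := by
    ext x
    rw [mem_finset_inf_halfSpace]
    have hfst : realMap (LinearMap.fst ℤ _ _) x ∈ σ.cone ↔
        ∀ t ∈ T, 0 ≤ evalR (t.comp (LinearMap.fst ℤ _ (Module.Dual ℤ M × Module.Dual ℤ M'))) x := by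
      rw [hT, mem_finset_inf_halfSpace]
      simp only [evalR_realMap]
    constructor
    · intro hx l hl
      obtain ⟨h1, h2⟩ := d.mem_cell.1 hx
      rcases Finset.mem_union.1 hl with hl | hl
      · obtain ⟨t, ht, rfl⟩ := Finset.mem_image.1 hl
        exact hfst.1 h1 t ht
      · obtain ⟨q, hq, rfl⟩ := Finset.mem_image.1 hl
        exact h2 q.1 q.2 (Finset.mem_product.1 hq).2
    · intro h
      refine d.mem_cell_of_isIrred hs hu (hfst.2 fun t ht =>
        h _ (Finset.mem_union_left _ (Finset.mem_image_of_mem _ ht))) fun p hp u' hu' =>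
        h _ (Finset.mem_union_right _ (Finset.mem_image.2 ⟨(p, u'), ?_, rfl⟩))
      refine Finset.mem_product.2 ⟨?_, hu'⟩
      rcases hp with rfl | hp
      · exact Finset.mem_insert_self _ _
      · exact Finset.mem_insert_of_mem (d.finite_isIrred.mem_toFinset.2 hp)
  rw [this]
  exact isLatticeGenerated_halfSpaces A

end CellData

end Cells

/-! ### The cells as a translation-equivariant fan -/

section CellFan

variable {σ : RPC} {M : Type} [AddCommGroup M] {Q : M →ₗ[ℤ] M →ₗ[ℤ] Module.Dual ℤ σ.N}
  {M' : Type} [AddCommGroup M']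

lemma realMap_fst_translate (m : M) (x : RealExt (BigLat σ M M')) :
    realMap (LinearMap.fst ℤ _ _) (realMap (translate Q M' m) x) =
      realMap (LinearMap.fst ℤ _ _) x := by
  rw [← realMap_comp]
  rfl

lemma realMap_translate_neg (m : M) (x : RealExt (BigLat σ M M')) :
    realMap (translate Q M' m) (realMap (translate Q M' (-m)) x) = x := by
  rw [← realMap_comp, translate_comp, add_neg_cancel, translate_zero, realMap_id]

lemma realMap_neg_translate (m : M) (x : RealExt (BigLat σ M M')) :
    realMap (translate Q M' (-m)) (realMap (translate Q M' m) x) = x := by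
  rw [← realMap_comp, translate_comp, neg_add_cancel, translate_zero, realMap_id]

lemma mem_map_translate {m : M} {C : PointedCone ℝ (RealExt (BigLat σ M M'))}
    {x : RealExt (BigLat σ M M')} : x ∈ C.map (realMap (translate Q M' m)) ↔
      realMap (translate Q M' (-m)) x ∈ C := by
  constructor
  · rintro ⟨y, hy, rfl⟩
    change realMap _ (realMap _ y) ∈ C
    rwa [realMap_neg_translate]
  · intro h
    exact ⟨_, h, realMap_translate_neg m x⟩

lemma map_translate_translate (m m' : M) (C : PointedCone ℝ (RealExt (BigLat σ M M'))) :
    (C.map (realMap (translate Q M' m'))).map (realMap (translate Q M' m)) =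
      C.map (realMap (translate Q M' (m + m'))) := by
  rw [PointedCone.map_map, ← translate_comp]
  congr 1
  exact LinearMap.ext fun x => (realMap_comp _ _ x).symm

lemma map_translate_zero (C : PointedCone ℝ (RealExt (BigLat σ M M'))) :
    C.map (realMap (translate Q M' 0)) = C := by
  ext x
  rw [mem_map_translate, neg_zero, translate_zero, realMap_id]

lemma isFaceOf_map_translate {F C : PointedCone ℝ (RealExt (BigLat σ M M'))} (h : F.IsFaceOf C)
    (m : M) : (F.map (realMap (translate Q M' m))).IsFaceOf (C.map (realMap (translate Q M' m))) where
  le x hx := mem_map_translate.2 (h.le (mem_map_translate.1 hx))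
  mem_of_smul_add_mem {x y a} hx hy ha hxy := by
    rw [mem_map_translate] at *
    rw [map_add, map_smul] at hxy
    exact h.mem_of_smul_add_mem hx hy ha hxy

lemma IsRelInt.map_translate {C : PointedCone ℝ (RealExt (BigLat σ M M'))} {l : BigLat σ M M'}
    (h : IsRelInt C (latPt l)) (m : M) :
    IsRelInt (C.map (realMap (translate Q M' m))) (latPt (translate Q M' m l)) := by
  rw [← realMap_latPt]
  exact isRelInt_map h

/-- A translation fixes the points over which it is not strictly convex. -/
lemma realMap_translate_eq_self [Module.Free ℤ M] [Module.Finite ℤ M]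
    (hs : ∀ m m' : M, Q m m' = Q m' m) (hQ : IsPosDef Q)
    {x : RealExt (BigLat σ M M')} (hx : realMap (LinearMap.fst ℤ _ _) x ∈ σ.cone) {m : M}
    (hm : evalR (Q m m) (realMap (LinearMap.fst ℤ _ _) x) = 0) :
    realMap (translate Q M' m) x = x := by
  let j : Module.Dual ℤ M →ₗ[ℤ] BigLat σ M M' := (LinearMap.inr ℤ _ _).comp (LinearMap.inl ℤ _ _)
  have h1 : realMap (translate Q M' m) x = x + realMap (j.comp ((QhomN Q m).comp
      (LinearMap.fst ℤ _ _))) x := by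
    have : realMap (translate Q M' m) = LinearMap.id + realMap (j.comp ((QhomN Q m).comp
        (LinearMap.fst ℤ _ _))) := realExt_ext fun n => by
      rw [LinearMap.add_apply, realMap_latPt, realMap_latPt, LinearMap.id_apply, ← latPt_add]
      congr 1
      exact bigLat_ext (by simp [j]) (fun _ => by simp [j]) (by simp [j])
    rw [this]
    rfl
  rw [h1, realMap_comp j, realMap_comp (QhomN Q m)]
  have h2 : realMap (QhomN Q m) (realMap (LinearMap.fst ℤ _ _) x) = 0 := by
    refine eq_zero_of_evalR fun l => ?_
    obtain ⟨m', rfl⟩ := (Module.evalEquiv ℤ M).surjective l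
    rw [evalR_realMap]
    exact evalR_eq_zero_of_self hs hQ hx hm m'
  rw [h2, map_zero, add_zero]

namespace CellData

variable (d : CellData Q M')

lemma mem_cell_translate (hs : ∀ m m' : M, Q m m' = Q m' m) {m : M} {u : M × M'}
    {x : RealExt (BigLat σ M M')} (m₀ : M) :
    realMap (translate Q M' m₀) x ∈ d.cell m u ↔ x ∈ d.cell (m + 2 • m₀) u := by
  rw [mem_cell', mem_cell', realMap_fst_translate]
  refine and_congr_right fun _ => ?_
  simp only [evalR_realMap, d.ell_comp_translate hs, evalR_sub]
  constructor
  · intro h p u' hu'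
    have := h (p - 2 • m₀) u' hu'
    rw [sub_add_cancel] at this
    linarith
  · intro h p u' hu'
    have := h (p + 2 • m₀) u' hu'
    linarith

lemma map_cell (hs : ∀ m m' : M, Q m m' = Q m' m) (m : M) (u : M × M') (m₀ : M) :
    (d.cell m u).map (realMap (translate Q M' m₀)) = d.cell (m - 2 • m₀) u := by
  ext x
  rw [mem_map_translate, d.mem_cell_translate hs, smul_neg, sub_eq_add_neg]

lemma eq_zero_of_pair [Module.Free ℤ M] [Module.Finite ℤ M] [Module.Free ℤ M']
    [Module.Finite ℤ M'] {x : RealExt (BigLat σ M M')}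
    (h1 : realMap (LinearMap.fst ℤ σ.N (Module.Dual ℤ M × Module.Dual ℤ M')) x = 0)
    (h2 : ∀ u ∈ d.U, evalR (pair (σ := σ) u) x = 0) : x = 0 := by
  have h3 : ∀ w, evalR (pair (σ := σ) w) x = 0 := by
    intro w
    have hw : w ∈ Submodule.span ℤ (d.U : Set (M × M')) := by rw [d.span_eq]; trivial
    induction hw using Submodule.span_induction with
    | mem w hw => exact h2 w hw
    | zero => rw [map_zero, evalR_zero]
    | add a b _ _ ha hb => rw [map_add, evalR_add, ha, hb, add_zero]
    | smul c a _ ha => rw [map_smul, evalR_smul, ha, mul_zero]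
  refine eq_zero_of_evalR fun l => ?_
  obtain ⟨m, hm⟩ := (Module.evalEquiv ℤ M).surjective
    (l.comp ((LinearMap.inr ℤ _ _).comp (LinearMap.inl ℤ _ _)))
  obtain ⟨m', hm'⟩ := (Module.evalEquiv ℤ M').surjective
    (l.comp ((LinearMap.inr ℤ _ _).comp (LinearMap.inr ℤ _ _)))
  have e : l = (l.comp (LinearMap.inl ℤ _ _)).comp (LinearMap.fst ℤ _ _) + pair (m, m') := by
    refine LinearMap.ext fun y => ?_
    have e1 : y.2.1 m = l (0, y.2.1, 0) := LinearMap.congr_fun hm y.2.1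
    have e2 : y.2.2 m' = l (0, 0, y.2.2) := LinearMap.congr_fun hm' y.2.2
    rw [LinearMap.add_apply, pair_apply, e1, e2, LinearMap.comp_apply, LinearMap.comp_apply,
      ← map_add, ← map_add]
    congr 1
    simp
  rw [e, evalR_add, h3, ← evalR_realMap, h1, map_zero, add_zero]

/-- If x and −x lie in the cell, then n = 0 and all `ell p u'` agree at x. With p = m this makes the
pairing with u' constant on U, hence 0 because 0 ∈ U, and U spans M × M'. -/
lemma isRationalCone_cell [Module.Free ℤ M] [Module.Finite ℤ M] [Module.Free ℤ M']
    [Module.Finite ℤ M'] (hs : ∀ m m' : M, Q m m' = Q m' m) (m : M)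
    {u : M × M'} (hu : u ∈ d.U) : IsRationalCone (d.cell m u) := by
  refine ⟨d.isLatticeGenerated_cell hs m hu, fun x hx hx' => ?_⟩
  obtain ⟨h1, h2⟩ := d.mem_cell'.1 hx
  obtain ⟨h1', h2'⟩ := d.mem_cell'.1 hx'
  rw [map_neg] at h1'
  have h0 := σ.rational.strictlyConvex _ h1 h1'
  refine d.eq_zero_of_pair h0 ?_
  have e : ∀ p, ∀ u' ∈ d.U, evalR (d.ell m u) x = evalR (d.ell p u') x := by
    intro p u' hu'
    have a := h2 p u' hu'
    have b := h2' p u' hu'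
    rw [map_neg, map_neg] at b
    linarith
  have hp : ∀ u' ∈ d.U, evalR (pair (σ := σ) u') x = evalR (pair (σ := σ) u) x := by
    intro u' hu'
    have h3 := e m u' hu'
    have h4 : ∀ v, evalR (d.ell m v) x = d.K * (4 * evalR (pair (σ := σ) (m, 0)) x) +
        2 * evalR (pair (σ := σ) v) x := by
      intro v
      rw [ell, evalR_add, evalR_add, evalR_smul, evalR_add, evalR_smul, evalR_smul,
        ← evalR_realMap, ← evalR_realMap, h0, map_zero, map_zero]
      push_cast
      ring
    rw [h4, h4] at h3
    linarith
  intro u' hu'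
  rw [hp u' hu', ← hp 0 d.zero_mem, map_zero, evalR_zero]

/-- The set of all cells. -/
def cells : Set (PointedCone ℝ (RealExt (BigLat σ M M'))) :=
  {C | ∃ m, ∃ u ∈ d.U, C.IsFaceOf (d.cell m u)}

/-- Inside the first cell, the second is the zero locus of `ell m' u' − ell m u`, which is
nonnegative there. -/
lemma isFaceOf_inf_cell (m m' : M) {u u' : M × M'} (hu : u ∈ d.U) (hu' : u' ∈ d.U) :
    (d.cell m u ⊓ d.cell m' u').IsFaceOf (d.cell m u) where
  le := inf_le_left
  mem_of_smul_add_mem {x y a} hx hy ha hxy := by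
    refine ⟨hx, ?_⟩
    obtain ⟨hx1, hx2⟩ := d.mem_cell'.1 hx
    obtain ⟨-, hy2⟩ := d.mem_cell'.1 hy
    have h := (d.mem_cell'.1 hxy.2).2 m u hu
    refine d.mem_cell'.2 ⟨hx1, fun p v hv => le_trans ?_ (hx2 p v hv)⟩
    rw [map_add, map_add, map_smul, map_smul, smul_eq_mul, smul_eq_mul] at h
    have a1 := hx2 m' u' hu'
    have a2 := hy2 m' u' hu'
    by_contra hcon
    push Not at hcon
    nlinarith

lemma inter_cells {C C' : PointedCone ℝ (RealExt (BigLat σ M M'))} (hC : C ∈ d.cells)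
    (hC' : C' ∈ d.cells) : (C ⊓ C').IsFaceOf C := by
  obtain ⟨m, u, hu, h⟩ := hC
  obtain ⟨m', u', hu', h'⟩ := hC'
  have h1 : ((d.cell m u ⊓ d.cell m' u') ⊓ C').IsFaceOf (d.cell m u ⊓ d.cell m' u') :=
    isFaceOf_inf_of_isFaceOf inf_le_right h'
  have h2 := h1.trans (d.isFaceOf_inf_cell m m' hu hu')
  have h3 : (C ⊓ ((d.cell m u ⊓ d.cell m' u') ⊓ C')).IsFaceOf C :=
    isFaceOf_inf_of_isFaceOf h.le h2
  have e : C ⊓ ((d.cell m u ⊓ d.cell m' u') ⊓ C') = C ⊓ C' := by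
    apply le_antisymm
    · exact le_inf inf_le_left (inf_le_right.trans inf_le_right)
    · exact le_inf inf_le_left (le_inf (le_inf (inf_le_left.trans h.le) (inf_le_right.trans h'.le))
        inf_le_right)
  rwa [e] at h3

lemma isRationalCone_of_mem [Module.Free ℤ M] [Module.Finite ℤ M] [Module.Free ℤ M']
    [Module.Finite ℤ M'] (hs : ∀ m m' : M, Q m m' = Q m' m)
    {C : PointedCone ℝ (RealExt (BigLat σ M M'))} (hC : C ∈ d.cells) : IsRationalCone C := by
  obtain ⟨m, u, hu, h⟩ := hC
  exact (d.isRationalCone_cell hs m hu).face h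

lemma translate_cells (hs : ∀ m m' : M, Q m m' = Q m' m)
    {C : PointedCone ℝ (RealExt (BigLat σ M M'))} (hC : C ∈ d.cells) (m₀ : M) :
    C.map (realMap (translate Q M' m₀)) ∈ d.cells := by
  obtain ⟨m, u, hu, h⟩ := hC
  refine ⟨m - 2 • m₀, u, hu, ?_⟩
  rw [← d.map_cell hs]
  exact isFaceOf_map_translate h m₀

/-- Both `ell m u` and `ell (m − 2 m₀) u` are minimal at x, so neither exceeds `ell (m − m₀) u`. But
their sum is twice that value plus 2K Q(m₀,m₀). -/
lemma evalR_form_eq_zero (hs : ∀ m m' : M, Q m m' = Q m' m) (hQ : IsPosDef Q) {m : M}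
    {u : M × M'} (hu : u ∈ d.U) {x : RealExt (BigLat σ M M')} {m₀ : M} (hx : x ∈ d.cell m u)
    (hx' : realMap (translate Q M' (-m₀)) x ∈ d.cell m u) :
    evalR (Q m₀ m₀) (realMap (LinearMap.fst ℤ _ _) x) = 0 := by
  rw [d.mem_cell_translate hs] at hx'
  obtain ⟨h1, h2⟩ := d.mem_cell'.1 hx
  have h3 := (d.mem_cell'.1 hx').2 (m - m₀) u hu
  have h4 := h2 (m - m₀) u hu
  have h5 := hQ.evalR_nonneg m₀ h1
  have e : d.ell m u + d.ell (m + 2 • -m₀) u = d.ell (m - m₀) u + d.ell (m - m₀) u +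
      (2 * d.K) • (Q m₀ m₀).comp (LinearMap.fst ℤ _ _) := by
    refine LinearMap.ext fun l => ?_
    have h := LinearMap.congr_fun (hs m₀ m) l.1
    simp only [LinearMap.comp_apply, ell_apply, LinearMap.smul_apply,
      LinearMap.add_apply, LinearMap.fst_apply, map_add, map_sub, map_neg, map_nsmul,
      LinearMap.sub_apply, LinearMap.neg_apply, smul_eq_mul, nsmul_eq_mul]
    push_cast
    ring
  have e2 := congrArg (fun f => evalR f x) e
  simp only [evalR_add, evalR_smul, ← evalR_realMap] at e2
  have hK : (0 : ℝ) < d.K := by exact_mod_cast d.K_pos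
  push_cast at e2
  nlinarith

lemma fixed_cells [Module.Free ℤ M] [Module.Finite ℤ M] (hs : ∀ m m' : M, Q m m' = Q m' m)
    (hQ : IsPosDef Q) {C : PointedCone ℝ (RealExt (BigLat σ M M'))} (hC : C ∈ d.cells)
    {x : RealExt (BigLat σ M M')} {m₀ : M} (hx : x ∈ C)
    (hx' : x ∈ C.map (realMap (translate Q M' m₀))) : realMap (translate Q M' m₀) x = x := by
  obtain ⟨m, u, hu, h⟩ := hC
  have h1 := h.le hx
  refine realMap_translate_eq_self hs hQ (d.mem_cell'.1 h1).1 ?_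
  exact d.evalR_form_eq_zero hs hQ hu h1 (h.le (mem_map_translate.1 hx'))

/-- T_{m₀} shifts the index m of a maximal cell by −2 m₀, so representatives of the finite group M /
2M suffice. -/
lemma finite_cells [Module.Free ℤ M] [Module.Finite ℤ M] [Module.Free ℤ M']
    [Module.Finite ℤ M'] (hs : ∀ m m' : M, Q m m' = Q m' m) :
    ∃ R : Set (PointedCone ℝ (RealExt (BigLat σ M M'))), R.Finite ∧ R ⊆ d.cells ∧
      ∀ C ∈ d.cells, ∃ C₀ ∈ R, ∃ m : M, C = C₀.map (realMap (translate Q M' m)) := by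
  let A := M ⧸ (LinearMap.range (LinearMap.lsmul ℤ M 2))
  have htor : Module.IsTorsion ℤ A := by
    intro a
    refine ⟨⟨2, by simp⟩, ?_⟩
    induction a using Submodule.Quotient.induction_on with
    | H m =>
      rw [Submonoid.mk_smul, ← Submodule.Quotient.mk_smul, Submodule.Quotient.mk_eq_zero]
      exact ⟨m, rfl⟩
  have : Finite A := Module.finite_of_fg_torsion A htor
  have hex : ∀ a : A, ∃ m : M, Submodule.Quotient.mk m = a := fun a =>
    Submodule.Quotient.mk_surjective _ a
  choose r hr using hex
  refine ⟨⋃ (a : A), ⋃ u ∈ d.U, {F | F.IsFaceOf (d.cell (r a) u)}, ?_, ?_, ?_⟩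
  · exact Set.finite_iUnion fun a => d.U.finite_toSet.biUnion fun u hu =>
      (d.isLatticeGenerated_cell hs (r a) hu).finite_faces
  · intro F hF
    simp only [Set.mem_iUnion] at hF
    obtain ⟨a, u, hu, h⟩ := hF
    exact ⟨_, u, hu, h⟩
  · rintro C ⟨m, u, hu, h⟩
    obtain ⟨t, ht⟩ := (Submodule.Quotient.eq _).1 (hr (Submodule.Quotient.mk m))
    have ht : (2 : ℤ) • t = r (Submodule.Quotient.mk m) - m := ht
    have e : m = r (Submodule.Quotient.mk m) - 2 • t := by
      rw [← natCast_zsmul]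
      push_cast
      rw [ht]
      abel
    refine ⟨C.map (realMap (translate Q M' (-t))), ?_, t, ?_⟩
    · simp only [Set.mem_iUnion]
      refine ⟨Submodule.Quotient.mk m, u, hu, ?_⟩
      have h2 := isFaceOf_map_translate (Q := Q) h (-t)
      rw [d.map_cell hs] at h2
      have e3 : m - 2 • -t = r (Submodule.Quotient.mk m) := by
        rw [smul_neg, sub_neg_eq_add]
        nth_rewrite 1 [e]
        abel
      rw [e3] at h2
      exact h2
    · rw [map_translate_translate, add_neg_cancel, map_translate_zero]

lemma evalR_ell_zero (u : M × M') (x : RealExt (BigLat σ M M')) :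
    evalR (d.ell 0 u) x = 2 * evalR (pair (σ := σ) u) x := by
  have : d.ell 0 u = (2 : ℤ) • pair u := LinearMap.ext fun l => by simp [ell_apply]
  rw [this, evalR_smul]
  norm_num

lemma evalR_pair_nonneg {x : RealExt (BigLat σ M M')} (hx : x ∈ d.cell 0 0) {u : M × M'}
    (hu : u ∈ d.U) : 0 ≤ evalR (pair (σ := σ) u) x := by
  have h := (d.mem_cell'.1 hx).2 0 u hu
  rw [evalR_ell_zero, evalR_ell_zero, map_zero, evalR_zero] at h
  linarith

lemma realMap_fst_inl (x : RealExt σ.N) :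
    realMap (LinearMap.fst ℤ σ.N (Module.Dual ℤ M × Module.Dual ℤ M'))
      (realMap (LinearMap.inl ℤ _ _) x) = x := by
  rw [← realMap_comp]
  have : (LinearMap.fst ℤ σ.N (Module.Dual ℤ M × Module.Dual ℤ M')).comp
    (LinearMap.inl ℤ _ _) = LinearMap.id := rfl
  rw [this, realMap_id]

lemma mem_zeroCone {x : RealExt (BigLat σ M M')} : x ∈ zeroCone M' (σ := σ) (M := M) ↔
    ∃ y ∈ σ.cone, realMap (LinearMap.inl ℤ _ _) y = x := Iff.rfl

lemma evalR_pair_inl (u : M × M') (x : RealExt σ.N) :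
    evalR (pair (σ := σ) u) (realMap (LinearMap.inl ℤ _ _) x) = 0 := by
  rw [evalR_realMap]
  have : (pair u).comp (LinearMap.inl ℤ σ.N (Module.Dual ℤ M × Module.Dual ℤ M')) = 0 :=
    LinearMap.ext fun l => by simp
  rw [this, evalR_zero]

/-- On σ × 0 × 0 the function `ell p u` is Q(p, K p + u₁) and `ell 0 0` is 0. Since |l(u₁)| ≤ K, the
value K l(p) + l(u₁) never has sign opposite to l(p). -/
lemma zeroCone_le_cell : zeroCone M' (σ := σ) (M := M) ≤ d.cell 0 0 := by
  intro x hx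
  obtain ⟨y, hy, rfl⟩ := mem_zeroCone.1 hx
  refine d.mem_cell'.2 ⟨by rwa [realMap_fst_inl], fun p u hu => ?_⟩
  rw [evalR_ell_zero, evalR_pair_inl, evalR_realMap]
  have e2 : (d.ell p u).comp (LinearMap.inl ℤ _ _) = Q p (d.K • p + u.1) :=
    LinearMap.ext fun l => by simp [ell_apply]
  rw [e2, mul_zero]
  refine evalR_nonneg_of_latPt (d.pos _ _ fun l hl => ?_) hy
  have hb := abs_le.1 (d.bound 0 d.zero_mem u hu l hl)
  have hK := d.K_pos
  rw [Prod.fst_zero, sub_zero] at hb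
  rw [map_add, map_smul, smul_eq_mul]
  rcases lt_trichotomy (l p) 0 with h3 | h3 | h3
  · exact mul_nonneg_of_nonpos_of_nonpos h3.le (by nlinarith)
  · simp [h3]
  · exact mul_nonneg h3.le (by nlinarith)

lemma mem_zeroCone_of_pair [Module.Free ℤ M] [Module.Finite ℤ M] [Module.Free ℤ M']
    [Module.Finite ℤ M'] {x : RealExt (BigLat σ M M')}
    (hx : realMap (LinearMap.fst ℤ _ _) x ∈ σ.cone)
    (h : ∀ u ∈ d.U, evalR (pair (σ := σ) u) x = 0) : x ∈ zeroCone M' (σ := σ) (M := M) := by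
  set y := realMap (LinearMap.fst ℤ σ.N (Module.Dual ℤ M × Module.Dual ℤ M')) x with hy
  have e : x - realMap (LinearMap.inl ℤ _ _) y = 0 := by
    refine d.eq_zero_of_pair ?_ fun u hu => ?_
    · rw [map_sub, realMap_fst_inl, hy, sub_self]
    · rw [map_sub, h u hu, evalR_pair_inl, sub_zero]
  exact mem_zeroCone.2 ⟨y, hx, (sub_eq_zero.1 e).symm⟩

lemma evalR_pair_of_mem_zeroCone {x : RealExt (BigLat σ M M')}
    (hx : x ∈ zeroCone M' (σ := σ) (M := M)) (u : M × M') : evalR (pair (σ := σ) u) x = 0 := by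
  obtain ⟨z, -, hz⟩ := mem_zeroCone.1 hx
  rw [← hz, evalR_pair_inl]

/-- Comparing `ell 0 u` with `ell 0 0` shows that the pairings with U are nonnegative on `cell 0 0`;
their common zero locus there is σ × 0 × 0. -/
lemma zeroCone_mem_cells [Module.Free ℤ M] [Module.Finite ℤ M] [Module.Free ℤ M']
    [Module.Finite ℤ M'] : zeroCone M' (σ := σ) (M := M) ∈ d.cells := by
  have h : (zeroCone M' (σ := σ) (M := M)).IsFaceOf (d.cell 0 0) :=
    { le := d.zeroCone_le_cell
      mem_of_smul_add_mem := by
        intro x y a hx hy ha hxy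
        refine d.mem_zeroCone_of_pair (d.mem_cell'.1 hx).1 fun u hu => ?_
        have h1 := evalR_pair_of_mem_zeroCone hxy u
        rw [map_add, map_smul, smul_eq_mul] at h1
        have h2 := d.evalR_pair_nonneg hx hu
        have h3 := d.evalR_pair_nonneg hy hu
        have h4 : a * evalR (pair (σ := σ) u) x ≤ 0 := by linarith
        exact le_antisymm (nonpos_of_mul_nonpos_right h4 ha) h2 }
  exact ⟨0, 0, d.zero_mem, h⟩

lemma latPt_mem_cell {m : M} {u : M × M'} {l : BigLat σ M M'} : latPt l ∈ d.cell m u ↔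
    latPt l.1 ∈ σ.cone ∧ ∀ p, ∀ u' ∈ d.U, d.ell m u l ≤ d.ell p u' l := by
  rw [mem_cell', realMap_latPt]
  refine and_congr Iff.rfl ?_
  simp only [evalR_latPt, Int.cast_le]

/-- For x isotropic at n, passing from m to m ± x changes `ell` by ±4K n'(x), so minimality at m
forces n'(x) = 0. -/
lemma mem_admissible_of_mem_cells [Module.Free ℤ M] [Module.Finite ℤ M]
    (hs : ∀ m m' : M, Q m m' = Q m' m) (hQ : IsPosDef Q)
    {C : PointedCone ℝ (RealExt (BigLat σ M M'))} (hC : C ∈ d.cells) {l : BigLat σ M M'}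
    (hl : latPt l ∈ C) : l ∈ admissible Q M' := by
  obtain ⟨m, u, hu, h⟩ := hC
  obtain ⟨h1, h2⟩ := d.latPt_mem_cell.1 (h.le hl)
  refine ⟨h1, ?_⟩
  obtain ⟨k, hk, m₀, hm₀⟩ := exists_smul_eq_of_isotropic (formAt Q l.1)
    (fun x y => by simp [hs x y]) (fun x => hQ.nonneg x h1) l.2.1 (fun x hx => by
      have e : ∀ y, Q x y l.1 = 0 := fun y =>
        apply_eq_zero_of_apply_self (B := formAt Q l.1)
          (fun x y => by simp [hs x y]) (fun x => hQ.nonneg x h1) hx y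
      have e' : ∀ y, Q y x l.1 = 0 := fun y => by rw [hs]; exact e y
      have h3 := h2 (m + x) u hu
      have h4 := h2 (m - x) u hu
      have hK := d.K_pos
      simp only [ell_apply, map_add, map_sub, LinearMap.add_apply, LinearMap.sub_apply, e, e'] at h3 h4
      have h5 : 0 ≤ d.K * l.2.1 x := by linarith
      have h6 : d.K * l.2.1 x ≤ 0 := by linarith
      exact (mul_eq_zero.1 (le_antisymm h6 h5)).resolve_left hK.ne')
  exact ⟨k, hk, m₀, LinearMap.ext hm₀⟩

/-- Rational representability of n' by the form bounds `ell m u` below in m. Its values at l are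
integers, so the minimum is attained. -/
lemma exists_mem_cells (hs : ∀ m m' : M, Q m m' = Q m' m) (hQ : IsPosDef Q)
    {l : BigLat σ M M'} (hl : l ∈ admissible Q M') : ∃ C ∈ d.cells, latPt l ∈ C := by
  obtain ⟨h, k, hk, m₀, hm₀⟩ := hl
  have hK := d.K_pos
  have hk' : (0 : ℤ) < k := by exact_mod_cast hk
  have hkx : ∀ x, (k : ℤ) * l.2.1 x = Q m₀ x l.1 := fun x => by
    have := LinearMap.congr_fun hm₀ x
    rw [LinearMap.smul_apply, QhomN_apply, nsmul_eq_mul] at this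
    exact this
  have hb : ∀ u : M × M', ∃ b : ℤ, ∀ m, b ≤ d.ell m u l := by
    intro u
    -- Completing the square: apart from the term independent of m, k `ell` equals kK Q(m,m) +
    -- Q(m,w), and 4kK times this plus Q(w,w) is the form at 2kK m + w, hence nonnegative.
    let w : M := (4 * d.K) • m₀ + (k : ℤ) • u.1
    refine ⟨-(Q w w l.1) + 2 * (l.2.1 u.1 + l.2.2 u.2) , fun m => ?_⟩
    have h1 := hQ.nonneg ((2 * k * d.K) • m + w) h
    have e1 : k * (d.ell m u l - 2 * (l.2.1 u.1 + l.2.2 u.2)) =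
        k * d.K * Q m m l.1 + Q m w l.1 := by
      have h2 := hkx m
      have h3 := LinearMap.congr_fun (hs m m₀) l.1
      simp only [ell_apply, w, map_add, map_smul, LinearMap.add_apply, LinearMap.smul_apply,
        smul_eq_mul]
      linear_combination (4 * d.K) * h2 - (4 * d.K) * h3
    have e2 : Q ((2 * k * d.K) • m + w) ((2 * k * d.K) • m + w) l.1 =
        4 * (k * d.K) * (k * d.K * Q m m l.1 + Q m w l.1) + Q w w l.1 := by
      have h3 := LinearMap.congr_fun (hs w m) l.1
      simp only [map_add, map_smul, LinearMap.add_apply, LinearMap.smul_apply, smul_eq_mul]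
      linear_combination (2 * k * d.K) * h3
    rw [e2, ← e1] at h1
    have h4 := hQ.nonneg w h
    have h5 : 1 ≤ k * d.K * k := by
      have := mul_pos (mul_pos hk' hK) hk'
      omega
    by_contra hcon
    push Not at hcon
    nlinarith
  choose b hb using hb
  obtain ⟨z, ⟨m, u, hu, hz⟩, hmin⟩ := Int.exists_least_of_bdd
    (P := fun z => ∃ m, ∃ u ∈ d.U, d.ell m u l = z)
    ⟨-∑ u ∈ d.U, |b u|, by
      rintro _ ⟨m, u, hu, rfl⟩
      have h1 := hb u m
      have h2 : |b u| ≤ ∑ u ∈ d.U, |b u| :=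
        Finset.single_le_sum (f := fun u => |b u|) (fun _ _ => abs_nonneg _) hu
      have h3 := neg_abs_le (b u)
      omega⟩ ⟨_, 0, 0, d.zero_mem, rfl⟩
  refine ⟨d.cell m u, ⟨m, u, hu, .refl _⟩, d.latPt_mem_cell.2 ⟨h, fun p u' hu' => ?_⟩⟩
  rw [hz]
  exact hmin _ ⟨p, u', hu', rfl⟩

end CellData

end CellFan

/-! ### Lattice fans with saturated lattices -/

section Saturated

variable {P : RPCᵒᵖ ⥤ Type} {Y : RPCStack}
  {F : Y.toBasedCategory ⥤ᵇ (stackOf P).toBasedCategory}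

/-- If all rays of `x` lift to `Y`, the base change of `Y` along `x` is a subdivision. -/
lemma exists_coneSubdivision (hF : IsMono F) {τ : RPC} (x : P.obj (op τ))
    (hx : IsFiniteConeStack (baseChange F (show (stackOf P).obj from ⟨τ, x⟩)))
    (hr : ∀ r : ray ⟶ τ, P.map r.op x ∈ (imageSub F).obj (op ray)) :
    ∃ Δ : ConeSubdivision τ, ∀ {ρ : RPC} (g : ρ ⟶ τ),
      P.map g.op x ∈ (imageSub F).obj (op ρ) ↔
        ∃ δ ∈ Δ.cones, ∀ z ∈ ρ.cone, realMap (RPCHom.lin g) z ∈ δ := by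
  obtain ⟨Φ, hfin, hΦ, hle, hiff⟩ := exists_isLatticeFan (L := τ.N) F hF
    (show (stackOf P).obj from ⟨τ, x⟩) hx (h := LinearMap.id) Function.injective_id
  have hle : ∀ p ∈ Φ, p.1 ≤ τ.cone := by
    intro p hp y hy
    obtain ⟨z, hz, rfl⟩ := hle p hp hy
    change realMap LinearMap.id z ∈ _
    rw [realMap_id]
    exact hz
  have hiff : ∀ {ρ : RPC} (g : ρ ⟶ τ), P.map g.op x ∈ (imageSub F).obj (op ρ) ↔
      ∃ p ∈ Φ, Factors (RPCHom.lin g) p := hiff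
  have hcov : ∀ n : τ.N, latPt n ∈ τ.cone → ∃ p ∈ Φ, n ∈ p.2 ∧ IsRelInt p.1 (latPt n) := by
    intro n hn
    obtain ⟨p, hp, hf⟩ := (hiff (rayHom n hn)).1 (hr _)
    obtain ⟨q, hq, hfq, hri, -⟩ := hΦ.exists_factors_isRelInt hp hf isRelInt_ray
    change IsRelInt q.1 (latPt (rayLin n (rayPt 1))) at hri
    have h2 := hfq.2 (rayPt 1)
    change rayLin n (rayPt 1) ∈ q.2 at h2
    rw [rayLin_apply, one_smul] at hri h2
    exact ⟨q, hq, h2, hri⟩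
  -- For l in the span and n an interior point in p.2, some k n + l is interior. By `hcov` it lies
  -- in the lattice of a cone having it as interior point, which must be p; so l ∈ p.2.
  have hsat : ∀ p ∈ Φ, ∀ l, latPt l ∈ coneSpan p.1 → l ∈ p.2 := by
    intro p hp l hl
    obtain ⟨n, hn, hri⟩ := (hΦ.isLatticeCone p hp).exists_isRelInt
    obtain ⟨k, -, hk⟩ := hri.exists_nat_smul_add hl
    rw [← latPt_nsmul, ← latPt_add] at hk
    obtain ⟨q, hq, hmem, hq2⟩ := hcov _ (hle p hp hk.1)
    obtain rfl := hΦ.uniq' hp hq hk hq2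
    simpa using p.2.sub_mem hmem (p.2.smul_mem k hn)
  refine ⟨⟨Prod.fst '' Φ, hfin.image _, ?_, ?_, ?_, ?_⟩, ?_⟩
  · rintro _ ⟨p, hp, rfl⟩
    exact (hΦ.isLatticeCone p hp).rational
  · rintro _ ⟨p, hp, rfl⟩ G hG
    exact ⟨_, hΦ.face p hp G hG, rfl⟩
  · rintro _ ⟨p, hp, rfl⟩ _ ⟨q, hq, rfl⟩
    obtain ⟨h1, h2, -⟩ := hΦ.inter hp hq
    exact ⟨h1, h2⟩
  · intro z
    constructor
    · refine IsLatticeGenerated.exists_mem_of_latPt τ.rational.generated (hfin.image _) ?_ ?_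
      · rintro _ ⟨p, hp, rfl⟩
        exact (hΦ.isLatticeCone p hp).rational.generated
      · intro n hn
        obtain ⟨p, hp, -, h⟩ := hcov n hn
        exact ⟨_, ⟨p, hp, rfl⟩, h.1⟩
    · rintro ⟨_, ⟨p, hp, rfl⟩, hz⟩
      exact hle p hp hz
  · intro ρ g
    rw [hiff]
    constructor
    · rintro ⟨p, hp, hf⟩
      exact ⟨_, ⟨p, hp, rfl⟩, fun z hz => realMap_mem_of_latPt hf.1 hz⟩
    · rintro ⟨_, ⟨p, hp, rfl⟩, h⟩
      refine ⟨p, hp, fun n hn => ?_, fun n => hsat p hp _ ?_⟩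
      · rw [← realMap_latPt]
        exact h _ hn
      · have h1 : latPt n ∈ coneSpan ρ.cone := by rw [ρ.full]; trivial
        have h2 : coneSpan (ρ.cone.map (realMap (RPCHom.lin g))) ≤ coneSpan p.1 :=
          coneSpan_mono (by rintro _ ⟨z, hz, rfl⟩; exact h z hz)
        refine h2 ?_
        rw [coneSpan_map, ← realMap_latPt]
        exact ⟨_, h1, rfl⟩

lemma mem_imageSub_homOfLe {S T : Subfunctor P} (hST : S ≤ T) {ρ : RPC}
    (z : T.toFunctor.obj (op ρ)) :
    z ∈ (imageSub (stackMap (Subfunctor.homOfLe hST))).obj (op ρ) ↔ z.1 ∈ S.obj (op ρ) := by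
  rw [mem_imageSub_stackMap]
  constructor
  · rintro ⟨y, rfl⟩
    exact y.2
  · intro hz
    exact ⟨⟨_, hz⟩, rfl⟩

lemma isMono_homOfLe {S T : Subfunctor P} (hST : S ≤ T) :
    IsMono (stackMap (Subfunctor.homOfLe hST)) := by
  refine isMono_stackMap _ fun τ a b hab => ?_
  have : (S.ι.app τ) a = (S.ι.app τ) b := congrArg (T.ι.app τ) hab
  exact Subtype.ext this

/-- All rays of a point of T lie in the image of F, so `exists_coneSubdivision` applies to it, and
on points of T the subfunctor S coincides with that image. -/
lemma isSubdivision_homOfLe (hF : IsMono F) (hx : ∀ x, IsFiniteConeStack (baseChange F x))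
    {S T : Subfunctor P} (hST : S ≤ T)
    (h : ∀ (τ : RPC) (x : P.obj (op τ)), x ∈ T.obj (op τ) →
      (x ∈ S.obj (op τ) ↔ x ∈ (imageSub F).obj (op τ)))
    (hr : ∀ x : P.obj (op ray), x ∈ T.obj (op ray) → x ∈ (imageSub F).obj (op ray)) :
    IsSubdivision (stackMap (Subfunctor.homOfLe hST)) := by
  rintro ⟨τ, x⟩
  obtain ⟨Δ, hΔ⟩ := exists_coneSubdivision hF x.1 (hx _) fun r => hr _ (T.map r.op x.2)
  have hm := isMono_homOfLe hST
  refine ⟨Δ, full_baseChangeProj _ hm _, faithful_baseChangeProj _ hm _, fun f => ?_⟩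
  refine (essImage_baseChangeProj (stackMap (Subfunctor.homOfLe hST))
    (show (stackOf T.toFunctor).obj from ⟨τ, x⟩) f.hom).trans (Iff.trans ?_ (hΔ f.hom))
  exact (mem_imageSub_homOfLe hST (T.toFunctor.map f.hom.op x)).trans
    (h _ _ (T.map f.hom.op x.2))

end Saturated

/-! ### Lattice points of stacky fans -/

section LatticePoints

variable {L : Type} [AddCommGroup L]

open scoped Pointwise in
-- The convex hull of the lattice points of C is closed under addition, and it contains each c l
-- with c ≥ 0, which lies between 0 and a multiple n l. So it contains all nonnegative combinations
-- of generators.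
lemma convex_cone_latPt {S : Set L} (C : PointedCone ℝ (RealExt L)) (hC : IsLatticeGenerated C)
    (h : ∀ l, latPt l ∈ C → l ∈ S) : (C : Set (RealExt L)) ⊆ convexHull ℝ (latPt '' S) := by
  let A : Set (RealExt L) := latPt '' {l : L | latPt l ∈ C}
  have hA : A ⊆ latPt '' S := Set.image_mono h
  refine Set.Subset.trans ?_ (convexHull_mono hA)
  have hadd : ∀ x ∈ convexHull ℝ A, ∀ y ∈ convexHull ℝ A, x + y ∈ convexHull ℝ A := by
    intro x hx y hy
    have h1 : x + y ∈ convexHull ℝ (A + A) := by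
      rw [convexHull_add]
      exact Set.add_mem_add hx hy
    refine convexHull_mono ?_ h1
    rintro _ ⟨_, ⟨a, ha, rfl⟩, _, ⟨b, hb, rfl⟩, rfl⟩
    refine ⟨a + b, ?_, latPt_add a b⟩
    change latPt (a + b) ∈ C
    rw [latPt_add]
    exact C.add_mem ha hb
  have h0 : (0 : RealExt L) ∈ A := ⟨0, by simp [latPt_zero], latPt_zero⟩
  have hsmul : ∀ c : ℝ, 0 ≤ c → ∀ x ∈ A, c • x ∈ convexHull ℝ A := by
    rintro c hc _ ⟨l, hl, rfl⟩
    obtain ⟨n, hn⟩ := exists_nat_gt c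
    have hn0 : (0 : ℝ) < n := hc.trans_lt hn
    have h1 : latPt (n • l) ∈ A := ⟨n • l, by
      change latPt (n • l) ∈ C
      rw [latPt_nsmul]
      exact C.smul_mem n.cast_nonneg hl, rfl⟩
    have h2 := convex_convexHull ℝ A (subset_convexHull ℝ A h0) (subset_convexHull ℝ A h1)
      (a := 1 - c / n) (b := c / n) (by
        rw [sub_nonneg, div_le_one hn0]
        exact hn.le) (by positivity) (by ring)
    rwa [smul_zero, zero_add, latPt_nsmul, smul_smul, div_mul_cancel₀ _ hn0.ne'] at h2
  obtain ⟨s, hs⟩ := hC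
  intro x hx
  rw [hs] at hx
  obtain ⟨c, hc, rfl⟩ := mem_hull_latPt.1 hx
  have hsum : ∀ t : Finset L, t ⊆ s → ∑ i ∈ t, c i • latPt i ∈ convexHull ℝ A := by
    classical
    intro t
    induction t using Finset.induction_on with
    | empty => exact fun _ => subset_convexHull ℝ A h0
    | insert a t ha ih =>
      intro ht
      rw [Finset.sum_insert ha]
      refine hadd _ (hsmul _ (hc a) _ ⟨a, ?_, rfl⟩) _
        (ih ((Finset.subset_insert a t).trans ht))
      change latPt a ∈ C
      rw [hs]
      exact PointedCone.subset_hull ⟨a, ht (Finset.mem_insert_self a t), rfl⟩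
  exact hsum s subset_rfl

lemma IsLatticeCone.exists_nsmul_of_mem_span [Module.Finite ℤ L]
    {p : PointedCone ℝ (RealExt L) × Submodule ℤ L} (hp : IsLatticeCone p) {l : L}
    (hl : latPt l ∈ coneSpan p.1) : ∃ k : ℕ, 0 < k ∧ k • l ∈ p.2 := by
  refine exists_nsmul_mem_of_latPt_mem_span (Submodule.span_le.2 ?_ hl)
  obtain ⟨s, hs⟩ := hp.rational.generated
  intro x hx
  have hx : x ∈ p.1 := hx
  rw [hs] at hx
  obtain ⟨c, -, rfl⟩ := mem_hull_latPt.1 hx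
  refine Submodule.sum_mem _ fun v hv => Submodule.smul_mem _ _ ?_
  obtain ⟨k, hk, hkv⟩ := hp.exists_nsmul v
    (by rw [hs]; exact PointedCone.subset_hull ⟨v, hv, rfl⟩)
  have hk0 : (k : ℝ) ≠ 0 := by exact_mod_cast hk.ne'
  have e : latPt v = (k : ℝ)⁻¹ • latPt (k • v) := by
    rw [latPt_nsmul, smul_smul, inv_mul_cancel₀ hk0, one_smul]
  rw [e]
  exact Submodule.smul_mem _ _ (Submodule.subset_span ⟨_, hkv, rfl⟩)

/-- The quotient is finitely generated and torsion, hence finite. -/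
lemma IsLatticeCone.relIndex_ne_zero [Module.Finite ℤ L]
    {p : PointedCone ℝ (RealExt L) × Submodule ℤ L} (hp : IsLatticeCone p) :
    p.2.toAddSubgroup.relIndex (spanLat p.1) ≠ 0 := by
  have : Module.Finite ℤ (spanMod p.1) := inferInstance
  have h1 : Module.Finite ℤ (spanLat p.1) := this
  let H := p.2.toAddSubgroup.addSubgroupOf (spanLat p.1)
  have h2 : Module.Finite ℤ (spanLat p.1 ⧸ H) :=
    Module.Finite.of_surjective (QuotientAddGroup.mk' H).toIntLinearMap
      (QuotientAddGroup.mk'_surjective H)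
  have h3 : Module.IsTorsion ℤ (spanLat p.1 ⧸ H) := by
    intro a
    obtain ⟨⟨l, hl⟩, rfl⟩ := QuotientAddGroup.mk'_surjective H a
    obtain ⟨k, hk, hkl⟩ := hp.exists_nsmul_of_mem_span hl
    refine ⟨⟨(k : ℤ), mem_nonZeroDivisors_of_ne_zero (by exact_mod_cast hk.ne')⟩, ?_⟩
    rw [Submonoid.mk_smul, natCast_zsmul, ← map_nsmul]
    exact (QuotientAddGroup.eq_zero_iff _).2 (AddSubgroup.mem_addSubgroupOf.2 hkl)
  have h4 : Finite (spanLat p.1 ⧸ H) := Module.finite_of_fg_torsion _ h3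
  exact AddSubgroup.index_ne_zero_of_finite (H := H)

end LatticePoints

lemma toAddSubgroup_spanMod {L : Type} [AddCommGroup L] (C : PointedCone ℝ (RealExt L)) :
    (spanMod C).toAddSubgroup = spanLat C :=
  AddSubgroup.ext fun _ => Iff.rfl

/-! ### Gluing the fans of a partial compactification -/

section Glue

variable {σ : RPC} {M : Type} [AddCommGroup M] {Q : M →ₗ[ℤ] M →ₗ[ℤ] Module.Dual ℤ σ.N}
  {M' : Type} [AddCommGroup M']

/-- The lift `h` defines a point of `R`. -/
def IsPt (hs : ∀ m m' : M, Q m m' = Q m' m) (hQ : IsPosDef Q)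
    (R : Subfunctor (tropSemiabelian Q M')) {ρ : RPC} (h : ρ.N →ₗ[ℤ] BigLat σ M M') : Prop :=
  ∃ hh : IsLift Q h, liftPoint hs hQ h hh ∈ R.obj (op ρ)

section

variable {hs : ∀ m m' : M, Q m m' = Q m' m} {hQ : IsPosDef Q}
  {R : Subfunctor (tropSemiabelian Q M')}

lemma IsPt.translate {τ : RPC} {h : τ.N →ₗ[ℤ] BigLat σ M M'} (hh : IsPt hs hQ R h) (m : M) :
    IsPt hs hQ R ((translate Q M' m).comp h) := by
  obtain ⟨h1, h2⟩ := hh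
  refine ⟨h1.translate m, ?_⟩
  rwa [← (liftPoint_eq_iff hs hQ h1 (h1.translate m)).2 ⟨m, rfl⟩]

lemma IsPt.translate_iff {τ : RPC} {h : τ.N →ₗ[ℤ] BigLat σ M M'} (m : M) :
    IsPt hs hQ R ((TropMin.translate Q M' m).comp h) ↔ IsPt hs hQ R h := by
  refine ⟨fun hh => ?_, fun hh => hh.translate m⟩
  have := hh.translate (-m)
  rwa [← LinearMap.comp_assoc, translate_comp, neg_add_cancel, translate_zero,
    LinearMap.id_comp] at this

end

/-- The fan of a monomorphism over a cone of admissible points. -/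
lemma exists_localFan [Module.Free ℤ M] [Module.Finite ℤ M] [Module.Free ℤ M'] [Module.Finite ℤ M']
    (hs : ∀ m m' : M, Q m m' = Q m' m) (hQ : IsPosDef Q) {Y : RPCStack}
    {F : Y.toBasedCategory ⥤ᵇ (semiabStack Q M').toBasedCategory} (hF : IsMono F)
    (hx : ∀ x, IsFiniteConeStack (baseChange F x)) {δ : PointedCone ℝ (RealExt (BigLat σ M M'))}
    (hδ : IsRationalCone δ) (hadm : ∀ l, latPt l ∈ δ → l ∈ admissible Q M') :
    ∃ Φ : Set (PointedCone ℝ (RealExt (BigLat σ M M')) × Submodule ℤ (BigLat σ M M')),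
      Φ.Finite ∧ IsLatticeFan Φ ∧ (∀ p ∈ Φ, p.1 ≤ δ) ∧
      ∀ {ρ : RPC} (g : ρ.N →ₗ[ℤ] BigLat σ M M'), (∀ n, latPt n ∈ ρ.cone → latPt (g n) ∈ δ) →
        (IsPt hs hQ (imageSub (P := tropSemiabelian Q M') F) g ↔ ∃ p ∈ Φ, Factors g p) := by
  -- With its saturated lattice, δ is an RPC whose inclusion is a lift, that is, a point of X along
  -- which F can be base changed. Saturation lets every g that maps into δ factor through it.
  have hp := isLatticeCone_spanMod hδ
  let τ := latticeConeRPC _ hp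
  let h : τ.N →ₗ[ℤ] BigLat σ M M' := latticeConeIncl hp
  have hh : IsLift Q h := fun n hn => hadm _ ((latPt_mem_latticeCone hp).1 hn)
  obtain ⟨Φ, hfin, hΦ, hle, hiff⟩ := exists_isLatticeFan (P := tropSemiabelian Q M') F hF
    (⟨τ, liftPoint hs hQ h hh⟩ : PshPt (tropSemiabelian Q M')) (hx _)
    (h := h) (latticeConeIncl_injective hp)
  refine ⟨Φ, hfin, hΦ, fun p hp' => (hle p hp').trans (map_latticeCone hp).le, fun {ρ} g hg => ?_⟩
  have hspan : ∀ n, g n ∈ spanMod δ := by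
    intro n
    have h1 : latPt n ∈ coneSpan ρ.cone := by rw [ρ.full]; trivial
    have h2 : coneSpan (ρ.cone.map (realMap g)) ≤ coneSpan δ :=
      coneSpan_mono (by rintro _ ⟨z, hz, rfl⟩; exact realMap_mem_of_latPt hg hz)
    refine h2 ?_
    rw [coneSpan_map, ← realMap_latPt]
    exact ⟨_, h1, rfl⟩
  let g' : ρ ⟶ τ := RPC.homMk (g.codRestrict _ hspan) fun n hn =>
    (latPt_mem_latticeCone hp).2 (hg n hn)
  have e : h.comp (RPCHom.lin g') = g := rfl
  have h3 := hiff g'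
  rw [← e]
  refine Iff.trans ?_ h3
  exact ⟨fun ⟨_, h⟩ => h, fun h => ⟨hh.comp g', h⟩⟩

/-- Compatible fans over the cells. -/
structure LocalFans (hs : ∀ m m' : M, Q m m' = Q m' m) (hQ : IsPosDef Q) (d : CellData Q M')
    (R : Subfunctor (tropSemiabelian Q M')) where
  fan : PointedCone ℝ (RealExt (BigLat σ M M')) →
    Set (PointedCone ℝ (RealExt (BigLat σ M M')) × Submodule ℤ (BigLat σ M M'))
  finite : ∀ δ ∈ d.cells, (fan δ).Finite
  isLatticeFan : ∀ δ ∈ d.cells, IsLatticeFan (fan δ)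
  le : ∀ δ ∈ d.cells, ∀ p ∈ fan δ, p.1 ≤ δ
  isPt_iff : ∀ δ ∈ d.cells, ∀ {ρ : RPC} (g : ρ.N →ₗ[ℤ] BigLat σ M M'),
    (∀ n, latPt n ∈ ρ.cone → latPt (g n) ∈ δ) → (IsPt hs hQ R g ↔ ∃ p ∈ fan δ, Factors g p)

lemma nonempty_localFans [Module.Free ℤ M] [Module.Finite ℤ M] [Module.Free ℤ M']
    [Module.Finite ℤ M'] (hs : ∀ m m' : M, Q m m' = Q m' m) (hQ : IsPosDef Q) (d : CellData Q M')
    {Y : RPCStack} {F : Y.toBasedCategory ⥤ᵇ (semiabStack Q M').toBasedCategory} (hF : IsMono F)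
    (hx : ∀ x, IsFiniteConeStack (baseChange F x)) :
    Nonempty (LocalFans hs hQ d (imageSub (P := tropSemiabelian Q M') F)) := by
  have key : ∀ δ : PointedCone ℝ (RealExt (BigLat σ M M')), ∃ Φ : Set (PointedCone ℝ
      (RealExt (BigLat σ M M')) × Submodule ℤ (BigLat σ M M')), δ ∈ d.cells →
      Φ.Finite ∧ IsLatticeFan Φ ∧ (∀ p ∈ Φ, p.1 ≤ δ) ∧
      ∀ {ρ : RPC} (g : ρ.N →ₗ[ℤ] BigLat σ M M'), (∀ n, latPt n ∈ ρ.cone → latPt (g n) ∈ δ) →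
        (IsPt hs hQ (imageSub (P := tropSemiabelian Q M') F) g ↔ ∃ p ∈ Φ, Factors g p) := by
    intro δ
    by_cases hδ : δ ∈ d.cells
    · obtain ⟨Φ, h⟩ := exists_localFan hs hQ hF hx (d.isRationalCone_of_mem hs hδ)
        fun l hl => d.mem_admissible_of_mem_cells hs hQ hδ hl
      exact ⟨Φ, fun _ => h⟩
    · exact ⟨∅, fun h => absurd h hδ⟩
  choose Φ hΦ using key
  exact ⟨⟨Φ, fun δ h => (hΦ δ h).1, fun δ h => (hΦ δ h).2.1, fun δ h => (hΦ δ h).2.2.1,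
    fun δ h => (hΦ δ h).2.2.2⟩⟩

lemma eq_inl_of_mem_span [Module.Finite ℤ M] [Module.Finite ℤ M']
    {l : BigLat σ M M'} (hl : l ∈ spanMod (zeroCone M' (σ := σ) (M := M))) :
    l = LinearMap.inl ℤ _ _ l.1 := by
  rw [mem_spanMod, zeroCone, coneSpan_map] at hl
  obtain ⟨y, -, hy⟩ := hl
  have h1 : realMap (LinearMap.snd ℤ σ.N (Module.Dual ℤ M × Module.Dual ℤ M')) (latPt l) = 0 := by
    rw [← hy, ← realMap_comp]
    have : (LinearMap.snd ℤ σ.N (Module.Dual ℤ M × Module.Dual ℤ M')).comp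
      (LinearMap.inl ℤ _ _) = 0 := rfl
    rw [this, realMap, LinearMap.baseChange_zero, LinearMap.zero_apply]
  rw [realMap_latPt, ← latPt_zero] at h1
  exact Prod.ext rfl (latPt_injective h1)

namespace LocalFans

variable {hs : ∀ m m' : M, Q m m' = Q m' m} {hQ : IsPosDef Q} {d : CellData Q M'}
  {R : Subfunctor (tropSemiabelian Q M')} (Ψ : LocalFans hs hQ d R)

/-- The union of the fans over all cells. -/
def total : Set (PointedCone ℝ (RealExt (BigLat σ M M')) × Submodule ℤ (BigLat σ M M')) :=
  {p | ∃ δ ∈ d.cells, p ∈ Ψ.fan δ}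

lemma exists_relInt {δ : PointedCone ℝ (RealExt (BigLat σ M M'))} (hδ : δ ∈ d.cells)
    {p : PointedCone ℝ (RealExt (BigLat σ M M')) × Submodule ℤ (BigLat σ M M')}
    (hp : p ∈ Ψ.fan δ) : ∃ l ∈ p.2, IsRelInt p.1 (latPt l) :=
  ((Ψ.isLatticeFan δ hδ).isLatticeCone p hp).exists_isRelInt

lemma mem_image_fst_of_spanMod {C : PointedCone ℝ (RealExt (BigLat σ M M'))}
    (h : (C, spanMod C) ∈ Ψ.total) : C ∈ Prod.fst '' Ψ.total := ⟨_, h, rfl⟩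

variable [Module.Free ℤ M] [Module.Finite ℤ M] [Module.Free ℤ M'] [Module.Finite ℤ M']

/-- A translate of a cone of the fan over `δ` is contained in a cone of the fan over any cell
containing a relatively interior point of it. -/
lemma exists_le {δ δ' : PointedCone ℝ (RealExt (BigLat σ M M'))} (hδ : δ ∈ d.cells)
    (hδ' : δ' ∈ d.cells)
    {p : PointedCone ℝ (RealExt (BigLat σ M M')) × Submodule ℤ (BigLat σ M M')}
    (hp : p ∈ Ψ.fan δ) (m : M) {l : BigLat σ M M'} (hl : l ∈ p.2) (hri : IsRelInt p.1 (latPt l))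
    (hl' : latPt (translate Q M' m l) ∈ δ') :
    ∃ q ∈ Ψ.fan δ', IsRelInt q.1 (latPt (translate Q M' m l)) ∧
      p.1.map (realMap (translate Q M' m)) ≤ q.1 ∧ p.2.map (translate Q M' m) ≤ q.2 := by
  have hL := (Ψ.isLatticeFan δ hδ).isLatticeCone p hp
  let τ := latticeConeRPC p hL
  let i : τ.N →ₗ[ℤ] BigLat σ M M' := latticeConeIncl hL
  have hi : IsPt hs hQ R i := (Ψ.isPt_iff δ hδ i fun n hn =>
    Ψ.le δ hδ p hp ((latPt_mem_latticeCone hL).1 hn)).2 ⟨p, hp, factors_latticeConeIncl hL⟩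
  -- The translate of δ meets δ' in a face; the translate of p.1 has an interior point in that face,
  -- hence lies in it.
  have hsub : p.1.map (realMap (translate Q M' m)) ≤ δ' := by
    have h1 : p.1.map (realMap (translate Q M' m)) ≤ δ.map (realMap (translate Q M' m)) := by
      rintro _ ⟨x, hx, rfl⟩
      exact ⟨x, Ψ.le δ hδ p hp hx, rfl⟩
    have hTδ := d.translate_cells hs hδ m
    have hri' := hri.map_translate (Q := Q) m
    exact (hri'.le_of_mem_face h1 (d.inter_cells hTδ hδ') ⟨h1 hri'.1, hl'⟩).trans inf_le_right
  have hmaps : ∀ n, latPt n ∈ τ.cone → latPt (((translate Q M' m).comp i) n) ∈ δ' := by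
    intro n hn
    refine hsub ⟨_, (latPt_mem_latticeCone hL).1 hn, ?_⟩
    exact realMap_latPt _ _
  obtain ⟨q₀, hq₀, hf⟩ := (Ψ.isPt_iff δ' hδ' _ hmaps).1 (hi.translate m)
  let n₀ : τ.N := (⟨l, hl⟩ : p.2)
  have hn : IsRelInt τ.cone (latPt n₀) := by
    refine isRelInt_of_map (realMap_injective (latticeConeIncl_injective hL)) ?_
    have e : realMap (latticeConeIncl hL) (latPt n₀) = latPt l := realMap_latPt _ _
    rw [map_latticeCone hL, e]
    exact hri
  obtain ⟨q, hq, hfq, hrq, -⟩ := (Ψ.isLatticeFan δ' hδ').exists_factors_isRelInt hq₀ hf hn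
  refine ⟨q, hq, hrq, ?_, ?_⟩
  · rw [← map_latticeCone hL]
    rintro _ ⟨_, ⟨x, hx, rfl⟩, rfl⟩
    have := realMap_mem_of_latPt hfq.1 hx
    rwa [realMap_comp] at this
  · rintro _ ⟨x, hx, rfl⟩
    exact hfq.2 ⟨x, hx⟩

/-- Translates of cones of the fans are cones of the fans. -/
lemma map_translate_mem {δ δ' : PointedCone ℝ (RealExt (BigLat σ M M'))} (hδ : δ ∈ d.cells)
    (hδ' : δ' ∈ d.cells)
    {p : PointedCone ℝ (RealExt (BigLat σ M M')) × Submodule ℤ (BigLat σ M M')}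
    (hp : p ∈ Ψ.fan δ) (m : M) {l : BigLat σ M M'} (hl : l ∈ p.2) (hri : IsRelInt p.1 (latPt l))
    (hl' : latPt (translate Q M' m l) ∈ δ') :
    (p.1.map (realMap (translate Q M' m)), p.2.map (translate Q M' m)) ∈ Ψ.fan δ' := by
  obtain ⟨q, hq, hqr, h1, h2⟩ := Ψ.exists_le hδ hδ' hp m hl hri hl'
  -- Translating back by −m gives a cone over δ with l in its interior, which must be p; so both
  -- inclusions are equalities.
  have e : translate Q M' (-m) (translate Q M' m l) = l := translate_neg_translate m l
  obtain ⟨p', hp', hpr, h3, h4⟩ := Ψ.exists_le hδ' hδ hq (-m) (h2 ⟨l, hl, rfl⟩) hqr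
    (by rw [e]; exact Ψ.le δ hδ p hp hri.1)
  rw [e] at hpr
  obtain rfl := (Ψ.isLatticeFan δ hδ).uniq' hp hp' hri hpr
  have e1 : p.1.map (realMap (translate Q M' m)) = q.1 :=
    le_antisymm h1 fun x hx => mem_map_translate.2 (h3 ⟨x, hx, rfl⟩)
  have e2 : p.2.map (translate Q M' m) = q.2 :=
    le_antisymm h2 fun x hx => ⟨_, h4 ⟨x, hx, rfl⟩, translate_translate_neg m x⟩
  rw [e1, e2]
  exact hq

lemma translate_mem_fan {δ : PointedCone ℝ (RealExt (BigLat σ M M'))} (hδ : δ ∈ d.cells)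
    {p : PointedCone ℝ (RealExt (BigLat σ M M')) × Submodule ℤ (BigLat σ M M')}
    (hp : p ∈ Ψ.fan δ) (m : M) :
    (p.1.map (realMap (translate Q M' m)), p.2.map (translate Q M' m)) ∈
      Ψ.fan (δ.map (realMap (translate Q M' m))) := by
  obtain ⟨l, hl, hri⟩ := Ψ.exists_relInt hδ hp
  refine Ψ.map_translate_mem hδ (d.translate_cells hs hδ m) hp m hl hri ?_
  exact ⟨_, Ψ.le δ hδ p hp hri.1, realMap_latPt _ _⟩

lemma mem_fan_of_mem {δ δ' : PointedCone ℝ (RealExt (BigLat σ M M'))} (hδ : δ ∈ d.cells)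
    (hδ' : δ' ∈ d.cells)
    {p : PointedCone ℝ (RealExt (BigLat σ M M')) × Submodule ℤ (BigLat σ M M')}
    (hp : p ∈ Ψ.fan δ) {l : BigLat σ M M'} (hl : l ∈ p.2) (hri : IsRelInt p.1 (latPt l))
    (hl' : latPt l ∈ δ') : p ∈ Ψ.fan δ' := by
  have h := Ψ.map_translate_mem hδ hδ' hp 0 hl hri (by rwa [translate_zero])
  rwa [map_translate_zero, translate_zero, Submodule.map_id] at h

/-- A cone of one local fan belongs to the fan over any cell that contains one interior point of its
lattice, so uniqueness can be tested inside a single cell. -/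
lemma isLatticeFan_total : IsLatticeFan Ψ.total := by
  refine ⟨?_, ?_, ?_⟩
  · rintro p ⟨δ, hδ, hp⟩
    exact (Ψ.isLatticeFan δ hδ).isLatticeCone p hp
  · rintro p ⟨δ, hδ, hp⟩ F hF
    exact ⟨δ, hδ, (Ψ.isLatticeFan δ hδ).face p hp F hF⟩
  · rintro p ⟨δ, hδ, hp⟩ q ⟨δ', hδ', hq⟩ l hlp hlq hrp hrq
    have := Ψ.mem_fan_of_mem hδ hδ' hp hlp hrp (Ψ.le δ' hδ' q hq hrq.1)
    exact (Ψ.isLatticeFan δ' hδ').uniq p this q hq l hlp hlq hrp hrq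

/-- The zero section fills all of σ × 0 × 0 and its saturated lattice, so the cone of the local fan
through which it factors can only be this one. -/
lemma zeroCone_mem_total (hzero : IsPt hs hQ R (ρ := σ) (LinearMap.inl ℤ _ _)) :
    (zeroCone M' (σ := σ) (M := M), spanMod (zeroCone M')) ∈ Ψ.total := by
  have hδ := d.zeroCone_mem_cells
  refine ⟨_, hδ, ?_⟩
  obtain ⟨p, hp, hf⟩ := (Ψ.isPt_iff _ hδ (ρ := σ) (LinearMap.inl ℤ _ _) fun n hn =>
    CellData.mem_zeroCone.2 ⟨_, hn, realMap_latPt _ _⟩).1 hzero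
  have e1 : zeroCone M' (σ := σ) (M := M) = p.1 := by
    refine le_antisymm (fun x hx => ?_) (Ψ.le _ hδ p hp)
    obtain ⟨y, hy, rfl⟩ := CellData.mem_zeroCone.1 hx
    exact realMap_mem_of_latPt hf.1 hy
  have e2 : spanMod (zeroCone M' (σ := σ) (M := M)) = p.2 := by
    refine le_antisymm (fun l hl => ?_)
      (e1 ▸ ((Ψ.isLatticeFan _ hδ).isLatticeCone p hp).le_span)
    rw [eq_inl_of_mem_span hl]
    exact hf.2 l.1
  have e3 : (zeroCone M' (σ := σ) (M := M), spanMod (zeroCone M')) = p := Prod.ext e1 e2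
  rw [e3]
  exact hp

/-- The lattice of a cone of the glued fan. -/
def lat (C : PointedCone ℝ (RealExt (BigLat σ M M'))) : AddSubgroup (BigLat σ M M') :=
  ⨆ (Λ : Submodule ℤ (BigLat σ M M')) (_ : (C, Λ) ∈ Ψ.total), Λ.toAddSubgroup

/-- The supremum defining `lat` has a single term, by `IsLatticeFan.snd_eq`. -/
lemma lat_eq {p : PointedCone ℝ (RealExt (BigLat σ M M')) × Submodule ℤ (BigLat σ M M')}
    (hp : p ∈ Ψ.total) : Ψ.lat p.1 = p.2.toAddSubgroup := by
  refine le_antisymm (iSup₂_le fun Λ hΛ => ?_) (le_iSup₂_of_le p.2 hp le_rfl)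
  have e := congrArg Prod.snd (Ψ.isLatticeFan_total.snd_eq hΛ hp rfl)
  exact (congrArg Submodule.toAddSubgroup e).le

lemma translate_mem_total
    {p : PointedCone ℝ (RealExt (BigLat σ M M')) × Submodule ℤ (BigLat σ M M')}
    (hp : p ∈ Ψ.total) (m : M) :
    (p.1.map (realMap (translate Q M' m)), p.2.map (translate Q M' m)) ∈ Ψ.total := by
  obtain ⟨δ, hδ, hp⟩ := hp
  exact ⟨_, d.translate_cells hs hδ m, Ψ.translate_mem_fan hδ hp m⟩

lemma lat_eq_spanLat {C : PointedCone ℝ (RealExt (BigLat σ M M'))}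
    (h : (C, spanMod C) ∈ Ψ.total) : Ψ.lat C = spanLat C :=
  (Ψ.lat_eq h).trans (toAddSubgroup_spanMod C)

/-- The glued fan as a stacky fan. -/
def stackyFan (hzero : IsPt hs hQ R (ρ := σ) (LinearMap.inl ℤ _ _)) : StackyFan Q M' where
  cones := Prod.fst '' Ψ.total
  lat := Ψ.lat
  rational := by
    rintro _ ⟨p, hp, rfl⟩
    exact (Ψ.isLatticeFan_total.isLatticeCone p hp).rational
  subset := by
    rintro _ ⟨p, hp, rfl⟩
    refine convex_cone_latPt _ (Ψ.isLatticeFan_total.isLatticeCone p hp).rational.generated ?_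
    obtain ⟨δ, hδ, hp⟩ := hp
    exact fun l hl => d.mem_admissible_of_mem_cells hs hQ hδ (Ψ.le δ hδ p hp hl)
  lat_le := by
    rintro _ ⟨p, hp, rfl⟩
    rw [Ψ.lat_eq hp]
    exact (Ψ.isLatticeFan_total.isLatticeCone p hp).le_span
  lat_finiteIndex := by
    rintro _ ⟨p, hp, rfl⟩
    rw [Ψ.lat_eq hp]
    exact (Ψ.isLatticeFan_total.isLatticeCone p hp).relIndex_ne_zero
  inter_face := by
    rintro _ ⟨p, hp, rfl⟩ _ ⟨q, hq, rfl⟩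
    obtain ⟨h1, h2, -⟩ := Ψ.isLatticeFan_total.inter hp hq
    exact ⟨h1, h2⟩
  lat_inter := by
    rintro _ ⟨p, hp, rfl⟩ _ ⟨q, hq, rfl⟩
    rw [Ψ.lat_eq hp, Ψ.lat_eq hq]
    have h := (Ψ.isLatticeFan_total.inter hp hq).2.2
    exact congrArg Submodule.toAddSubgroup h
  face_mem := by
    rintro _ ⟨p, hp, rfl⟩ F hF
    exact ⟨_, Ψ.isLatticeFan_total.face p hp F hF, rfl⟩
  translate_mem := by
    rintro _ ⟨p, hp, rfl⟩ m
    exact ⟨_, Ψ.translate_mem_total hp m, rfl⟩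
  lat_translate := by
    rintro _ ⟨p, hp, rfl⟩ m
    have h := Ψ.lat_eq (Ψ.translate_mem_total hp m)
    rw [Ψ.lat_eq hp]
    exact h
  fixed := by
    rintro _ ⟨p, ⟨δ, hδ, hp⟩, rfl⟩ m x ⟨hx1, hx2⟩
    refine d.fixed_cells hs hQ hδ (Ψ.le δ hδ p hp hx1) ?_
    exact mem_map_translate.2 (Ψ.le δ hδ p hp (mem_map_translate.1 hx2))
  finite := by
    obtain ⟨A, hA, hAd, hAt⟩ := d.finite_cells hs
    refine ⟨⋃ δ ∈ A, Prod.fst '' Ψ.fan δ, hA.biUnion fun δ hδ => (Ψ.finite δ (hAd hδ)).image _,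
      ?_, ?_⟩
    · intro C hC
      simp only [Set.mem_iUnion] at hC
      obtain ⟨δ, hδ, p, hp, rfl⟩ := hC
      exact ⟨p, ⟨δ, hAd hδ, hp⟩, rfl⟩
    · rintro _ ⟨p, ⟨δ, hδ, hp⟩, rfl⟩
      obtain ⟨δ₀, hδ₀, m, rfl⟩ := hAt δ hδ
      have h := Ψ.translate_mem_fan hδ hp (-m)
      rw [map_translate_translate, neg_add_cancel, map_translate_zero] at h
      refine ⟨p.1.map (realMap (translate Q M' (-m))), ?_, m, ?_⟩
      · simp only [Set.mem_iUnion]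
        exact ⟨δ₀, hδ₀, _, h, rfl⟩
      · rw [map_translate_translate, add_neg_cancel, map_translate_zero]
  zero_mem := Ψ.mem_image_fst_of_spanMod (Ψ.zeroCone_mem_total hzero)
  lat_zero := Ψ.lat_eq_spanLat (Ψ.zeroCone_mem_total hzero)

/-- The cells cover the admissible points, and over a cell a ray factors through a cone of the local
fan exactly when its generator lies in the cone and in its lattice. -/
lemma mem_points_stackyFan (hzero : IsPt hs hQ R (ρ := σ) (LinearMap.inl ℤ _ _))
    {l : BigLat σ M M'} : l ∈ (Ψ.stackyFan hzero).points ↔ IsPt hs hQ R (rayLin l) := by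
  constructor
  · rintro ⟨_, ⟨p, ⟨δ, hδ, hp⟩, rfl⟩, h1, h2⟩
    have h2 : l ∈ Ψ.lat p.1 := h2
    rw [Ψ.lat_eq ⟨δ, hδ, hp⟩] at h2
    refine (Ψ.isPt_iff δ hδ _ (rayLin_mem (Ψ.le δ hδ p hp h1))).2 ⟨p, hp, rayLin_mem h1, ?_⟩
    intro n
    obtain ⟨k, rfl⟩ : ∃ k, rayPt k = n := ⟨n, rfl⟩
    rw [rayLin_apply]
    exact p.2.smul_mem k h2
  · intro h
    have h1 : l ∈ admissible Q M' := by
      have := h.1 (rayPt 1) one_mem_ray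
      rwa [rayLin_apply, one_smul] at this
    obtain ⟨δ, hδ, hl⟩ := d.exists_mem_cells hs hQ h1
    obtain ⟨p, hp, hf⟩ := (Ψ.isPt_iff δ hδ _ (rayLin_mem hl)).1 h
    refine ⟨p.1, ⟨p, ⟨δ, hδ, hp⟩, rfl⟩, ?_, ?_⟩
    · have := hf.1 (rayPt 1) one_mem_ray
      rwa [rayLin_apply, one_smul] at this
    · change l ∈ Ψ.lat p.1
      rw [Ψ.lat_eq ⟨δ, hδ, hp⟩]
      have := hf.2 (rayPt 1)
      rwa [rayLin_apply, one_smul] at this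

end LocalFans

end Glue

/-! ### Minimal fans and the two statements of the corollary -/

section MinimalFans

variable {σ : RPC} {M : Type} [AddCommGroup M] {Q : M →ₗ[ℤ] M →ₗ[ℤ] Module.Dual ℤ σ.N}
  {M' : Type} [AddCommGroup M']

/-- Lattice points of the convex hull of the admissible points are admissible. -/
lemma mem_admissible_of_mem_convexHull [Module.Free ℤ M] [Module.Finite ℤ M]
    (hs : ∀ m m' : M, Q m m' = Q m' m) (hQ : IsPosDef Q) {l : BigLat σ M M'}
    (hl : latPt l ∈ convexHull ℝ (latPt '' admissible Q M')) : l ∈ admissible Q M' := by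
  let q : M → Module.Dual ℤ (BigLat σ M M') := fun m => (Q m m).comp (LinearMap.fst ℤ _ _)
  let v : M → Module.Dual ℤ (BigLat σ M M') := fun m => CellData.pair (m, 0)
  -- Admissibility restated for real points: n'(m) vanishes wherever Q(m,m) does. As Q(m,m) ≥ 0, it
  -- vanishes at a convex combination only if it vanishes at every point with nonzero weight, so the
  -- condition is convex.
  let A : Set (RealExt (BigLat σ M M')) := {x | realMap (LinearMap.fst ℤ _ _) x ∈ σ.cone ∧
    ∀ m, 0 ≤ evalR (q m) x ∧ (evalR (q m) x = 0 → evalR (v m) x = 0)}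
  have hA : Convex ℝ A := by
    rintro x ⟨hx1, hx2⟩ y ⟨hy1, hy2⟩ a b ha hb -
    refine ⟨?_, fun m => ?_⟩
    · rw [map_add, map_smul, map_smul]
      exact σ.cone.add_mem (σ.cone.smul_mem ha hx1) (σ.cone.smul_mem hb hy1)
    · obtain ⟨hx3, hx4⟩ := hx2 m
      obtain ⟨hy3, hy4⟩ := hy2 m
      rw [map_add, map_smul, map_smul, map_add, map_smul, map_smul, smul_eq_mul, smul_eq_mul,
        smul_eq_mul, smul_eq_mul]
      have h1 := mul_nonneg ha hx3
      have h2 := mul_nonneg hb hy3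
      refine ⟨add_nonneg h1 h2, fun h => ?_⟩
      have h3 : a * evalR (q m) x = 0 := by linarith
      have h4 : b * evalR (q m) y = 0 := by linarith
      have h5 : a * evalR (v m) x = 0 := by
        rcases mul_eq_zero.1 h3 with h | h
        · rw [h, zero_mul]
        · rw [hx4 h, mul_zero]
      have h6 : b * evalR (v m) y = 0 := by
        rcases mul_eq_zero.1 h4 with h | h
        · rw [h, zero_mul]
        · rw [hy4 h, mul_zero]
      rw [h5, h6, add_zero]
  have hle : latPt '' admissible Q M' ⊆ A := by
    rintro _ ⟨a, ha, rfl⟩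
    refine ⟨by rw [realMap_latPt]; exact ha.1, fun m => ?_⟩
    rw [evalR_latPt, evalR_latPt]
    refine ⟨by exact_mod_cast hQ.nonneg m ha.1, fun h => ?_⟩
    have h1 : Q m m a.1 = 0 := by exact_mod_cast h
    have h2 := apply_eq_zero_of_admissible hs hQ ha h1
    simp [v, h2]
  obtain ⟨h1, h2⟩ := convexHull_min hle hA hl
  rw [realMap_latPt] at h1
  have h1 : latPt l.1 ∈ σ.cone := h1
  refine ⟨h1, ?_⟩
  obtain ⟨k, hk, m, hm⟩ := exists_smul_eq_of_isotropic (formAt Q l.1)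
    (fun x y => by simp [hs x y]) (fun x => hQ.nonneg x h1) l.2.1 (fun x hx => by
      have h3 := (h2 x).2
      rw [evalR_latPt, evalR_latPt] at h3
      have h4 : v x l = 0 := by
        have hx : q x l = 0 := hx
        exact_mod_cast h3 (by exact_mod_cast hx)
      simpa [v] using h4)
  exact ⟨k, hk, m, LinearMap.ext hm⟩

namespace StackyFan

variable (Δ : StackyFan Q M')

lemma translate_mem_points {l : BigLat σ M M'} (hl : l ∈ Δ.points) (m : M) :
    translate Q M' m l ∈ Δ.points := by
  obtain ⟨τ, hτ, h1, h2⟩ := hl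
  refine ⟨_, Δ.translate_mem τ hτ m, ⟨_, h1, realMap_latPt _ _⟩, ?_⟩
  rw [Δ.lat_translate τ hτ m]
  exact ⟨l, h2, rfl⟩

lemma zsmul_mem_points {l : BigLat σ M M'} (hl : l ∈ Δ.points) {n : ℤ} (hn : 0 ≤ n) :
    n • l ∈ Δ.points := by
  obtain ⟨τ, hτ, h1, h2⟩ := hl
  refine ⟨τ, hτ, ?_, zsmul_mem h2 n⟩
  rw [latPt_zsmul]
  exact τ.smul_mem (by exact_mod_cast hn) h1

lemma mem_admissible_of_mem_points [Module.Free ℤ M] [Module.Finite ℤ M]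
    (hs : ∀ m m' : M, Q m m' = Q m' m) (hQ : IsPosDef Q) {l : BigLat σ M M'}
    (hl : l ∈ Δ.points) : l ∈ admissible Q M' := by
  obtain ⟨τ, hτ, h1, -⟩ := hl
  exact mem_admissible_of_mem_convexHull hs hQ (Δ.subset τ hτ h1)

/-- S can be read off from Σ_S, since the points of a stacky fan are admissible and stable under
nonnegative multiples and translations. -/
lemma isPt_rayLin_iff [Module.Free ℤ M] [Module.Finite ℤ M]
    (hs : ∀ m m' : M, Q m m' = Q m' m) (hQ : IsPosDef Q) {l : BigLat σ M M'} :
    IsPt hs hQ (sigmaSub Q Δ.points) (rayLin l) ↔ l ∈ Δ.points := by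
  constructor
  · rintro ⟨hh, h⟩
    have := (liftPoint_mem_sigmaSub hs hQ hh).1 h 0 (rayPt 1) one_mem_ray
    rwa [translate_zero, rayLin_apply, one_smul] at this
  · intro hl
    have h : ∀ n, latPt n ∈ ray.cone → rayLin l n ∈ Δ.points := by
      intro n hn
      obtain ⟨k, rfl⟩ : ∃ k, rayPt k = n := ⟨n, rfl⟩
      rw [rayLin_apply]
      exact Δ.zsmul_mem_points hl (latPt_mem_ray.1 hn)
    have hh : IsLift Q (rayLin l) := fun n hn => Δ.mem_admissible_of_mem_points hs hQ (h n hn)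
    exact ⟨hh, (liftPoint_mem_sigmaSub hs hQ hh).2 fun m n hn =>
      Δ.translate_mem_points (h n hn) m⟩

end StackyFan

lemma imageSub_sigmaIncl (S : Set (BigLat σ M M')) :
    imageSub (P := tropSemiabelian Q M') (sigmaIncl Q S) = sigmaSub Q S :=
  imageSub_subfunctor _

/-- A partial compactification contains the zero section. -/
lemma isPt_inl (hs : ∀ m m' : M, Q m m' = Q m' m) (hQ : IsPosDef Q) {Y : RPCStack}
    {F : Y.toBasedCategory ⥤ᵇ (semiabStack Q M').toBasedCategory}
    (h : ∃ s : (coneStackOf σ).toBasedCategory ⥤ᵇ Y.toBasedCategory,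
      Nonempty (s.comp F ≅ zeroSection Q M')) :
    IsPt hs hQ (imageSub (P := tropSemiabelian Q M') F) (ρ := σ) (LinearMap.inl ℤ _ _) := by
  obtain ⟨s, ⟨i⟩⟩ := h
  refine ⟨isLift_inl (𝟙 σ), s.obj (⟨σ, 𝟙 σ⟩ : PshPt (yoneda.obj σ)), ?_⟩
  exact (map_obj_eq_of_iso (P := tropSemiabelian Q M') (Y := coneStackOf σ) (s.comp F) i
    (⟨σ, 𝟙 σ⟩ : PshPt (yoneda.obj σ))).trans (zeroSection_obj hs hQ (𝟙 σ))

/-- Points all of whose rays are points of `R`. -/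
lemma liftPoint_mem_sigmaSub_rays [Module.Free ℤ M] [Module.Finite ℤ M]
    (hs : ∀ m m' : M, Q m m' = Q m' m) (hQ : IsPosDef Q)
    {R : Subfunctor (tropSemiabelian Q M')} {τ : RPC} (x : (tropSemiabelian Q M').obj (op τ)) :
    x ∈ (sigmaSub Q {l | IsPt hs hQ R (rayLin l)}).obj (op τ) ↔
      ∀ r : ray ⟶ τ, (tropSemiabelian Q M').map r.op x ∈ R.obj (op ray) := by
  obtain ⟨h, hh, rfl⟩ := exists_liftPoint hs hQ x
  rw [liftPoint_mem_sigmaSub]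
  have key : ∀ m n (hn : latPt n ∈ τ.cone), translate Q M' m (h n) ∈ {l | IsPt hs hQ R (rayLin l)} ↔
      (tropSemiabelian Q M').map (rayHom n hn).op (liftPoint hs hQ h hh) ∈ R.obj (op ray) := by
    intro m n hn
    rw [map_liftPoint]
    change IsPt hs hQ R (rayLin (translate Q M' m (h n))) ↔ _
    rw [← comp_rayLin, IsPt.translate_iff, ← comp_rayLin]
    exact ⟨fun ⟨_, h⟩ => h, fun h => ⟨_, h⟩⟩
  constructor
  · intro H r
    have hr : r = rayHom (RPCHom.lin r (rayPt 1)) (RPC.maps_latPt r one_mem_ray) := by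
      refine RPC.hom_ext fun n => ?_
      obtain ⟨k, rfl⟩ : ∃ k, rayPt k = n := ⟨n, rfl⟩
      change _ = rayLin _ (rayPt k)
      rw [rayLin_apply, ← map_smul]
      congr 1
      change k = k • (1 : ℤ)
      simp
    rw [hr]
    exact (key 0 _ _).1 (H 0 _ (RPC.maps_latPt r one_mem_ray))
  · intro H m n hn
    exact (key m n hn).2 (H _)

/-- Minimal generalized compactifications come from minimal fans. -/
lemma IsMinimal.exists_isMinimalFan [Module.Free ℤ M] [Module.Finite ℤ M] [Module.Free ℤ M']
    [Module.Finite ℤ M'] (hs : ∀ m m' : M, Q m m' = Q m' m) (hQ : IsPosDef Q) {Y : RPCStack}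
    {F : Y.toBasedCategory ⥤ᵇ (semiabStack Q M').toBasedCategory}
    (hF : IsGenPartialTropComp (zeroSection Q M') F) (hmin : IsMinimal F) :
    ∃ S : Set (BigLat σ M M'), IsMinimalFan Q M' S ∧ IsoOver F (sigmaIncl Q S) := by
  obtain ⟨hmono, Y', s, hsub, hmono', hrep, hzero⟩ := hF
  let P := tropSemiabelian Q M'
  let E : Subfunctor P := imageSub (P := P) F
  let E' : Subfunctor P := imageSub (P := P) (s.comp F)
  have hE : E' ≤ E := by
    rintro τ x ⟨y, hy⟩
    exact ⟨s.obj y, hy⟩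
  have hray : ∀ x : P.obj (op ray), x ∈ E.obj (op ray) → x ∈ E'.obj (op ray) :=
    fun x hx => mem_imageSub_of_ray (P := P) hsub hx
  obtain ⟨d⟩ := nonempty_cellData M' hs hQ
  obtain ⟨Ψ⟩ := nonempty_localFans hs hQ d hmono' hrep
  have h0 := isPt_inl hs hQ hzero
  let S : Set (BigLat σ M M') := {l | IsPt hs hQ E' (rayLin l)}
  have hS : IsMinimalFan Q M' S :=
    ⟨Ψ.stackyFan h0, Set.ext fun l => (Ψ.mem_points_stackyFan h0).symm⟩
  refine ⟨S, hS, isoOver_of_imageSub_eq (P := P) hmono (isMono_subfunctor _) ?_⟩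
  refine Eq.trans (b := sigmaSub Q S) (le_antisymm ?_ ?_) (imageSub_sigmaIncl S).symm
  -- The rays of a point of E lie in E, hence in E'.
  · intro τ x hx
    refine (liftPoint_mem_sigmaSub_rays hs hQ x).2 fun r => hray _ ?_
    exact E.map r.op hx
  -- Minimality is applied to the subdivision T ⊓ E' → T and the map T ⊓ E' ≤ E' ≤ E to Y. The
  -- resulting T → Y over X shows T ≤ E; its uniqueness plays no role.
  · let T : Subfunctor P := sigmaSub Q S
    have hT : ∀ x : P.obj (op ray), x ∈ T.obj (op ray) → x ∈ E'.obj (op ray) := by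
      intro x hx
      have := (liftPoint_mem_sigmaSub_rays hs hQ x).1 hx (𝟙 ray)
      rwa [op_id, P.map_id] at this
    have hST : T ⊓ E' ≤ T := inf_le_left
    have hsub' : IsSubdivision (stackMap (Subfunctor.homOfLe hST)) :=
      isSubdivision_homOfLe (P := P) hmono' hrep hST
        (fun τ x hx => ⟨fun h => h.2, fun h => ⟨hx, h⟩⟩) hT
    let H : (stackOf (T ⊓ E').toFunctor).toBasedCategory ⥤ᵇ (stackOf P).toBasedCategory :=
      stackMap (T ⊓ E').ι
    obtain ⟨f, hf⟩ := exists_lift (P := P) hmono (Z := stackOf (T ⊓ E').toFunctor) H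
      (fun z => hE _ (z : PshPt (T ⊓ E').toFunctor).pt.2.2)
    obtain ⟨g, ⟨⟨i⟩, -⟩, -⟩ := hmin (stackOf T.toFunctor) (stackOf (T ⊓ E').toFunctor)
      (stackMap T.ι) (stackMap (Subfunctor.homOfLe hST)) f hsub' ⟨eqToIso hf⟩
    intro τ x hx
    refine ⟨g.obj (⟨τ.unop, ⟨x, hx⟩⟩ : PshPt T.toFunctor), ?_⟩
    exact map_obj_eq_of_iso (P := P) (Y := stackOf T.toFunctor) (g.comp F) i
      (⟨τ.unop, ⟨x, hx⟩⟩ : PshPt T.toFunctor)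

/-- Minimal fans are determined by their stacks. -/
lemma IsMinimalFan.eq_of_isoOver [Module.Free ℤ M] [Module.Finite ℤ M]
    (hs : ∀ m m' : M, Q m m' = Q m' m) (hQ : IsPosDef Q) {S S' : Set (BigLat σ M M')}
    (hS : IsMinimalFan Q M' S) (hS' : IsMinimalFan Q M' S')
    (h : IsoOver (sigmaIncl Q S) (sigmaIncl Q S')) : S = S' := by
  obtain ⟨Δ, rfl⟩ := hS
  obtain ⟨Δ', rfl⟩ := hS'
  have e := IsoOver.imageSub_eq (P := tropSemiabelian Q M') h
  rw [imageSub_sigmaIncl, imageSub_sigmaIncl] at e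
  ext l
  rw [← Δ.isPt_rayLin_iff hs hQ, ← Δ'.isPt_rayLin_iff hs hQ, e]

end MinimalFans

end TropMin

end

theorem mainTheorem5 (σ : TropMin.RPC)
    (M : Type) [AddCommGroup M] [Module.Free ℤ M] [Module.Finite ℤ M]
    (Q : M →ₗ[ℤ] M →ₗ[ℤ] Module.Dual ℤ σ.N)
    (hsymm : ∀ m m' : M, Q m m' = Q m' m) (hpos : TropMin.IsPosDef Q)
    (M' : Type) [AddCommGroup M'] [Module.Free ℤ M'] [Module.Finite ℤ M'] :
    (∀ (Y : TropMin.RPCStack)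
        (F : CategoryTheory.BasedFunctor Y.toBasedCategory
          (TropMin.semiabStack Q M').toBasedCategory),
        TropMin.IsGenPartialTropComp (TropMin.zeroSection Q M') F → TropMin.IsMinimal F →
          ∃ S : Set (TropMin.BigLat σ M M'), TropMin.IsMinimalFan Q M' S ∧
            TropMin.IsoOver F (TropMin.sigmaIncl Q S)) ∧
    (∀ S S' : Set (TropMin.BigLat σ M M'),
        TropMin.IsMinimalFan Q M' S → TropMin.IsMinimalFan Q M' S' →
          TropMin.IsoOver (TropMin.sigmaIncl Q S) (TropMin.sigmaIncl Q S') → S = S') :=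
  ⟨fun _ _ hF hmin => hmin.exists_isMinimalFan hsymm hpos hF,
    fun _ _ hS hS' h => hS.eq_of_isoOver hsymm hpos hS' h⟩
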